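/- **Conventions.** Let $k$ be an algebraically closed field. An abelian category is regarded as an exact category whose conflations are the short exact sequences. A full subcategory of an exact category containing a zero object and closed under extensions (a *fully exact subcategory*) carries the induced exact structure, and $\mathcal F(\mathcal X)$ denotes the smallest fully exact subcategory containing a class of objects $\mathcal X$ (its extension closure). For a full subcategory $\mathcal T$ of an exact category $\mathcal E$, $\mathcal T^{\perp}=\{E\in\mathcal E \mid \operatorname{Hom}(\mathcal T,E)=0=\operatorname{Ext}^1(\mathcal T,E)\}$; a fully exact $\mathcal T$ is *right admissible* if every $E\in\mathcal E$ fits into a conflation $T\to E\to F$ with $T\in\mathcal T$, $F\in\mathcal T^\perp$. A nonzero object $E$ of an exact category is *irreducible* if every inflation into $E$ is zero or an isomorphism. A $k$-linear exact category $\mathcal E$ is *thin* if all its $\operatorname{Hom}$ and $\operatorname{Ext}^1$ spaces are finite dimensional and there are right admissible subcategories $0=\mathcal T_0\subset\mathcal T_1\subset\dots\subset\mathcal T_n=\mathcal E$ such that each $\mathcal T_{i-1}^\perp\cap\mathcal T_i$ is equivalent, $k$-linearly, to the category of finite dimensional $k$-vector spaces. A functor $\Psi$ between exact categories is *right exact*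 if it is additive and for every conflation $X\xrightarrow{i}Y\xrightarrow{d}Z$ the morphism $\Psi(d)$ is a deflation with some kernel $i'$, and $\Psi(i)=i'\circ d'$ for a deflation $d'$; *left exact* functors are defined dually. $\operatorname{Rex}$ and $\operatorname{Lex}$ denote the categories of right, respectively left, exact functors and natural transformations. A *right abelian envelope* of $\mathcal E$ is an abelian category $\mathcal A$ with a right exact functor $i_R:\mathcal E\to\mathcal A$ such that $(-)\circ i_R:\operatorname{Rex}(\mathcal A,\mathcal B)\to\operatorname{Rex}(\mathcal E,\mathcal B)$ is an equivalence for every abelian category $\mathcal B$; a *left abelian envelope* is defined in the same way with left exact functors. **Highest weight categories.** Let $\mathcal A$ be a $k$-linear Deligne finite category, i.e. a $k$-linear abelian category with finite dimensional $\operatorname{Hom}$ and $\operatorname{Ext}^1$ spaces, finitely many simple objects up to isomorphism, all objects of finite length, and a projective generator. Let $\Lambda$ be a partial order on the set of isomorphism classes of simple objects; for $\lambda\in\Lambda$ let $L(\lambda)$ be the corresponding simple object, $P(\lambda)$ its projective cover and $I(\lambda)$ its injective hull. The *standard object* $\Delta(\lambda)$ is the maximal quotient of $P(\lambda)$, and the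 *costandard object* $\nabla(\lambda)$ the maximal subobject of $I(\lambda)$, all of whose simple factors are isomorphic to $L(\mu)$ with $\mu\preceq\lambda$. Put $\mathcal F(\Delta_\Lambda)=\mathcal F(\{\Delta(\lambda)\}_{\lambda\in\Lambda})$ and $\mathcal F(\nabla_\Lambda)=\mathcal F(\{\nabla(\lambda)\}_{\lambda\in\Lambda})$. The pair $(\mathcal A,\Lambda)$ is a *highest weight category* if for every $\lambda\in\Lambda$ 1. there is an epimorphism $\Delta(\lambda)\to L(\lambda)$ whose kernel has a finite filtration with graded factors $L(\mu)$, $\mu\prec\lambda$; 2. there is an epimorphism $P(\lambda)\to\Delta(\lambda)$ whose kernel has a finite filtration with graded factors $\Delta(\mu)$, $\mu\succ\lambda$. **Proposition.** Let $(\mathcal A,\Lambda)$ be a highest weight category over $k$. Then $\mathcal F(\Delta_\Lambda)$ and $\mathcal F(\nabla_\Lambda)$ are thin, and $\{\Delta(\lambda)\}_{\lambda\in\Lambda}$, respectively $\{\nabla(\lambda)\}_{\lambda\in\Lambda}$, is a list without repetition of all irreducible objects of $\mathcal F(\Delta_\Lambda)$, respectively $\mathcal F(\nabla_\Lambda)$,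 up to isomorphism. Moreover $\mathcal A$, with the inclusion functor, is the right abelian envelope of $\mathcal F(\Delta_\Lambda)$ and the left abelian envelope of $\mathcal F(\nabla_\Lambda)$. -/

import Mathlib

open CategoryTheory CategoryTheory.Limits

universe u v u₁ v₁ u₂ v₂ u₃ v₃ w

/-! ### Exact categories -/

namespace ExactCat

section Basic

variable {E : Type u} [Category.{v} E] [Preadditive E]

/-- `p` is the second map of a pair of composable maps belonging to the class `c`. -/
def IsDeflationOf (c : ObjectProperty (ShortComplex E)) {Y Z : E} (p : Y ⟶ Z) : Prop :=
  ∃ (X : E) (i : X ⟶ Y) (hw : i ≫ p = 0), c (ShortComplex.mk i p hw)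

/-- `i` is the first map of a pair of composable maps belonging to the class `c`. -/
def IsInflationOf (c : ObjectProperty (ShortComplex E)) {X Y : E} (i : X ⟶ Y) : Prop :=
  ∃ (Z : E) (p : Y ⟶ Z) (hw : i ≫ p = 0), c (ShortComplex.mk i p hw)

end Basic

/-- The structure of an exact category (in the sense of Quillen and Keller) on a preadditive
category `E`: `E` is additive, and it carries a class of conflations. -/
structure ExactStructure (E : Type u) [Category.{v} E] [Preadditive E] where
  hasZeroObject : HasZeroObject E
  hasBinaryBiproducts : HasBinaryBiproducts E
  /-- the class of conflations -/
  conf : ObjectProperty (ShortComplex E)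
  of_iso : ∀ {S T : ShortComplex E}, (S ≅ T) → conf S → conf T
  isKernel : ∀ S : ShortComplex E, conf S → Nonempty (IsLimit (KernelFork.ofι S.f S.zero))
  isCokernel : ∀ S : ShortComplex E, conf S → Nonempty (IsColimit (CokernelCofork.ofπ S.g S.zero))
  ex0 : ∀ X Z : E, IsZero Z → conf (ShortComplex.mk (0 : Z ⟶ X) (𝟙 X) zero_comp)
  ex1 : ∀ {X Y Z : E} (p : X ⟶ Y) (q : Y ⟶ Z),
    IsDeflationOf conf p → IsDeflationOf conf q → IsDeflationOf conf (p ≫ q)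
  ex2 : ∀ {Y Z W : E} (p : Y ⟶ Z) (f : W ⟶ Z), IsDeflationOf conf p →
    ∃ (V : E) (f' : V ⟶ Y) (p' : V ⟶ W), IsPullback f' p' p f ∧ IsDeflationOf conf p'
  ex2' : ∀ {X Y W : E} (i : X ⟶ Y) (f : X ⟶ W), IsInflationOf conf i →
    ∃ (V : E) (f' : Y ⟶ V) (i' : W ⟶ V), IsPushout i f f' i' ∧ IsInflationOf conf i'

namespace ExactStructure

section

variable {E : Type u} [Category.{v} E] [Preadditive E] (S : ExactStructure E)

def IsDeflation {Y Z : E} (p : Y ⟶ Z) : Prop := IsDeflationOf S.conf p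

def IsInflation {X Y : E} (i : X ⟶ Y) : Prop := IsInflationOf S.conf i

/-- A nonzero object such that every inflation into it is zero or an isomorphism. -/
def IsIrreducible (X : E) : Prop :=
  ¬ IsZero X ∧ ∀ (Y : E) (i : Y ⟶ X), S.IsInflation i → i = 0 ∨ IsIso i

/-- An extension of `Z` by `X`: a conflation `X ⟶ mid ⟶ Z`. -/
structure Extension (Z X : E) where
  mid : E
  i : X ⟶ mid
  p : mid ⟶ Z
  zero : i ≫ p = 0
  conf : S.conf (ShortComplex.mk i p zero)

/-- `Ext¹(Z, X) = 0`: every extension of `Z` by `X` splits. -/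
def ExtVanishes (Z X : E) : Prop :=
  ∀ e : S.Extension Z X, Nonempty (ShortComplex.mk e.i e.p e.zero).Splitting

/-- The class of `e` in `Ext¹(Z, X)` is the linear combination `∑ⱼ aⱼ [eⱼ]` for the Baer sum
and the scalar multiplication by pushforward. Namely, let `Xⁿ` be the product of `n` copies of `X`,
with projections `πⱼ`. There is an extension `η` of `Z` by `Xⁿ` whose pushforward along `πⱼ`
is `eⱼ` for all `j` (that is, `η` corresponds to `(e₁, …, eₙ)` under
`Ext¹(Z, Xⁿ) = Ext¹(Z, X)ⁿ`; it is the pullback of `e₁ ⊕ ⋯ ⊕ eₙ` along the diagonal of `Z`) and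
whose pushforward along `∑ⱼ aⱼ πⱼ : Xⁿ ⟶ X` is `e`. A morphism of conflations that is the identity
on the right exhibits its target as the pushforward of its source. -/
def IsBaerCombination (k : Type u₁) [Field k] [Linear k E] {Z X : E} {n : ℕ}
    (a : Fin n → k) (e' : Fin n → S.Extension Z X) (e : S.Extension Z X) : Prop :=
  ∃ (V : E) (π : Fin n → (V ⟶ X)) (_ : Nonempty (IsLimit (Fan.mk V π))) (η : S.Extension Z V),
    (∀ j, ∃ m : η.mid ⟶ (e' j).mid, η.i ≫ m = π j ≫ (e' j).i ∧ m ≫ (e' j).p = η.p) ∧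
    ∃ m : η.mid ⟶ e.mid, η.i ≫ m = (∑ j, a j • π j) ≫ e.i ∧ m ≫ e.p = η.p

/-- `Ext¹(Z, X)` is a finite dimensional vector space over `k`: it is spanned by finitely many
classes of extensions. -/
def ExtFinite (k : Type u₁) [Field k] [Linear k E] (Z X : E) : Prop :=
  ∃ (n : ℕ) (e' : Fin n → S.Extension Z X), ∀ e : S.Extension Z X,
    ∃ a : Fin n → k, S.IsBaerCombination k a e' e

/-- The right perpendicular subcategory `Tᗮ = {F | Hom(T, F) = 0 = Ext¹(T, F)}`. -/
def rightPerp (T : ObjectProperty E) : ObjectProperty E := fun F =>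
  ∀ X, T X → (∀ f : X ⟶ F, f = 0) ∧ S.ExtVanishes X F

/-- The full subcategory `P` is nonempty, in the sense of containing a zero object, and closed
under extensions; such subcategories are the fully exact subcategories. -/
structure IsFullyExact (P : ObjectProperty E) : Prop where
  zero : ∃ Z, IsZero Z ∧ P Z
  ext : ∀ T : ShortComplex E, S.conf T → P T.X₁ → P T.X₃ → P T.X₂

/-- `T` is right admissible: it is fully exact and `(T, Tᗮ)` is a torsion pair. -/
structure IsRightAdmissible (T : ObjectProperty E) : Prop where
  fullyExact : S.IsFullyExact T
  torsion : ∀ Y : E, ∃ C : ShortComplex E, S.conf C ∧ C.X₂ = Y ∧ T C.X₁ ∧ S.rightPerp T C.X₃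

/-- The extension closure of a class of objects (the smallest fully exact subcategory that
contains it). -/
inductive ExtClosure (P : ObjectProperty E) : ObjectProperty E
  | zero (Z : E) (hZ : IsZero Z) : ExtClosure P Z
  | of (X : E) (hX : P X) : ExtClosure P X
  | ext (T : ShortComplex E) (hT : S.conf T) (h₁ : ExtClosure P T.X₁) (h₃ : ExtClosure P T.X₃) :
      ExtClosure P T.X₂

/-- A `k`-linear exact category is thin if it is Hom- and `Ext¹`-finite and has a finite filtration
by right admissible subcategories `0 = T₀ ⊆ T₁ ⊆ ⋯ ⊆ Tₙ = E` whose graded factors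
`Tᵢᗮ ∩ Tᵢ₊₁` are equivalent to the category of finite dimensional vector spaces. -/
structure IsThin (k : Type u₁) [Field k] [Linear k E] : Prop where
  homFinite : ∀ X Y : E, Module.Finite k (X ⟶ Y)
  extFinite : ∀ X Y : E, S.ExtFinite k X Y
  filtration : ∃ (n : ℕ) (T : Fin (n + 1) → ObjectProperty E),
    (∀ i, S.IsRightAdmissible (T i)) ∧ Monotone T ∧
    (∀ X, T 0 X ↔ IsZero X) ∧ (∀ X, T (Fin.last n) X) ∧
    ∀ i : Fin n, ∃ e : (S.rightPerp (T i.castSucc) ⊓ T i.succ).FullSubcategory ≌ FGModuleCat.{u₁} k,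
      e.functor.Additive ∧ e.functor.Linear k

end

end ExactStructure

/-- The exact structure on an abelian category given by all short exact sequences. -/
def abelianExact (A : Type u) [Category.{v} A] [Abelian A] : ExactStructure A where
  hasZeroObject := inferInstance
  hasBinaryBiproducts := inferInstance
  conf := fun S => S.ShortExact
  of_iso e h := ShortComplex.shortExact_of_iso e h
  isKernel S h := ⟨h.fIsKernel⟩
  isCokernel S h := ⟨h.gIsCokernel⟩
  ex0 X Z hZ := by
    have : Mono (0 : Z ⟶ X) := ⟨fun _ _ _ => hZ.eq_of_tgt _ _⟩
    exact { exact := (ShortComplex.exact_iff_mono _ rfl).2 (by dsimp; infer_instance)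
            mono_f := this
            epi_g := by dsimp; infer_instance }
  ex1 p q hp hq := by
    obtain ⟨_, _, _, hp⟩ := hp
    obtain ⟨_, _, _, hq⟩ := hq
    have : Epi p := hp.epi_g
    have : Epi q := hq.epi_g
    exact ⟨_, kernel.ι (p ≫ q), kernel.condition _,
      { exact := ShortComplex.exact_of_f_is_kernel _ (kernelIsKernel (p ≫ q))
        mono_f := by dsimp; infer_instance
        epi_g := by dsimp; infer_instance }⟩
  ex2 p f hp := by
    obtain ⟨_, _, _, hp⟩ := hp
    have : Epi p := hp.epi_g
    refine ⟨_, pullback.fst p f, pullback.snd p f, IsPullback.of_hasPullback p f,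
      _, kernel.ι (pullback.snd p f), kernel.condition _, ?_⟩
    exact { exact := ShortComplex.exact_of_f_is_kernel _ (kernelIsKernel (pullback.snd p f))
            mono_f := by dsimp; infer_instance
            epi_g := by dsimp; infer_instance }
  ex2' i f hi := by
    obtain ⟨_, _, _, hi⟩ := hi
    have : Mono i := hi.mono_f
    refine ⟨_, pushout.inl i f, pushout.inr i f, IsPushout.of_hasPushout i f,
      _, cokernel.π (pushout.inr i f), cokernel.condition _, ?_⟩
    exact { exact := ShortComplex.exact_of_g_is_cokernel _ (cokernelIsCokernel (pushout.inr i f))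
            mono_f := by dsimp; infer_instance
            epi_g := by dsimp; infer_instance }

/-! ### Fully exact subcategories -/

namespace ExactStructure

section

variable {E : Type u} [Category.{v} E] [Preadditive E] (S : ExactStructure E)

/-- A kernel of a deflation gives a conflation. -/
theorem conf_of_isKernel {X Y Z : E} (i : X ⟶ Y) (p : Y ⟶ Z) (hw : i ≫ p = 0)
    (hi : IsLimit (KernelFork.ofι i hw)) (hp : S.IsDeflation p) :
    S.conf (ShortComplex.mk i p hw) := by
  obtain ⟨X', i', hw', hc⟩ := hp
  obtain ⟨hi'⟩ := S.isKernel _ hc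
  refine S.of_iso (ShortComplex.isoMk (S₁ := ShortComplex.mk i' p hw')
    (S₂ := ShortComplex.mk i p hw) (IsLimit.conePointUniqueUpToIso hi' hi) (Iso.refl _)
    (Iso.refl _) ?_ ?_) hc
  · have h := IsLimit.conePointUniqueUpToIso_hom_comp hi' hi WalkingParallelPair.zero
    dsimp at h ⊢
    rw [Category.comp_id]
    exact h
  · simp

/-- A cokernel of an inflation gives a conflation. -/
theorem conf_of_isCokernel {X Y Z : E} (i : X ⟶ Y) (p : Y ⟶ Z) (hw : i ≫ p = 0)
    (hp : IsColimit (CokernelCofork.ofπ p hw)) (hi : S.IsInflation i) :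
    S.conf (ShortComplex.mk i p hw) := by
  obtain ⟨Z', p', hw', hc⟩ := hi
  obtain ⟨hp'⟩ := S.isCokernel _ hc
  refine S.of_iso (ShortComplex.isoMk (S₁ := ShortComplex.mk i p' hw')
    (S₂ := ShortComplex.mk i p hw) (Iso.refl _) (Iso.refl _)
    (IsColimit.coconePointUniqueUpToIso hp' hp) ?_ ?_) hc
  · simp
  · have h := IsColimit.comp_coconePointUniqueUpToIso_hom hp' hp WalkingParallelPair.one
    dsimp at h ⊢
    rw [Category.id_comp]
    exact h.symm

/-- The pullback of a conflation along a morphism is a conflation with the same left term. -/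
theorem conf_of_isPullback {X Y Z W V : E} {i : X ⟶ Y} {p : Y ⟶ Z} {hw : i ≫ p = 0}
    (hc : S.conf (ShortComplex.mk i p hw)) {f : W ⟶ Z} {f' : V ⟶ Y} {p' : V ⟶ W}
    (sq : IsPullback f' p' p f) (hp' : S.IsDeflation p') :
    ∃ (i' : X ⟶ V) (hw' : i' ≫ p' = 0), i' ≫ f' = i ∧ S.conf (ShortComplex.mk i' p' hw') := by
  obtain ⟨hi⟩ := S.isKernel _ hc
  have hw' : sq.lift i 0 (by simpa using hw) ≫ p' = 0 := sq.lift_snd _ _ _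
  refine ⟨sq.lift i 0 (by simpa using hw), hw', sq.lift_fst _ _ _, ?_⟩
  apply S.conf_of_isKernel _ _ _ _ hp'
  have hm : Mono i := mono_of_isLimit_fork hi
  have hm' : Mono (sq.lift i 0 (by simpa using hw)) := mono_of_mono_fac (sq.lift_fst _ _ _)
  refine KernelFork.IsLimit.ofι' _ hw' (fun {U} g hg => ?_)
  have h0 : (g ≫ f') ≫ p = 0 := by rw [Category.assoc, sq.w, reassoc_of% hg, zero_comp]
  refine ⟨hi.lift (KernelFork.ofι (g ≫ f') h0), ?_⟩
  have h1 : hi.lift (KernelFork.ofι (g ≫ f') h0) ≫ i = g ≫ f' :=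
    hi.fac (KernelFork.ofι (g ≫ f') h0) WalkingParallelPair.zero
  apply sq.hom_ext
  · simpa using h1
  · simp [hg]

/-- The pushout of a conflation along a morphism is a conflation with the same right term. -/
theorem conf_of_isPushout {X Y Z W V : E} {i : X ⟶ Y} {p : Y ⟶ Z} {hw : i ≫ p = 0}
    (hc : S.conf (ShortComplex.mk i p hw)) {f : X ⟶ W} {f' : Y ⟶ V} {i' : W ⟶ V}
    (sq : IsPushout i f f' i') (hi' : S.IsInflation i') :
    ∃ (p' : V ⟶ Z) (hw' : i' ≫ p' = 0), f' ≫ p' = p ∧ S.conf (ShortComplex.mk i' p' hw') := by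
  obtain ⟨hp⟩ := S.isCokernel _ hc
  have hw' : i' ≫ sq.desc p 0 (by simpa using hw) = 0 := sq.inr_desc _ _ _
  refine ⟨sq.desc p 0 (by simpa using hw), hw', sq.inl_desc _ _ _, ?_⟩
  apply S.conf_of_isCokernel _ _ _ _ hi'
  have hm : Epi p := epi_of_isColimit_cofork hp
  have hm' : Epi (sq.desc p 0 (by simpa using hw)) := epi_of_epi_fac (sq.inl_desc _ _ _)
  refine CokernelCofork.IsColimit.ofπ' _ hw' (fun {U} g hg => ?_)
  have h0 : i ≫ (f' ≫ g) = 0 := by rw [← Category.assoc, sq.w, Category.assoc, hg, comp_zero]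
  refine ⟨hp.desc (CokernelCofork.ofπ (f' ≫ g) h0), ?_⟩
  have h1 : p ≫ hp.desc (CokernelCofork.ofπ (f' ≫ g) h0) = f' ≫ g :=
    hp.fac (CokernelCofork.ofπ (f' ≫ g) h0) WalkingParallelPair.one
  apply sq.hom_ext
  · simpa using h1
  · simp [hg]

/-- `X ⟶ 0` is a deflation. -/
theorem isDeflation_to_zero (X Z : E) (hZ : IsZero Z) : S.IsDeflation (0 : X ⟶ Z) := by
  have h0 : S.IsInflation (0 : Z ⟶ Z) :=
    ⟨Z, 𝟙 Z, zero_comp, S.ex0 Z Z hZ⟩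
  obtain ⟨V, f', i', sq, hi'⟩ := S.ex2' (0 : Z ⟶ Z) (0 : Z ⟶ X) h0
  have hd : i' ≫ sq.desc 0 (𝟙 X) (by simp) = 𝟙 X := sq.inr_desc _ _ _
  have hd' : sq.desc 0 (𝟙 X) (by simp) ≫ i' = 𝟙 V := by
    apply sq.hom_ext
    · exact hZ.eq_of_src _ _
    · rw [reassoc_of% hd, Category.comp_id]
  refine ⟨V, sq.desc 0 (𝟙 X) (by simp), comp_zero, ?_⟩
  have hc : S.conf (ShortComplex.mk i' (0 : V ⟶ Z) comp_zero) := by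
    apply S.conf_of_isCokernel _ _ _ _ hi'
    have : Epi (0 : V ⟶ Z) := ⟨fun _ _ _ => hZ.eq_of_src _ _⟩
    refine CokernelCofork.IsColimit.ofπ' _ _ (fun {U} g hg => ⟨0, ?_⟩)
    rw [comp_zero, ← Category.id_comp g, ← hd', Category.assoc, hg, comp_zero]
  exact S.of_iso (ShortComplex.isoMk (S₁ := ShortComplex.mk i' (0 : V ⟶ Z) comp_zero)
    (S₂ := ShortComplex.mk (sq.desc 0 (𝟙 X) (by simp)) (0 : X ⟶ Z) comp_zero)
    ⟨i', _, hd, hd'⟩ ⟨_, i', hd', hd⟩ (Iso.refl _) rfl (by simp)) hc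

theorem IsFullyExact.hasZeroObject {P : ObjectProperty E} {S : ExactStructure E}
    (hP : S.IsFullyExact P) : HasZeroObject P.FullSubcategory := by
  obtain ⟨Z, hZ, hPZ⟩ := hP.zero
  refine ⟨⟨⟨Z, hPZ⟩, ?_⟩⟩
  rw [IsZero.iff_id_eq_zero]
  ext
  exact hZ.eq_of_src _ _

theorem IsFullyExact.biprod_mem {P : ObjectProperty E} {S : ExactStructure E}
    (hP : S.IsFullyExact P) {X Y : E} (hX : P X) (hY : P Y) :
    ∃ b : BinaryBicone X Y, b.fst ≫ b.inl + b.snd ≫ b.inr = 𝟙 b.pt ∧ P b.pt := by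
  have := S.hasBinaryBiproducts
  obtain ⟨Z, hZ, -⟩ := hP.zero
  have hc : S.conf (ShortComplex.mk (𝟙 X) (0 : X ⟶ Z) comp_zero) := by
    refine S.conf_of_isKernel _ _ _ ?_ (S.isDeflation_to_zero X Z hZ)
    exact KernelFork.IsLimit.ofι' _ _ (fun {U} g _ => ⟨g, Category.comp_id g⟩)
  obtain ⟨V, f', p', sq, hp'⟩ := S.ex2 (0 : X ⟶ Z) (0 : Y ⟶ Z) (S.isDeflation_to_zero X Z hZ)
  obtain ⟨i', hw', -, hc'⟩ := S.conf_of_isPullback hc sq hp'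
  have hV : P V := hP.ext _ hc' hX hY
  have hz : ∀ {U : E} (a b : U ⟶ Z), a = b := fun a b => hZ.eq_of_tgt a b
  let b : BinaryBicone X Y :=
    { pt := V
      fst := f'
      snd := p'
      inl := sq.lift (𝟙 X) 0 (hz _ _)
      inr := sq.lift 0 (𝟙 Y) (hz _ _) }
  refine ⟨b, ?_, hV⟩
  apply sq.hom_ext
  · simp [b, Preadditive.add_comp]
  · simp [b, Preadditive.add_comp]

theorem IsFullyExact.hasBinaryBiproducts {P : ObjectProperty E} {S : ExactStructure E}
    (hP : S.IsFullyExact P) : HasBinaryBiproducts P.FullSubcategory := by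
  refine ⟨fun X Y => ?_⟩
  obtain ⟨b, hb, hV⟩ := hP.biprod_mem X.property Y.property
  let b' : BinaryBicone X Y :=
    { pt := ⟨b.pt, hV⟩
      fst := ObjectProperty.homMk b.fst
      snd := ObjectProperty.homMk b.snd
      inl := ObjectProperty.homMk b.inl
      inr := ObjectProperty.homMk b.inr
      inl_fst := by ext; exact b.inl_fst
      inl_snd := by ext; exact b.inl_snd
      inr_fst := by ext; exact b.inr_fst
      inr_snd := by ext; exact b.inr_snd }
  refine ⟨⟨b', isBinaryBilimitOfTotal b' ?_⟩⟩
  ext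
  exact hb

/-- The exact structure induced on a fully exact subcategory `P`: the conflations are those
conflations of `E` all of whose terms lie in `P`. -/
def induced (P : ObjectProperty E) (hP : S.IsFullyExact P) :
    ExactStructure P.FullSubcategory where
  hasZeroObject := hP.hasZeroObject
  hasBinaryBiproducts := hP.hasBinaryBiproducts
  conf := fun T => S.conf (T.map P.ι)
  of_iso e h := S.of_iso (P.ι.mapShortComplex.mapIso e) h
  isKernel T h := by
    obtain ⟨hi⟩ := S.isKernel _ h
    refine ⟨KernelFork.IsLimit.ofι _ _ (fun {U} g hg => ObjectProperty.homMk
      (hi.lift (KernelFork.ofι g.hom (congrArg (fun m => m.hom) hg)))) (fun {U} g hg => ?_)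
      (fun {U} g hg m hm => ?_)⟩
    · ext
      exact hi.fac (KernelFork.ofι g.hom (congrArg (fun m => m.hom) hg)) WalkingParallelPair.zero
    · ext
      refine Fork.IsLimit.hom_ext hi ?_
      refine Eq.trans ?_ (hi.fac (KernelFork.ofι g.hom (congrArg (fun m => m.hom) hg))
        WalkingParallelPair.zero).symm
      exact congrArg (fun m => m.hom) hm
  isCokernel T h := by
    obtain ⟨hi⟩ := S.isCokernel _ h
    refine ⟨CokernelCofork.IsColimit.ofπ _ _ (fun {U} g hg => ObjectProperty.homMk
      (hi.desc (CokernelCofork.ofπ g.hom (congrArg (fun m => m.hom) hg)))) (fun {U} g hg => ?_)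
      (fun {U} g hg m hm => ?_)⟩
    · ext
      exact hi.fac (CokernelCofork.ofπ g.hom (congrArg (fun m => m.hom) hg)) WalkingParallelPair.one
    · ext
      refine Cofork.IsColimit.hom_ext hi ?_
      refine Eq.trans ?_ (hi.fac (CokernelCofork.ofπ g.hom (congrArg (fun m => m.hom) hg))
        WalkingParallelPair.one).symm
      exact congrArg (fun m => m.hom) hm
  ex0 X Z hZ := S.ex0 X.obj Z.obj (by
    rw [IsZero.iff_id_eq_zero] at hZ ⊢
    exact congrArg (fun m => m.hom) hZ)
  ex1 {X Y Z} p q hp hq := by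
    obtain ⟨K, i, hi, hc⟩ := hp
    obtain ⟨M, j, hj, hd⟩ := hq
    replace hc : S.conf (ShortComplex.mk i.hom p.hom (congrArg (fun m => m.hom) hi)) := hc
    replace hd : S.conf (ShortComplex.mk j.hom q.hom (congrArg (fun m => m.hom) hj)) := hd
    obtain ⟨N, l, hl, he⟩ := S.ex1 p.hom q.hom ⟨_, _, _, hc⟩ ⟨_, _, _, hd⟩
    obtain ⟨V, f', p', sq, hp'⟩ := S.ex2 p.hom j.hom ⟨_, _, _, hc⟩
    obtain ⟨i', hw', -, hc'⟩ := S.conf_of_isPullback hc sq hp'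
    have hV : P V := hP.ext _ hc' K.property M.property
    have hw : f' ≫ p.hom ≫ q.hom = 0 := by
      have := congrArg (fun m => m.hom) hj
      rw [← Category.assoc, sq.w, Category.assoc]
      exact (congrArg (p' ≫ ·) this).trans comp_zero
    obtain ⟨hjl⟩ := S.isKernel _ hd
    refine ⟨⟨V, hV⟩, ObjectProperty.homMk f', by ext; exact hw, ?_⟩
    refine S.conf_of_isKernel f' (p.hom ≫ q.hom) hw ?_ ⟨N, l, hl, he⟩
    have hm : Mono j.hom := mono_of_isLimit_fork hjl
    refine KernelFork.IsLimit.ofι _ _ (fun {U} g hg => sq.lift g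
      (hjl.lift (KernelFork.ofι (g ≫ p.hom) (by simpa using hg)))
      (hjl.fac (KernelFork.ofι (g ≫ p.hom) (by simpa using hg)) WalkingParallelPair.zero).symm)
      (fun {U} g hg => sq.lift_fst _ _ _) (fun {U} g hg m hm' => ?_)
    apply sq.hom_ext
    · rw [sq.lift_fst]
      exact hm'
    · rw [← cancel_mono j.hom, Category.assoc, Category.assoc, ← sq.w, sq.lift_fst_assoc,
        ← Category.assoc, hm']
  ex2 {Y Z W} p f hp := by
    obtain ⟨K, i, hi, hc⟩ := hp
    replace hc : S.conf (ShortComplex.mk i.hom p.hom (congrArg (fun m => m.hom) hi)) := hc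
    obtain ⟨V, f', p', sq, hp'⟩ := S.ex2 p.hom f.hom ⟨_, _, _, hc⟩
    obtain ⟨i', hw', -, hc'⟩ := S.conf_of_isPullback hc sq hp'
    have hV : P V := hP.ext _ hc' K.property W.property
    refine ⟨⟨V, hV⟩, ObjectProperty.homMk f', ObjectProperty.homMk p', ?_,
      K, ObjectProperty.homMk i', by ext; exact hw', hc'⟩
    exact IsPullback.of_map P.ι (by ext; exact sq.w) sq
  ex2' {X Y W} i f hi := by
    obtain ⟨K, p, hp, hc⟩ := hi
    replace hc : S.conf (ShortComplex.mk i.hom p.hom (congrArg (fun m => m.hom) hp)) := hc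
    obtain ⟨V, f', i', sq, hi'⟩ := S.ex2' i.hom f.hom ⟨_, _, _, hc⟩
    obtain ⟨p', hw', -, hc'⟩ := S.conf_of_isPushout hc sq hi'
    have hV : P V := hP.ext _ hc' W.property K.property
    refine ⟨⟨V, hV⟩, ObjectProperty.homMk f', ObjectProperty.homMk i', ?_,
      K, ObjectProperty.homMk p', by ext; exact hw', hc'⟩
    exact IsPushout.of_map P.ι (by ext; exact sq.w) sq

theorem extClosure_isFullyExact (P : ObjectProperty E) : S.IsFullyExact (S.ExtClosure P) where
  zero := by
    obtain ⟨Z, hZ⟩ := S.hasZeroObject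
    exact ⟨Z, hZ, .zero Z hZ⟩
  ext T hT h₁ h₃ := .ext T hT h₁ h₃

end

end ExactStructure

/-! ### Right and left exact functors, abelian envelopes -/

section Functors

variable {E : Type u₁} [Category.{v₁} E] [Preadditive E]
variable {E' : Type u₂} [Category.{v₂} E'] [Preadditive E']

/-- `F` is additive and for every conflation `X ⟶ Y ⟶ Z` with maps `i`, `d`, the map `F d` is a
deflation with kernel `i' : K ⟶ F Y`, and `F i` is the composite of a deflation `F X ⟶ K`
with `i'`. -/
def IsRightExact (S : ExactStructure E) (S' : ExactStructure E') (F : E ⥤ E') : Prop :=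
  F.Additive ∧ ∀ T : ShortComplex E, S.conf T →
    ∃ (K : E') (d' : F.obj T.X₁ ⟶ K) (i' : K ⟶ F.obj T.X₂) (hw : i' ≫ F.map T.g = 0),
      S'.conf (ShortComplex.mk i' (F.map T.g) hw) ∧ S'.IsDeflation d' ∧ F.map T.f = d' ≫ i'

/-- `F` is additive and for every conflation `X ⟶ Y ⟶ Z` with maps `i`, `d`, the map `F i` is an
inflation with cokernel `d' : F Y ⟶ C`, and `F d` is the composite of `d'` with an
inflation `C ⟶ F Z`. -/
def IsLeftExact (S : ExactStructure E) (S' : ExactStructure E') (F : E ⥤ E') : Prop :=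
  F.Additive ∧ ∀ T : ShortComplex E, S.conf T →
    ∃ (C : E') (d' : F.obj T.X₂ ⟶ C) (i' : C ⟶ F.obj T.X₃) (hw : F.map T.f ≫ d' = 0),
      S'.conf (ShortComplex.mk (F.map T.f) d' hw) ∧ S'.IsInflation i' ∧ F.map T.g = d' ≫ i'

theorem IsRightExact.comp {S : ExactStructure E} {S' : ExactStructure E'}
    {B : Type u₃} [Category.{v₃} B] [Abelian B]
    {F : E ⥤ E'} {G : E' ⥤ B} (hF : IsRightExact S S' F) (hG : IsRightExact S' (abelianExact B) G) :
    IsRightExact S (abelianExact B) (F ⋙ G) := by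
  have := hF.1
  have := hG.1
  refine ⟨inferInstance, fun T hT => ?_⟩
  obtain ⟨K, d', i', hw, hc, ⟨M, j, hj, hd⟩, hf⟩ := hF.2 T hT
  obtain ⟨K₂, d₂, i₂, hw₂, hc₂, hd₂, hf₂⟩ := hG.2 _ hc
  obtain ⟨K₃, d₃, i₃, hw₃, hc₃, hd₃, hf₃⟩ := hG.2 _ hd
  refine ⟨K₂, G.map d' ≫ d₂, i₂, hw₂, hc₂,
    (abelianExact B).ex1 _ _ ⟨_, _, _, hc₃⟩ hd₂, ?_⟩
  dsimp at hf₂ ⊢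
  rw [hf, G.map_comp, hf₂, Category.assoc]

theorem IsLeftExact.comp {S : ExactStructure E} {S' : ExactStructure E'}
    {B : Type u₃} [Category.{v₃} B] [Abelian B]
    {F : E ⥤ E'} {G : E' ⥤ B} (hF : IsLeftExact S S' F) (hG : IsLeftExact S' (abelianExact B) G) :
    IsLeftExact S (abelianExact B) (F ⋙ G) := by
  have := hF.1
  have := hG.1
  refine ⟨inferInstance, fun T hT => ?_⟩
  obtain ⟨K, d', i', hw, hc, ⟨M, j, hj, hd⟩, hf⟩ := hF.2 T hT
  obtain ⟨K₂, d₂, i₂, hw₂, hc₂, ⟨_, _, _, hd₂⟩, hf₂⟩ := hG.2 _ hc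
  obtain ⟨K₃, d₃, i₃, hw₃, hc₃, hd₃, hf₃⟩ := hG.2 _ hd
  have : Mono i₂ := ShortComplex.ShortExact.mono_f hd₂
  have : Mono (G.map i') := ShortComplex.ShortExact.mono_f hc₃
  refine ⟨K₂, d₂, i₂ ≫ G.map i', hw₂, hc₂, ⟨_, _, cokernel.condition _,
    { exact := ShortComplex.exact_of_g_is_cokernel _ (cokernelIsCokernel (i₂ ≫ G.map i'))
      mono_f := by dsimp; infer_instance
      epi_g := by dsimp; infer_instance }⟩, ?_⟩
  dsimp at hf₂ ⊢
  rw [hf, G.map_comp, hf₂, Category.assoc]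

/-- The category `Rex(E, E')` of right exact functors and natural transformations. -/
abbrev Rex (S : ExactStructure E) (S' : ExactStructure E') :=
  ObjectProperty.FullSubcategory (C := E ⥤ E') (IsRightExact S S')

/-- The category `Lex(E, E')` of left exact functors and natural transformations. -/
abbrev Lex (S : ExactStructure E) (S' : ExactStructure E') :=
  ObjectProperty.FullSubcategory (C := E ⥤ E') (IsLeftExact S S')

/-- Composition with a right exact functor `i`, as a functor `Rex(E', B) ⥤ Rex(E, B)`. -/
def rexRestriction {S : ExactStructure E} {S' : ExactStructure E'}
    (i : E ⥤ E') (hi : IsRightExact S S' i) (B : Type u₃) [Category.{v₃} B] [Abelian B] :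
    Rex S' (abelianExact B) ⥤ Rex S (abelianExact B) :=
  ObjectProperty.lift _ (ObjectProperty.ι _ ⋙ (Functor.whiskeringLeft E E' B).obj i)
    (fun F => hi.comp F.property)

/-- Composition with a left exact functor `i`, as a functor `Lex(E', B) ⥤ Lex(E, B)`. -/
def lexRestriction {S : ExactStructure E} {S' : ExactStructure E'}
    (i : E ⥤ E') (hi : IsLeftExact S S' i) (B : Type u₃) [Category.{v₃} B] [Abelian B] :
    Lex S' (abelianExact B) ⥤ Lex S (abelianExact B) :=
  ObjectProperty.lift _ (ObjectProperty.ι _ ⋙ (Functor.whiskeringLeft E E' B).obj i)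
    (fun F => hi.comp F.property)

end Functors

/-- The abelian category `A` together with `i : E ⥤ A` is a right abelian envelope of the exact
category `(E, S)`: the functor `i` is right exact and composition with it is an equivalence
`Rex(A, B) ⥤ Rex(E, B)` for every abelian category `B` (in the universes `u₃`, `v₃`). -/
def IsRightAbelianEnvelope {E : Type u₁} [Category.{v₁} E] [Preadditive E] (S : ExactStructure E)
    {A : Type u₂} [Category.{v₂} A] [Abelian A] (i : E ⥤ A) : Prop :=
  ∃ hi : IsRightExact S (abelianExact A) i,
    ∀ (B : Type u₃) [Category.{v₃} B] [Abelian B],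
      (rexRestriction i hi B).IsEquivalence

/-- The abelian category `A` together with `i : E ⥤ A` is a left abelian envelope of the exact
category `(E, S)`: the functor `i` is left exact and composition with it is an equivalence
`Lex(A, B) ⥤ Lex(E, B)` for every abelian category `B` (in the universes `u₃`, `v₃`). -/
def IsLeftAbelianEnvelope {E : Type u₁} [Category.{v₁} E] [Preadditive E] (S : ExactStructure E)
    {A : Type u₂} [Category.{v₂} A] [Abelian A] (i : E ⥤ A) : Prop :=
  ∃ hi : IsLeftExact S (abelianExact A) i,
    ∀ (B : Type u₃) [Category.{v₃} B] [Abelian B],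
      (lexRestriction i hi B).IsEquivalence

/-! ### Highest weight categories -/

/-- `X` is a family of pairwise non-isomorphic representatives of the isomorphism classes of the
objects with the property `P`. -/
structure IsRepresentativeFamily {C : Type u₁} [Category.{v₁} C] {Λ : Type w}
    (P : ObjectProperty C) (X : Λ → C) : Prop where
  prop : ∀ i, P (X i)
  inj : ∀ i j, Nonempty (X i ≅ X j) → i = j
  exhaust : ∀ Y, P Y → ∃ i, Nonempty (Y ≅ X i)

section HighestWeight

variable {A : Type u₁} [Category.{v₁} A] [Abelian A]

/-- A `k`-linear abelian category is Deligne finite if it is Hom- and `Ext¹`-finite, has finitely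
many simple objects up to isomorphism, every object has a finite filtration with
simple graded factors, and there is a projective generator. -/
structure IsDeligneFinite (k : Type u) [Field k] (A : Type u₁) [Category.{v₁} A] [Abelian A]
    [Linear k A] : Prop where
  homFinite : ∀ X Y : A, Module.Finite k (X ⟶ Y)
  extFinite : ∀ X Y : A, (abelianExact A).ExtFinite k X Y
  finite_simples : ∃ (n : ℕ) (X : Fin n → A), ∀ Y : A, Simple Y → ∃ i, Nonempty (Y ≅ X i)
  finite_length : ∀ X : A, (abelianExact A).ExtClosure (fun Y => Simple Y) X
  generator : ∃ P : A, Projective P ∧ IsSeparator P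

/-- `p : P ⟶ X` is a projective cover. -/
structure IsProjectiveCover {P X : A} (p : P ⟶ X) : Prop where
  projective : Projective P
  epi : Epi p
  essential : ∀ (Y : A) (f : Y ⟶ P), Epi (f ≫ p) → Epi f

/-- `m : X ⟶ I` is an injective hull. -/
structure IsInjectiveHull {X I : A} (m : X ⟶ I) : Prop where
  injective : Injective I
  mono : Mono m
  essential : ∀ (Y : A) (f : I ⟶ Y), Mono (m ≫ f) → Mono f

variable {Λ : Type w} [PartialOrder Λ] (L : Λ → A)

/-- The objects having a finite filtration with all graded factors isomorphic to `L j`, `j ≤ i`. -/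
def FactorsLE (i : Λ) : ObjectProperty A :=
  (abelianExact A).ExtClosure (fun Y => ∃ j, j ≤ i ∧ Nonempty (Y ≅ L j))

/-- The objects having a finite filtration with all graded factors isomorphic to `L j`, `j < i`. -/
def FactorsLT (i : Λ) : ObjectProperty A :=
  (abelianExact A).ExtClosure (fun Y => ∃ j, j < i ∧ Nonempty (Y ≅ L j))

/-- `D` is the standard object `Δ(i)`: the maximal quotient of the projective cover of `L i` all of
whose simple factors are isomorphic to `L j` with `j ≤ i`. -/
def IsStandard (i : Λ) (D : A) : Prop :=
  ∃ (P : A) (p : P ⟶ L i) (q : P ⟶ D), IsProjectiveCover p ∧ Epi q ∧ FactorsLE L i D ∧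
    ∀ (Q : A) (f : P ⟶ Q), Epi f → FactorsLE L i Q → ∃ g : D ⟶ Q, q ≫ g = f

/-- `N` is the costandard object `∇(i)`: the maximal subobject of the injective hull of `L i` all of
whose simple factors are isomorphic to `L j` with `j ≤ i`. -/
def IsCostandard (i : Λ) (N : A) : Prop :=
  ∃ (I : A) (m : L i ⟶ I) (q : N ⟶ I), IsInjectiveHull m ∧ Mono q ∧ FactorsLE L i N ∧
    ∀ (Q : A) (f : Q ⟶ I), Mono f → FactorsLE L i Q → ∃ g : Q ⟶ N, g ≫ q = f

/-- `(A, Λ)` is a highest weight category over `k`: `A` is Deligne finite, `L` lists the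
isomorphism classes of its simple objects, and for every `i`
* there is an epimorphism `Δ(i) ⟶ L i` whose kernel has a finite filtration with graded factors
  `L j`, `j < i`;
* there is an epimorphism `P(i) ⟶ Δ(i)` whose kernel has a finite filtration with graded factors
  `Δ(j)`, `j > i`, where `P(i)` is the projective cover of `L i`. -/
structure IsHighestWeight (k : Type u) [Field k] [Linear k A] : Prop where
  deligneFinite : IsDeligneFinite k A
  simples : IsRepresentativeFamily (fun X : A => Simple X) L
  st1 : ∀ i, ∃ D : A, IsStandard L i D ∧ ∃ e : D ⟶ L i, Epi e ∧ FactorsLT L i (kernel e)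
  st2 : ∀ i, ∃ (P : A) (p : P ⟶ L i) (D : A), IsProjectiveCover p ∧ IsStandard L i D ∧
    ∃ q : P ⟶ D, Epi q ∧
      (abelianExact A).ExtClosure (fun Y => ∃ j, i < j ∧ IsStandard L j Y) (kernel q)

/-- `F(Δ)`: the extension closure of the standard objects. -/
def FDelta : ObjectProperty A :=
  (abelianExact A).ExtClosure (fun Y => ∃ i, IsStandard L i Y)

/-- `F(∇)`: the extension closure of the costandard objects. -/
def FNabla : ObjectProperty A :=
  (abelianExact A).ExtClosure (fun Y => ∃ i, IsCostandard L i Y)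

/-- The exact structure on `F(Δ)` induced from `A`. -/
def exactFDelta : ExactStructure (FDelta L).FullSubcategory :=
  (abelianExact A).induced (FDelta L) ((abelianExact A).extClosure_isFullyExact _)

/-- The exact structure on `F(∇)` induced from `A`. -/
def exactFNabla : ExactStructure (FNabla L).FullSubcategory :=
  (abelianExact A).induced (FNabla L) ((abelianExact A).extClosure_isFullyExact _)

end HighestWeight

end ExactCat

/-!
The proof has two independent halves: the exact structure of `F(Δ)` and `F(∇)`, and their
abelian envelopes.

*Thinness and irreducible objects.* Call a finite sequence `X₁, …, Xₙ` of objects with scalar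
endomorphisms exceptional if `Hom(Xᵢ, Xⱼ) = 0` for `i < j` and `Ext¹(Xᵢ, Xⱼ) = 0` for `i ≤ j`. In
the extension closure of such a sequence the factors of a filtration can be rearranged so that
those with small index come first, whence each object `Y` sits in a conflation `T ⟶ Y ⟶ F` with
`T` filtered by `X₁, …, Xₘ` and `F` by the remaining `Xᵢ` (`IsExceptional.exists_torsion`). These
are the right admissible subcategories of a thin category. Its graded pieces consist of direct
sums of copies of one `Xᵢ`, so `Hom(Xᵢ, -)` identifies them with finite dimensional vector spaces
(`exists_linear_equivalence`). A conflation `Y ⟶ Xᵢ ⟶ Z` has `Y` filtered by the `Xₗ` with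
`l ≥ i` and `Z` by those with `l ≤ i`; therefore it splits, and `Xᵢ` is irreducible.

The costandard objects, in the order of a linear extension of `Λ`, and the standard objects, in the
opposite order, are exceptional. For the standard objects this follows from the presentation
`P i ⟶ D i`, whose kernel is filtered by `D j` with `j > i`. For the costandard objects
the main point is that `Ext¹(L i, N j) = 0` unless `j < i` (`HighestWeightData.extZero_L_N`): for
`i ≤ j` the quotient of the injective hull of `L j` by its maximal subobject `N j` does not contain
`L i`, and for incomparable `i`, `j` one compares `L i` with `D i`. Injective hulls of simple
objects are constructed as essential extensions of maximal length (`exists_isInjectiveHull`).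

*Envelopes.* If a fully exact subcategory `P` of `A` contains enough projectives of `A` and the
syzygies of its own objects, a right exact functor on `P` has a pointwise left Kan extension to
`A`, computed by projective presentations, which is right exact; and a right exact functor on `A`
is the Kan extension of its restriction. So `A` is the right abelian envelope of `P`
(`HasProjectiveResolutions.isRightAbelianEnvelope`), and dually for left exact functors. For
`F(Δ)` the resolutions come from `P i ⟶ D i` and the horseshoe lemma. For `F(∇)` they come from
the vanishing of `Ext¹(D i, N j)` and `Ext²(D i, N j)` and the criterion that an object `M` belongs
to `F(∇)` if `Ext¹(D i, M) = 0` for all `i` (`HighestWeightData.filt_N_of_extZero`): by the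
criterion all injective objects belong to `F(∇)`, and so do the cosyzygies of its objects.
-/

universe w'

open ZeroObject

namespace ExactCat

/-! ### Extension closures and vanishing of `Hom` and `Ext` -/

section Closure

variable {A : Type u₁} [Category.{v₁} A] [Abelian A]

theorem shortExact_kernel {X Y : A} (f : X ⟶ Y) [Epi f] :
    (ShortComplex.mk (kernel.ι f) f (kernel.condition f)).ShortExact where
  exact := ShortComplex.exact_of_f_is_kernel _ (kernelIsKernel f)
  mono_f := by dsimp; infer_instance
  epi_g := by dsimp; infer_instance

theorem shortExact_cokernel {X Y : A} (f : X ⟶ Y) [Mono f] :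
    (ShortComplex.mk f (cokernel.π f) (cokernel.condition f)).ShortExact where
  exact := ShortComplex.exact_of_g_is_cokernel _ (cokernelIsCokernel f)
  mono_f := by dsimp; infer_instance
  epi_g := by dsimp; infer_instance

theorem shortExact_biprod (X Y : A) :
    (ShortComplex.mk (biprod.inl : X ⟶ X ⊞ Y) biprod.snd biprod.inl_snd).ShortExact :=
  (ShortComplex.Splitting.ofHasBinaryBiproduct X Y).shortExact

/-- The short exact sequence `X ⟶ Y ⟶ 0` attached to an isomorphism. -/
theorem shortExact_of_iso {X Y : A} (e : X ≅ Y) :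
    (ShortComplex.mk e.hom (0 : Y ⟶ (0 : A)) comp_zero).ShortExact where
  exact := by
    rw [ShortComplex.exact_iff_epi _ rfl]
    dsimp; infer_instance
  mono_f := by dsimp; infer_instance
  epi_g := ⟨fun _ _ _ => (isZero_zero A).eq_of_src _ _⟩

theorem extClosure_ext {P : ObjectProperty A} {S : ShortComplex A} (hS : S.ShortExact)
    (h₁ : (abelianExact A).ExtClosure P S.X₁) (h₃ : (abelianExact A).ExtClosure P S.X₃) :
    (abelianExact A).ExtClosure P S.X₂ :=
  .ext S hS h₁ h₃

theorem extClosure_of_iso {P : ObjectProperty A} {X Y : A} (e : X ≅ Y)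
    (h : (abelianExact A).ExtClosure P X) : (abelianExact A).ExtClosure P Y :=
  extClosure_ext (shortExact_of_iso e) h (.zero _ (isZero_zero A))

theorem extClosure_mono {P Q : ObjectProperty A} (hPQ : ∀ X, P X → Q X) {X : A}
    (h : (abelianExact A).ExtClosure P X) : (abelianExact A).ExtClosure Q X := by
  induction h with
  | zero Z hZ => exact .zero Z hZ
  | of X hX => exact .of X (hPQ X hX)
  | ext T hT _ _ h₁ h₃ => exact .ext T hT h₁ h₃

theorem extClosure_biprod {P : ObjectProperty A} {X Y : A}
    (hX : (abelianExact A).ExtClosure P X) (hY : (abelianExact A).ExtClosure P Y) :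
    (abelianExact A).ExtClosure P (X ⊞ Y) :=
  extClosure_ext (shortExact_biprod X Y) hX hY

/-- All morphisms from `X` to `Y` vanish. -/
def HomZero (X Y : A) : Prop := ∀ f : X ⟶ Y, f = 0

theorem HomZero.of_iso_left {X X' Y : A} (h : HomZero X Y) (e : X ≅ X') : HomZero X' Y := by
  intro f
  rw [← cancel_epi e.hom, h (e.hom ≫ f), comp_zero]

theorem HomZero.of_iso_right {X Y Y' : A} (h : HomZero X Y) (e : Y ≅ Y') : HomZero X Y' := by
  intro f
  rw [← cancel_mono e.inv, h (f ≫ e.inv), zero_comp]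

theorem HomZero.of_epi {X X' Y : A} (h : HomZero X Y) (f : X ⟶ X') [Epi f] : HomZero X' Y := by
  intro g
  rw [← cancel_epi f, h (f ≫ g), comp_zero]

theorem HomZero.of_mono {X Y Y' : A} (h : HomZero X Y) (f : Y' ⟶ Y) [Mono f] : HomZero X Y' := by
  intro g
  rw [← cancel_mono f, h (g ≫ f), zero_comp]

theorem HomZero.left_ext {S : ShortComplex A} (hS : S.ShortExact) {Y : A} (h₁ : HomZero S.X₁ Y)
    (h₃ : HomZero S.X₃ Y) : HomZero S.X₂ Y := by
  intro f
  obtain ⟨g, hg⟩ := CokernelCofork.IsColimit.desc' hS.gIsCokernel f (h₁ _)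
  rw [← hg, h₃ g, comp_zero]

theorem HomZero.right_ext {S : ShortComplex A} (hS : S.ShortExact) {Y : A} (h₁ : HomZero Y S.X₁)
    (h₃ : HomZero Y S.X₃) : HomZero Y S.X₂ := by
  intro f
  obtain ⟨g, hg⟩ := KernelFork.IsLimit.lift' hS.fIsKernel f (h₃ _)
  rw [← hg, h₁ g, zero_comp]

theorem homZero_left {P : ObjectProperty A} {X Y : A} (h : (abelianExact A).ExtClosure P X)
    (hP : ∀ Z, P Z → HomZero Z Y) : HomZero X Y := by
  induction h with
  | zero Z hZ => exact fun f => hZ.eq_of_src _ _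
  | of X hX => exact hP X hX
  | ext T hT _ _ h₁ h₃ => exact .left_ext hT h₁ h₃

theorem homZero_right {P : ObjectProperty A} {X Y : A} (h : (abelianExact A).ExtClosure P X)
    (hP : ∀ Z, P Z → HomZero Y Z) : HomZero Y X := by
  induction h with
  | zero Z hZ => exact fun f => hZ.eq_of_tgt _ _
  | of X hX => exact hP X hX
  | ext T hT _ _ h₁ h₃ => exact .right_ext hT h₁ h₃

theorem isZero_of_homZero_self {X : A} (h : HomZero X X) : IsZero X :=
  (IsZero.iff_id_eq_zero X).2 (h _)

section Ext

variable [HasExt.{w} A]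

open Abelian

/-- `Extⁿ(X, Y) = 0`. -/
def ExtZero (n : ℕ) (X Y : A) : Prop := ∀ x : Ext.{w} X Y n, x = 0

theorem ExtZero.left_ext {S : ShortComplex A} (hS : S.ShortExact) {n : ℕ} {Y : A}
    (h₁ : ExtZero.{u₁, v₁, w} n S.X₁ Y) (h₃ : ExtZero.{u₁, v₁, w} n S.X₃ Y) :
    ExtZero.{u₁, v₁, w} n S.X₂ Y := by
  intro x
  obtain ⟨y, rfl⟩ := Ext.contravariant_sequence_exact₂ hS Y x (h₁ _)
  rw [h₃ y, Ext.comp_zero]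

theorem ExtZero.right_ext {S : ShortComplex A} (hS : S.ShortExact) {n : ℕ} {Y : A}
    (h₁ : ExtZero.{u₁, v₁, w} n Y S.X₁) (h₃ : ExtZero.{u₁, v₁, w} n Y S.X₃) :
    ExtZero.{u₁, v₁, w} n Y S.X₂ := by
  intro x
  obtain ⟨y, rfl⟩ := Ext.covariant_sequence_exact₂ Y hS x (h₃ _)
  rw [h₁ y, Ext.zero_comp]

theorem ExtZero.of_iso_left {n : ℕ} {X X' Y : A} (h : ExtZero.{u₁, v₁, w} n X Y) (e : X ≅ X') :
    ExtZero.{u₁, v₁, w} n X' Y := by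
  intro x
  have h1 : (Ext.mk₀ e.inv).comp ((Ext.mk₀ e.hom).comp x (zero_add n)) (zero_add n) = x := by
    simp
  rw [← h1, h ((Ext.mk₀ e.hom).comp x (zero_add n)), Ext.comp_zero]

theorem ExtZero.of_iso_right {n : ℕ} {X Y Y' : A} (h : ExtZero.{u₁, v₁, w} n X Y) (e : Y ≅ Y') :
    ExtZero.{u₁, v₁, w} n X Y' := by
  intro x
  have h1 : (x.comp (Ext.mk₀ e.inv) (add_zero n)).comp (Ext.mk₀ e.hom) (add_zero n) = x := by
    simp
  rw [← h1, h (x.comp (Ext.mk₀ e.inv) (add_zero n)), Ext.zero_comp]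

theorem extZero_of_isZero_left {n : ℕ} {X Y : A} (hX : IsZero X) : ExtZero.{u₁, v₁, w} n X Y := by
  intro x
  have h1 : (Ext.mk₀ (𝟙 X)).comp x (zero_add n) = x := by simp
  rw [← h1, hX.eq_of_src (𝟙 X) 0, Ext.mk₀_zero, Ext.zero_comp]

theorem extZero_of_isZero_right {n : ℕ} {X Y : A} (hY : IsZero Y) :
    ExtZero.{u₁, v₁, w} n X Y := by
  intro x
  have h1 : x.comp (Ext.mk₀ (𝟙 Y)) (add_zero n) = x := by simp
  rw [← h1, hY.eq_of_src (𝟙 Y) 0, Ext.mk₀_zero, Ext.comp_zero]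

theorem extZero_left {n : ℕ} {P : ObjectProperty A} {X Y : A}
    (h : (abelianExact A).ExtClosure P X)
    (hP : ∀ Z, P Z → ExtZero.{u₁, v₁, w} n Z Y) : ExtZero.{u₁, v₁, w} n X Y := by
  induction h with
  | zero Z hZ => exact extZero_of_isZero_left hZ
  | of X hX => exact hP X hX
  | ext T hT _ _ h₁ h₃ => exact .left_ext hT h₁ h₃

theorem extZero_right {n : ℕ} {P : ObjectProperty A} {X Y : A}
    (h : (abelianExact A).ExtClosure P X)
    (hP : ∀ Z, P Z → ExtZero.{u₁, v₁, w} n Y Z) : ExtZero.{u₁, v₁, w} n Y X := by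
  induction h with
  | zero Z hZ => exact extZero_of_isZero_right hZ
  | of X hX => exact hP X hX
  | ext T hT _ _ h₁ h₃ => exact .right_ext hT h₁ h₃

/-- Dimension shift in the first variable, along a projective presentation. -/
theorem extZero_succ_of_projective {S : ShortComplex A} (hS : S.ShortExact) [Projective S.X₂]
    {n : ℕ} {Y : A} (h : ExtZero.{u₁, v₁, w} n S.X₁ Y) : ExtZero.{u₁, v₁, w} (n + 1) S.X₃ Y := by
  intro x
  obtain ⟨y, rfl⟩ := Ext.contravariant_sequence_exact₃ hS Y x (Ext.eq_zero_of_projective _)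
    (add_comm 1 n)
  rw [h y, Ext.comp_zero]

theorem HomZero.extZero {X Y : A} (h : HomZero X Y) : ExtZero.{u₁, v₁, w} 0 X Y := by
  intro x
  obtain ⟨f, rfl⟩ := (Ext.mk₀_bijective X Y).2 x
  rw [h f, Ext.mk₀_zero]

/-- If `Ext¹(Z, X) = 0`, morphisms out of `Z` lift along epimorphisms with kernel `X`. -/
theorem ExtZero.lift {S : ShortComplex A} (hS : S.ShortExact) {Z : A}
    (h : ExtZero.{u₁, v₁, w} 1 Z S.X₁) (f : Z ⟶ S.X₃) : ∃ g : Z ⟶ S.X₂, g ≫ S.g = f := by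
  obtain ⟨x, hx⟩ := Ext.covariant_sequence_exact₃ Z hS (Ext.mk₀ f) (zero_add 1) (h _)
  obtain ⟨g, rfl⟩ := (Ext.mk₀_bijective _ _).2 x
  refine ⟨g, (Ext.mk₀_bijective _ _).1 ?_⟩
  rw [← hx, Ext.mk₀_comp_mk₀]

/-- If `Ext¹(Z, X) = 0`, morphisms into `X` extend along monomorphisms with cokernel `Z`. -/
theorem ExtZero.extend {S : ShortComplex A} (hS : S.ShortExact) {X : A}
    (h : ExtZero.{u₁, v₁, w} 1 S.X₃ X) (f : S.X₁ ⟶ X) : ∃ g : S.X₂ ⟶ X, S.f ≫ g = f := by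
  obtain ⟨x, hx⟩ := Ext.contravariant_sequence_exact₁ hS X (Ext.mk₀ f) (add_zero 1) (h _)
  obtain ⟨g, rfl⟩ := (Ext.mk₀_bijective _ _).2 x
  refine ⟨g, (Ext.mk₀_bijective _ _).1 ?_⟩
  rw [← hx, Ext.mk₀_comp_mk₀]

end Ext

end Closure

/-! ### Categories generated by one object with scalar endomorphisms -/

section Brick

variable {k : Type u} [Field k] {D : Type u₁} [Category.{v₁} D] [Preadditive D]

/-- The identity of `Y` is a finite sum of morphisms factoring through `x`; equivalently, `Y` is a
direct summand of a finite direct sum of copies of `x`. -/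
def IsSummandOfPower (x Y : D) : Prop :=
  𝟙 Y ∈ AddSubgroup.closure {h : Y ⟶ Y | ∃ (p : Y ⟶ x) (i : x ⟶ Y), h = p ≫ i}

theorem IsSummandOfPower.eq_zero {x Y Z : D} (hY : IsSummandOfPower x Y) {f : Y ⟶ Z}
    (hf : ∀ g : x ⟶ Y, g ≫ f = 0) : f = 0 := by
  have key : ∀ h ∈ AddSubgroup.closure {h : Y ⟶ Y | ∃ (p : Y ⟶ x) (i : x ⟶ Y), h = p ≫ i},
      h ≫ f = 0 := by
    intro h hh
    induction hh using AddSubgroup.closure_induction with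
    | mem h hh =>
      obtain ⟨p, i, rfl⟩ := hh
      rw [Category.assoc, hf, comp_zero]
    | zero => exact zero_comp
    | add a b _ _ ha hb => rw [Preadditive.add_comp, ha, hb, add_zero]
    | neg a _ ha => rw [Preadditive.neg_comp, ha, neg_zero]
  simpa using key _ hY

variable [Linear k D]

/-- If `x` has scalar endomorphisms, every linear map `Hom(x, Y) ⟶ Hom(x, Z)` is the composition
with a morphism `Y ⟶ Z`. -/
theorem IsSummandOfPower.exists_hom {x : D} (hx : ∀ f : x ⟶ x, ∃ c : k, f = c • 𝟙 x) {Y Z : D}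
    (hY : IsSummandOfPower x Y) (ψ : (x ⟶ Y) →ₗ[k] (x ⟶ Z)) :
    ∃ f : Y ⟶ Z, ∀ g : x ⟶ Y, g ≫ f = ψ g := by
  have key : ∀ h ∈ AddSubgroup.closure {h : Y ⟶ Y | ∃ (p : Y ⟶ x) (i : x ⟶ Y), h = p ≫ i},
      ∃ f : Y ⟶ Z, ∀ g : x ⟶ Y, g ≫ f = ψ (g ≫ h) := by
    intro h hh
    induction hh using AddSubgroup.closure_induction with
    | mem h hh =>
      obtain ⟨p, i, rfl⟩ := hh
      refine ⟨p ≫ ψ i, fun g => ?_⟩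
      obtain ⟨c, hc⟩ := hx (g ≫ p)
      rw [← Category.assoc, ← Category.assoc, hc, Linear.smul_comp, Linear.smul_comp,
        Category.id_comp, Category.id_comp, map_smul]
    | zero => exact ⟨0, fun g => by simp⟩
    | add a b _ _ ha hb =>
      obtain ⟨f, hf⟩ := ha
      obtain ⟨f', hf'⟩ := hb
      exact ⟨f + f', fun g => by rw [Preadditive.comp_add, hf, hf', Preadditive.comp_add, map_add]⟩
    | neg a _ ha =>
      obtain ⟨f, hf⟩ := ha
      exact ⟨-f, fun g => by rw [Preadditive.comp_neg, hf, Preadditive.comp_neg, map_neg]⟩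
  obtain ⟨f, hf⟩ := key _ hY
  exact ⟨f, fun g => by simpa using hf g⟩

/-- The functor `Hom(x, -)` with values in `FGModuleCat k`. As the morphisms of `D` live in
another universe than `k`, each `Hom(x, Y)` is replaced with `kʳ` by the choice of a basis. -/
noncomputable def coordinateFunctor (x : D) (hfin : ∀ Y : D, Module.Finite k (x ⟶ Y)) :
    D ⥤ FGModuleCat.{u} k :=
  let b (Y : D) : (x ⟶ Y) ≃ₗ[k] (Fin (Module.finrank k (x ⟶ Y)) → k) :=
    (Module.finBasis k (x ⟶ Y)).equivFun
  { obj := fun Y => FGModuleCat.of k (Fin (Module.finrank k (x ⟶ Y)) → k)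
    map := fun {Y Z} f => FGModuleCat.ofHom
      ((b Z).toLinearMap ∘ₗ Linear.rightComp k x f ∘ₗ (b Y).symm.toLinearMap)
    map_id := fun Y => by
      refine FGModuleCat.hom_ext (LinearMap.ext fun v => ?_)
      change (b Y) ((b Y).symm v ≫ 𝟙 Y) = v
      rw [Category.comp_id, LinearEquiv.apply_symm_apply]
    map_comp := fun {X Y Z} f g => by
      refine FGModuleCat.hom_ext (LinearMap.ext fun v => ?_)
      change (b Z) ((b X).symm v ≫ f ≫ g) = (b Z) ((b Y).symm ((b Y) ((b X).symm v ≫ f)) ≫ g)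
      rw [LinearEquiv.symm_apply_apply, Category.assoc] }

/-- If `x` has scalar endomorphisms and all objects are direct summands of finite direct sums of
copies of `x`, then `Hom(x, -)` is an equivalence with the finite dimensional vector spaces. The
condition `hpow` replaces the existence of direct sums in `D`. -/
theorem exists_linear_equivalence (x : D) (hfin : ∀ Y : D, Module.Finite k (x ⟶ Y))
    (hx : ∀ f : x ⟶ x, ∃ c : k, f = c • 𝟙 x) (hsummand : ∀ Y : D, IsSummandOfPower x Y)
    (hpow : ∀ r : ℕ, ∃ Y : D, Module.finrank k (x ⟶ Y) = r) :
    ∃ e : D ≌ FGModuleCat.{u} k, e.functor.Additive ∧ e.functor.Linear k := by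
  let b (Y : D) : (x ⟶ Y) ≃ₗ[k] (Fin (Module.finrank k (x ⟶ Y)) → k) :=
    (Module.finBasis k (x ⟶ Y)).equivFun
  let G := coordinateFunctor x hfin
  have hG : ∀ {Y Z : D} (f : Y ⟶ Z) (g : x ⟶ Y), (G.map f).hom.hom (b Y g) = b Z (g ≫ f) := by
    intro Y Z f g
    change (b Z) (Linear.rightComp k x f ((b Y).symm (b Y g))) = _
    rw [LinearEquiv.symm_apply_apply]
    rfl
  have hext : ∀ {Y Z : D} {φ ψ : G.obj Y ⟶ G.obj Z},
      (∀ g, φ.hom.hom (b Y g) = ψ.hom.hom (b Y g)) → φ = ψ := by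
    intro Y Z φ ψ h
    refine FGModuleCat.hom_ext (LinearMap.ext fun v => ?_)
    obtain ⟨g, rfl⟩ := (b Y).surjective v
    exact h g
  have hadd : G.Additive := ⟨fun {Y Z f f'} => hext fun g => by
    change _ = (G.map f).hom.hom (b Y g) + (G.map f').hom.hom (b Y g)
    rw [hG, hG, hG, Preadditive.comp_add, map_add]
    rfl⟩
  have hlin : G.Linear k := ⟨fun {Y Z} f c => hext fun g => by
    change _ = c • (G.map f).hom.hom (b Y g)
    rw [hG, hG, Linear.comp_smul, map_smul]
    rfl⟩
  have hfaith : G.Faithful := ⟨fun {Y Z f f'} h => by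
    rw [← sub_eq_zero]
    refine (hsummand Y).eq_zero fun g => ?_
    rw [Preadditive.comp_sub, sub_eq_zero]
    apply (b Z).injective
    rw [← hG, ← hG, h]⟩
  have hfull : G.Full := ⟨fun {Y Z} φ => by
    obtain ⟨f, hf⟩ := (hsummand Y).exists_hom hx
      ((b Z).symm.toLinearMap ∘ₗ φ.hom.hom ∘ₗ (b Y).toLinearMap)
    refine ⟨f, hext fun g => ?_⟩
    rw [hG, hf]
    exact (b Z).apply_symm_apply _⟩
  have hess : G.EssSurj := ⟨fun V => by
    obtain ⟨Y, hY⟩ := hpow (Module.finrank k V)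
    have e : (Fin (Module.finrank k (x ⟶ Y)) → k) ≃ₗ[k] V :=
      LinearEquiv.ofFinrankEq _ _ (by rw [Module.finrank_fin_fun, hY])
    exact ⟨Y, ⟨e.toFGModuleCatIso⟩⟩⟩
  have : G.IsEquivalence := {}
  exact ⟨G.asEquivalence, hadd, hlin⟩

end Brick

/-! ### Rearranging filtrations -/

section Torsion

variable {A : Type u₁} [Category.{v₁} A] [Abelian A]

/-- Third isomorphism theorem: for subobjects `T ⊆ K ⊆ Y` the quotients form a short exact
sequence `K / T ⟶ Y / T ⟶ Y / K`. -/
theorem exists_shortExact_quotients {T K Q Y F : A} {i : T ⟶ K} {p : K ⟶ Q} {w : i ≫ p = 0}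
    (h : (ShortComplex.mk i p w).ShortExact) {j : K ⟶ Y} {q : Y ⟶ F} {w' : j ≫ q = 0}
    (h' : (ShortComplex.mk j q w').ShortExact) :
    ∃ (G : A) (r : Y ⟶ G) (a : Q ⟶ G) (b : G ⟶ F) (w₁ : (i ≫ j) ≫ r = 0) (w₂ : a ≫ b = 0),
      (ShortComplex.mk (i ≫ j) r w₁).ShortExact ∧ (ShortComplex.mk a b w₂).ShortExact := by
  have : Mono i := h.mono_f
  have : Mono j := h'.mono_f
  have : Epi p := h.epi_g
  have : Epi q := h'.epi_g
  let a : Q ⟶ cokernel (i ≫ j) :=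
    (CokernelCofork.IsColimit.desc' h.gIsCokernel (j ≫ cokernel.π (i ≫ j))
      ((Category.assoc _ _ _).symm.trans (cokernel.condition (i ≫ j)))).1
  have ha : p ≫ a = j ≫ cokernel.π (i ≫ j) :=
    (CokernelCofork.IsColimit.desc' h.gIsCokernel (j ≫ cokernel.π (i ≫ j))
      ((Category.assoc _ _ _).symm.trans (cokernel.condition (i ≫ j)))).2
  let b : cokernel (i ≫ j) ⟶ F := cokernel.desc (i ≫ j) q (by simp [w'])
  have hb : cokernel.π (i ≫ j) ≫ b = q := cokernel.π_desc _ _ _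
  have hab : a ≫ b = 0 := by
    rw [← cancel_epi p, reassoc_of% ha, hb, w', comp_zero]
  refine ⟨_, cokernel.π (i ≫ j), a, b, cokernel.condition _, hab, shortExact_cokernel _, ?_⟩
  have hepi : Epi b := epi_of_epi_fac hb
  have hmono : Mono a := by
    rw [Preadditive.mono_iff_cancel_zero]
    intro W x hx
    have sq := (IsPullback.of_hasPullback x p).w
    rw [← cancel_epi (pullback.fst x p), comp_zero, sq]
    have h1 : (pullback.snd x p ≫ j) ≫ cokernel.π (i ≫ j) = 0 := by
      rw [Category.assoc, ← ha, ← reassoc_of% sq, hx, comp_zero]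
    obtain ⟨l, hl⟩ := KernelFork.IsLimit.lift' (shortExact_cokernel (i ≫ j)).fIsKernel _ h1
    have hl' : l ≫ i = pullback.snd x p := by
      rw [← cancel_mono j, Category.assoc]
      exact hl
    rw [← hl', Category.assoc, w, comp_zero]
  exact
  { exact := by
      refine ShortComplex.exact_of_g_is_cokernel _
        (CokernelCofork.IsColimit.ofπ' _ _ (fun {U} t ht => ?_))
      have h2 : j ≫ cokernel.π (i ≫ j) ≫ t = 0 := by
        rw [← Category.assoc, ← ha, Category.assoc, ht, comp_zero]
      obtain ⟨d, hd⟩ := CokernelCofork.IsColimit.desc' h'.gIsCokernel _ h2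
      refine ⟨d, ?_⟩
      rw [← cancel_epi (cokernel.π (i ≫ j)), reassoc_of% hb]
      exact hd
    mono_f := hmono
    epi_g := hepi }

/-- The preimage `K` in `Y₂` of a subobject `T` of `Y₃`. -/
theorem exists_shortExact_preimage {Y₁ Y₂ Y₃ T F : A} {f : Y₁ ⟶ Y₂} {g : Y₂ ⟶ Y₃} {w : f ≫ g = 0}
    (h : (ShortComplex.mk f g w).ShortExact) {i : T ⟶ Y₃} {p : Y₃ ⟶ F} {w' : i ≫ p = 0}
    (h' : (ShortComplex.mk i p w').ShortExact) :
    ∃ (K : A) (a : Y₁ ⟶ K) (b : K ⟶ T) (j : K ⟶ Y₂) (w₁ : a ≫ b = 0) (w₂ : j ≫ g ≫ p = 0),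
      a ≫ j = f ∧ b ≫ i = j ≫ g ∧
      (ShortComplex.mk a b w₁).ShortExact ∧ (ShortComplex.mk j (g ≫ p) w₂).ShortExact := by
  have : Mono i := h'.mono_f
  have : Epi g := h.epi_g
  have : Epi p := h'.epi_g
  obtain ⟨K, j, b, sq, hb⟩ := (abelianExact A).ex2 g i ⟨_, f, w, h⟩
  obtain ⟨a, w₁, haj, hab⟩ := (abelianExact A).conf_of_isPullback h sq hb
  have hj : Mono j := by
    refine ⟨fun u v huv => sq.hom_ext huv ?_⟩
    rw [← cancel_mono i, Category.assoc, Category.assoc, ← sq.w, reassoc_of% huv]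
  have w₂ : j ≫ g ≫ p = 0 := by rw [← Category.assoc, sq.w, Category.assoc, w', comp_zero]
  refine ⟨K, a, b, j, w₁, w₂, haj, sq.w.symm, hab, ?_⟩
  exact
  { exact := by
      refine ShortComplex.exact_of_f_is_kernel _
        (KernelFork.IsLimit.ofι' _ _ (fun {U} t ht => ?_))
      have ht' : (t ≫ g) ≫ p = 0 := by simpa using ht
      obtain ⟨l, hl⟩ := KernelFork.IsLimit.lift' h'.fIsKernel _ ht'
      exact ⟨sq.lift t l hl.symm, sq.lift_fst _ _ _⟩
    mono_f := hj
    epi_g := by dsimp; infer_instance }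

/-- If the restriction of `r` to the subobject `Y` of `K` is an epimorphism with kernel `T₁`, then
`ker r` is an extension of `K / Y` by `T₁`. -/
theorem exists_shortExact_kernel {Y K T₃ T₁ F : A} {a : Y ⟶ K} {b : K ⟶ T₃} {w : a ≫ b = 0}
    (h : (ShortComplex.mk a b w).ShortExact) {i : T₁ ⟶ Y} {p : Y ⟶ F} {w' : i ≫ p = 0}
    (h' : (ShortComplex.mk i p w').ShortExact) (r : K ⟶ F) (hr : a ≫ r = p) :
    ∃ (T : A) (f : T₁ ⟶ T) (g : T ⟶ T₃) (j : T ⟶ K) (w₁ : f ≫ g = 0) (w₂ : j ≫ r = 0),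
      (ShortComplex.mk f g w₁).ShortExact ∧ (ShortComplex.mk j r w₂).ShortExact := by
  have : Mono i := h'.mono_f
  have : Mono a := h.mono_f
  have : Epi b := h.epi_g
  have : Epi p := h'.epi_g
  have : Epi r := epi_of_epi_fac hr
  let f : T₁ ⟶ kernel r := kernel.lift r (i ≫ a) (by rw [Category.assoc, hr, w'])
  have hf : f ≫ kernel.ι r = i ≫ a := kernel.lift_ι _ _ _
  have hfm : Mono f := mono_of_mono_fac hf
  have w₁ : f ≫ kernel.ι r ≫ b = 0 := by rw [reassoc_of% hf, w, comp_zero]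
  refine ⟨kernel r, f, kernel.ι r ≫ b, kernel.ι r, w₁, kernel.condition r, ?_,
    shortExact_kernel r⟩
  exact
  { exact := by
      refine ShortComplex.exact_of_f_is_kernel _
        (KernelFork.IsLimit.ofι' _ _ (fun {U} t ht => ?_))
      have ht' : (t ≫ kernel.ι r) ≫ b = 0 := by simpa using ht
      obtain ⟨l, hl⟩ := KernelFork.IsLimit.lift' h.fIsKernel _ ht'
      have hl0 : l ≫ a = t ≫ kernel.ι r := hl
      have hl' : l ≫ p = 0 := by
        rw [← hr, reassoc_of% hl0, kernel.condition, comp_zero]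
      obtain ⟨l', hl'⟩ := KernelFork.IsLimit.lift' h'.fIsKernel _ hl'
      have hl1 : l' ≫ i = l := hl'
      refine ⟨l', ?_⟩
      dsimp
      rw [← cancel_mono (kernel.ι r), Category.assoc, hf, reassoc_of% hl1, hl0]
    mono_f := hfm
    epi_g := by
      dsimp
      rw [Preadditive.epi_iff_cancel_zero]
      intro U t ht
      rw [Category.assoc] at ht
      obtain ⟨d, hd⟩ := CokernelCofork.IsColimit.desc' (shortExact_kernel r).gIsCokernel _ ht
      have hd' : r ≫ d = b ≫ t := hd
      have hd0 : d = 0 := by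
        rw [← cancel_epi p, ← hr, Category.assoc, hd', reassoc_of% w, zero_comp, comp_zero]
      rw [← cancel_epi b, ← hd', hd0, comp_zero, comp_zero] }

section

variable [HasExt.{w} A]

theorem ExtZero.splitting {S : ShortComplex A} (hS : S.ShortExact)
    (h : ExtZero.{u₁, v₁, w} 1 S.X₃ S.X₁) : Nonempty S.Splitting := by
  obtain ⟨s, hs⟩ := h.lift hS (𝟙 S.X₃)
  have := hS.mono_f
  exact ⟨.ofExactOfSection S hS.exact s hs this⟩

/-- If `Ext¹(T, F) = 0` for all `T` filtered by `P` and all `F` filtered by `Q`, then every object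
filtered by `P` and `Q` is an extension of an object filtered by `Q` by one filtered by `P`. -/
theorem exists_torsion_sequence {P Q : ObjectProperty A}
    (hPQ : ∀ T F, P T → Q F → ExtZero.{u₁, v₁, w} 1 T F) {Y : A}
    (hY : (abelianExact A).ExtClosure (fun Z => P Z ∨ Q Z) Y) :
    ∃ (T F : A) (i : T ⟶ Y) (p : Y ⟶ F) (hw : i ≫ p = 0), (ShortComplex.mk i p hw).ShortExact ∧
      (abelianExact A).ExtClosure P T ∧ (abelianExact A).ExtClosure Q F := by
  have hPQ' : ∀ T F, (abelianExact A).ExtClosure P T → (abelianExact A).ExtClosure Q F →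
      ExtZero.{u₁, v₁, w} 1 T F := fun T F hT hF =>
    extZero_left hT fun T' hT' => extZero_right hF fun F' hF' => hPQ T' F' hT' hF'
  have base : ∀ Y, (abelianExact A).ExtClosure P Y →
      ∃ (T F : A) (i : T ⟶ Y) (p : Y ⟶ F) (hw : i ≫ p = 0), (ShortComplex.mk i p hw).ShortExact ∧
        (abelianExact A).ExtClosure P T ∧ (abelianExact A).ExtClosure Q F := fun Y hY =>
    ⟨Y, 0, 𝟙 Y, 0, comp_zero, shortExact_of_iso (Iso.refl Y), hY, .zero _ (isZero_zero A)⟩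
  induction hY with
  | zero Z hZ => exact base Z (.zero Z hZ)
  | of X hX =>
    obtain hX | hX := hX
    · exact base X (.of X hX)
    · exact ⟨0, X, 0, 𝟙 X, zero_comp, (abelianExact A).ex0 X 0 (isZero_zero A),
        .zero _ (isZero_zero A), .of X hX⟩
  | ext S hS _ _ h₁ h₃ =>
    obtain ⟨T₁, F₁, i₁, p₁, w₁, e₁, hT₁, hF₁⟩ := h₁
    obtain ⟨T₃, F₃, i₃, p₃, w₃, e₃, hT₃, hF₃⟩ := h₃
    obtain ⟨K, a, b, j, wab, wj, -, -, hab, hj⟩ := exists_shortExact_preimage hS e₃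
    obtain ⟨r, hr⟩ := (hPQ' _ _ hT₃ hF₁).extend hab p₁
    obtain ⟨T, f, g, l, wfg, wl, hfg, hl⟩ := exists_shortExact_kernel hab e₁ r hr
    obtain ⟨G, s, c, d, ws, wcd, hs, hcd⟩ := exists_shortExact_quotients hl hj
    exact ⟨T, G, l ≫ j, s, ws, hs, extClosure_ext hfg hT₁ hT₃, extClosure_ext hcd hF₁ hF₃⟩

end

/-- A nonzero object of an extension closure contains one of the generating objects, with quotient
in the extension closure. -/
theorem isZero_or_exists_generator {P : ObjectProperty A} {Y : A}
    (hY : (abelianExact A).ExtClosure P Y) :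
    IsZero Y ∨ ∃ (W Z : A) (i : W ⟶ Y) (p : Y ⟶ Z) (hw : i ≫ p = 0),
      (ShortComplex.mk i p hw).ShortExact ∧ P W ∧ (abelianExact A).ExtClosure P Z := by
  induction hY with
  | zero Z hZ => exact .inl hZ
  | of X hX =>
    exact .inr ⟨X, 0, 𝟙 X, 0, comp_zero, shortExact_of_iso (Iso.refl X), hX,
      .zero _ (isZero_zero A)⟩
  | ext S hS h₁' h₃' h₁ h₃ =>
    obtain h₁ | ⟨W, Z, i, p, hw, e, hW, hZ⟩ := h₁
    · have : IsIso S.g := by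
        have := hS.epi_g
        have : Mono S.g := (S.exact_iff_mono (h₁.eq_of_src _ _)).1 hS.exact
        exact isIso_of_mono_of_epi _
      obtain h₃ | ⟨W, Z, i, p, hw, e, hW, hZ⟩ := h₃
      · exact .inl (h₃.of_iso (asIso S.g))
      · refine .inr ⟨W, Z, i ≫ inv S.g, S.g ≫ p, by simpa using hw, ?_, hW, hZ⟩
        exact ShortComplex.shortExact_of_iso
          (ShortComplex.isoMk (S₁ := ShortComplex.mk i p hw) (Iso.refl _) (asIso S.g).symm
            (Iso.refl _) (by simp) (by simp)) e
    · obtain ⟨G, r, a, b, w₁, w₂, hr, hab⟩ := exists_shortExact_quotients e hS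
      exact .inr ⟨W, G, i ≫ S.f, r, w₁, hr, hW, extClosure_ext hab hZ h₃'⟩

end Torsion

/-! ### Extension closures as exact categories -/

section Induced

variable {A : Type u₁} [Category.{v₁} A] [Abelian A]

theorem isClosedUnderFiniteProducts_extClosure (C : ObjectProperty A) :
    ((abelianExact A).ExtClosure C).IsClosedUnderFiniteProducts := by
  let P := (abelianExact A).ExtClosure C
  have h0 : P.ContainsZero := ⟨0, isZero_zero A, .zero _ (isZero_zero A)⟩
  have h1 : P.IsClosedUnderIsomorphisms := ⟨fun e h => extClosure_of_iso e h⟩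
  have h2 : P.IsClosedUnderBinaryProducts := by
    refine ⟨fun X ⟨p⟩ => ?_⟩
    exact extClosure_of_iso (IsLimit.conePointsIsoOfNatIso p.isLimit
      (BinaryBiproduct.isLimit _ _) (diagramIsoPair p.diag)).symm
      (extClosure_biprod (p.prop_diag_obj _) (p.prop_diag_obj _))
  exact .mk'

variable {P : ObjectProperty A} (hP : (abelianExact A).IsFullyExact P)

theorem isZero_obj_iff {Y : P.FullSubcategory} : IsZero Y.obj ↔ IsZero Y := by
  rw [IsZero.iff_id_eq_zero, IsZero.iff_id_eq_zero]
  exact ⟨fun h => ObjectProperty.hom_ext _ h, fun h => congrArg (fun m => m.hom) h⟩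

/-- Extensions in a fully exact subcategory are the same as in the ambient category. A linear
combination of extensions involves a finite product, which has to belong to the subcategory. -/
theorem extFinite_induced (k : Type u) [Field k] [Linear k A] [P.IsClosedUnderFiniteProducts]
    {Z X : P.FullSubcategory} (h : (abelianExact A).ExtFinite k Z.obj X.obj) :
    ((abelianExact A).induced P hP).ExtFinite k Z X := by
  obtain ⟨n, e', he'⟩ := h
  refine ⟨n, fun j =>
    { mid := ⟨(e' j).mid, hP.ext _ (e' j).conf X.property Z.property⟩
      i := ObjectProperty.homMk (e' j).i
      p := ObjectProperty.homMk (e' j).p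
      zero := ObjectProperty.hom_ext _ (e' j).zero
      conf := (e' j).conf }, fun e => ?_⟩
  obtain ⟨a, V, π, ⟨hV⟩, η, h₁, m, hm₁, hm₂⟩ := he'
    { mid := e.mid.obj
      i := e.i.hom
      p := e.p.hom
      zero := congrArg (fun m => m.hom) e.zero
      conf := e.conf }
  have hPV : P V := P.prop_of_isLimit_fan hV fun _ => X.property
  refine ⟨a, ⟨V, hPV⟩, fun j => ObjectProperty.homMk (π j), ⟨?_⟩,
    { mid := ⟨η.mid, hP.ext _ η.conf hPV Z.property⟩
      i := ObjectProperty.homMk η.i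
      p := ObjectProperty.homMk η.p
      zero := ObjectProperty.hom_ext _ η.zero
      conf := η.conf }, fun j => ?_, ObjectProperty.homMk m, ?_, ObjectProperty.hom_ext _ hm₂⟩
  · refine Fan.IsLimit.mk _
      (fun s => ObjectProperty.homMk (Fan.IsLimit.lift hV fun j => (s.proj j).hom))
      (fun s j => ?_) (fun s t ht => ?_)
    · exact ObjectProperty.hom_ext _ (Fan.IsLimit.fac hV (fun j => (s.proj j).hom) j)
    · refine ObjectProperty.hom_ext _ (Fan.IsLimit.hom_ext hV _ _ fun j => ?_)
      exact (congrArg (fun m => m.hom) (ht j)).trans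
        (Fan.IsLimit.fac hV (fun j => (s.proj j).hom) j).symm
  · obtain ⟨l, hl₁, hl₂⟩ := h₁ j
    exact ⟨ObjectProperty.homMk l, ObjectProperty.hom_ext _ hl₁, ObjectProperty.hom_ext _ hl₂⟩
  · refine ObjectProperty.hom_ext _ (hm₁.trans ?_)
    change _ = P.ι.map (∑ j, a j • (ObjectProperty.homMk (π j) :
      (⟨V, hPV⟩ : P.FullSubcategory) ⟶ X)) ≫ e.i.hom
    rw [Functor.map_sum]
    rfl

variable [HasExt.{w} A]

theorem rightPerp_induced {T : ObjectProperty P.FullSubcategory} {F : P.FullSubcategory}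
    (h : ∀ X, T X → HomZero X.obj F.obj ∧ ExtZero.{u₁, v₁, w} 1 X.obj F.obj) :
    ((abelianExact A).induced P hP).rightPerp T F := by
  refine fun X hX => ⟨fun f => ObjectProperty.hom_ext _ ((h X hX).1 f.hom), fun e => ?_⟩
  obtain ⟨σ⟩ := (h X hX).2.splitting (S := ShortComplex.mk e.i.hom e.p.hom
    (congrArg (fun m => m.hom) e.zero)) e.conf
  exact ⟨{
    r := ObjectProperty.homMk σ.r
    s := ObjectProperty.homMk σ.s
    f_r := ObjectProperty.hom_ext _ σ.f_r
    s_g := ObjectProperty.hom_ext _ σ.s_g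
    id := ObjectProperty.hom_ext _ σ.id }⟩

end Induced

/-! ### Exceptional sequences -/

section Exceptional

variable {A : Type u₁} [Category.{v₁} A] [Abelian A]

/-- The objects filtered by the `X i` with `i ∈ s`. -/
def Filt {ι : Type*} (X : ι → A) (s : Set ι) : ObjectProperty A :=
  (abelianExact A).ExtClosure (fun Y => ∃ i ∈ s, Nonempty (Y ≅ X i))

theorem homZero_filt {ι : Type*} {X : ι → A} {s t : Set ι}
    (h : ∀ i ∈ s, ∀ j ∈ t, HomZero (X i) (X j)) {Y Z : A} (hY : Filt X s Y) (hZ : Filt X t Z) :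
    HomZero Y Z :=
  homZero_left hY fun _ ⟨i, hi, ⟨e⟩⟩ => homZero_right hZ fun _ ⟨j, hj, ⟨e'⟩⟩ =>
    ((h i hi j hj).of_iso_left e.symm).of_iso_right e'.symm

theorem isZero_of_filt_empty {ι : Type*} {X : ι → A} {s : Set ι} (hs : ∀ i, i ∉ s) {Y : A}
    (hY : Filt X s Y) : IsZero Y :=
  isZero_of_homZero_self (homZero_left hY fun _ ⟨i, hi, _⟩ => absurd hi (hs i))

theorem filt_univ {ι : Type*} {X : ι → A} {C : ObjectProperty A}
    (hC : ∀ Y, C Y ↔ ∃ i, Nonempty (Y ≅ X i)) {Y : A} (hY : (abelianExact A).ExtClosure C Y) :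
    Filt X Set.univ Y :=
  extClosure_mono (fun Y hY => by
    obtain ⟨i, e⟩ := (hC Y).1 hY
    exact ⟨i, trivial, e⟩) hY

theorem extClosure_of_filt {ι : Type*} {X : ι → A} {C : ObjectProperty A}
    (hC : ∀ Y, C Y ↔ ∃ i, Nonempty (Y ≅ X i)) {s : Set ι} {Y : A} (hY : Filt X s Y) :
    (abelianExact A).ExtClosure C Y :=
  extClosure_mono (fun Y ⟨i, _, e⟩ => (hC Y).2 ⟨i, e⟩) hY

variable [HasExt.{w} A]

/-- A sequence of objects with scalar endomorphisms such that `Hom(Xᵢ, Xⱼ) = 0` for `i < j` and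
`Ext¹(Xᵢ, Xⱼ) = 0` for `i ≤ j`. -/
structure IsExceptional (k : Type u) [Field k] [Linear k A] {n : ℕ} (X : Fin n → A) : Prop where
  homZero : ∀ i j, i < j → HomZero (X i) (X j)
  extZero : ∀ i j, i ≤ j → ExtZero.{u₁, v₁, w} 1 (X i) (X j)
  nonzero : ∀ i, ¬ IsZero (X i)
  scalar : ∀ i (f : X i ⟶ X i), ∃ c : k, f = c • 𝟙 (X i)

theorem extZero_filt {ι : Type*} {X : ι → A} {s t : Set ι} {m : ℕ}
    (h : ∀ i ∈ s, ∀ j ∈ t, ExtZero.{u₁, v₁, w} m (X i) (X j)) {Y Z : A} (hY : Filt X s Y)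
    (hZ : Filt X t Z) : ExtZero.{u₁, v₁, w} m Y Z :=
  extZero_left hY fun _ ⟨i, hi, ⟨e⟩⟩ => extZero_right hZ fun _ ⟨j, hj, ⟨e'⟩⟩ =>
    ((h i hi j hj).of_iso_left e.symm).of_iso_right e'.symm

variable {k : Type u} [Field k] [Linear k A] {n : ℕ} {X : Fin n → A}

/-- The factors of a filtration by an exceptional sequence can be rearranged so that those with
small index come first. -/
theorem IsExceptional.exists_torsion (hX : IsExceptional.{u, u₁, v₁, w} k X) (m : ℕ)
    {s : Set (Fin n)} {Y : A} (hY : Filt X s Y) :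
    ∃ (T F : A) (i : T ⟶ Y) (p : Y ⟶ F) (hw : i ≫ p = 0), (ShortComplex.mk i p hw).ShortExact ∧
      Filt X {i | i ∈ s ∧ i.val < m} T ∧ Filt X {i | i ∈ s ∧ m ≤ i.val} F := by
  refine exists_torsion_sequence.{u₁, v₁, w} ?_ (extClosure_mono ?_ hY)
  · rintro T F ⟨i, ⟨-, hi⟩, ⟨e⟩⟩ ⟨j, ⟨-, hj⟩, ⟨e'⟩⟩
    exact ((hX.extZero i j (Fin.le_def.2 (hi.le.trans hj))).of_iso_left e.symm).of_iso_right e'.symm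
  · rintro Y ⟨i, hi, e⟩
    by_cases him : i.val < m
    · exact .inl ⟨i, ⟨hi, him⟩, e⟩
    · exact .inr ⟨i, ⟨hi, not_lt.1 him⟩, e⟩

/-- As `Xᵢ` has no self-extensions, the objects filtered by `Xᵢ` alone are sums of copies of it. -/
theorem IsExceptional.isSummandOfPower (hX : IsExceptional.{u, u₁, v₁, w} k X) (i : Fin n) {Y : A}
    (hY : Filt X {i} Y) : IsSummandOfPower (X i) Y := by
  have hext : ∀ {Y Z}, Filt X {i} Y → Filt X {i} Z → ExtZero.{u₁, v₁, w} 1 Y Z :=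
    fun hY hZ => extZero_filt (by rintro _ rfl _ rfl; exact hX.extZero _ _ le_rfl) hY hZ
  have conj : ∀ {Y Z : A} (a : Z ⟶ Y) (b : Y ⟶ Z), IsSummandOfPower (X i) Y →
      a ≫ b ∈ AddSubgroup.closure {h : Z ⟶ Z | ∃ (p : Z ⟶ X i) (j : X i ⟶ Z), h = p ≫ j} := by
    intro Y Z a b hY
    have key : ∀ h ∈ AddSubgroup.closure {h : Y ⟶ Y | ∃ (p : Y ⟶ X i) (j : X i ⟶ Y), h = p ≫ j},
        a ≫ h ≫ b ∈ AddSubgroup.closure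
          {h : Z ⟶ Z | ∃ (p : Z ⟶ X i) (j : X i ⟶ Z), h = p ≫ j} := by
      intro h hh
      induction hh using AddSubgroup.closure_induction with
      | mem h hh =>
        obtain ⟨p, j, rfl⟩ := hh
        exact AddSubgroup.subset_closure ⟨a ≫ p, j ≫ b, by simp⟩
      | zero => simp
      | add f g _ _ hf hg => simpa using AddSubgroup.add_mem _ hf hg
      | neg f _ hf => simpa using AddSubgroup.neg_mem _ hf
    simpa using key _ hY
  induction hY with
  | zero Z hZ =>
    rw [IsSummandOfPower, hZ.eq_of_src (𝟙 Z) 0]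
    exact AddSubgroup.zero_mem _
  | of Y hY =>
    obtain ⟨_, rfl, ⟨e⟩⟩ := hY
    exact AddSubgroup.subset_closure ⟨e.hom, e.inv, by simp⟩
  | ext S hS h₁ h₃ ih₁ ih₃ =>
    obtain ⟨σ⟩ := (hext h₃ h₁).splitting hS
    rw [IsSummandOfPower, ← σ.id]
    exact AddSubgroup.add_mem _ (conj _ _ ih₁) (conj _ _ ih₃)

theorem IsExceptional.exists_finrank_hom (hX : IsExceptional.{u, u₁, v₁, w} k X)
    (hfin : ∀ X Y : A, Module.Finite k (X ⟶ Y)) (i : Fin n) (r : ℕ) :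
    ∃ Y : A, Filt X {i} Y ∧ Module.finrank k (X i ⟶ Y) = r := by
  induction r with
  | zero =>
    refine ⟨0, .zero _ (isZero_zero A), ?_⟩
    exact Module.finrank_zero_of_subsingleton
  | succ r ih =>
    obtain ⟨Y, hY, hr⟩ := ih
    refine ⟨Y ⊞ X i, extClosure_biprod hY (.of _ ⟨i, rfl, ⟨Iso.refl _⟩⟩), ?_⟩
    let e : (X i ⟶ Y ⊞ X i) ≃ₗ[k] (X i ⟶ Y) × (X i ⟶ X i) :=
      { toFun := fun f => (f ≫ biprod.fst, f ≫ biprod.snd)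
        invFun := fun g => biprod.lift g.1 g.2
        map_add' := fun f g => by simp
        map_smul' := fun c f => by simp
        left_inv := fun f => by ext <;> simp
        right_inv := fun g => by simp }
    have h1 : Module.finrank k (X i ⟶ X i) = 1 := by
      refine finrank_eq_one (𝟙 (X i)) (fun h => hX.nonzero i ((IsZero.iff_id_eq_zero _).2 h)) ?_
      intro f
      obtain ⟨c, hc⟩ := hX.scalar i f
      exact ⟨c, hc.symm⟩
    rw [e.finrank_eq, Module.finrank_prod, hr, h1]

end Exceptional

/-! ### The extension closure of an exceptional sequence -/

section Exceptional

variable {A : Type u₁} [Category.{v₁} A] [Abelian A] [HasExt.{w} A]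
  {k : Type u} [Field k] [Linear k A] {n : ℕ} {X : Fin n → A}

/-- The extension closure of an exceptional sequence is thin: the filtration is given by the
extension closures of the initial segments of the sequence. -/
theorem IsExceptional.isThin (hX : IsExceptional.{u, u₁, v₁, w} k X)
    (hfin : ∀ X Y : A, Module.Finite k (X ⟶ Y))
    (hext : ∀ X Y : A, (abelianExact A).ExtFinite k X Y)
    {C : ObjectProperty A} (hC : ∀ Y, C Y ↔ ∃ i, Nonempty (Y ≅ X i))
    (hP : (abelianExact A).IsFullyExact ((abelianExact A).ExtClosure C)) :
    ((abelianExact A).induced _ hP).IsThin k := by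
  have hprod := isClosedUnderFiniteProducts_extClosure C
  have hfin' : ∀ Y Z : ((abelianExact A).ExtClosure C).FullSubcategory,
      Module.Finite k (Y ⟶ Z) := fun Y Z =>
    Module.Finite.equiv (InducedCategory.homLinearEquiv (R := k) (X := Y) (Y := Z)).symm
  let T : Fin (n + 1) → ObjectProperty ((abelianExact A).ExtClosure C).FullSubcategory :=
    fun m Y => Filt X {i | i.val < m.val} Y.obj
  -- the objects filtered by the later members of the sequence are orthogonal to `T m`
  have hperp : ∀ (m : Fin (n + 1)) (F : ((abelianExact A).ExtClosure C).FullSubcategory),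
      Filt X {i | m.val ≤ i.val} F.obj → ((abelianExact A).induced _ hP).rightPerp (T m) F := by
    intro m F hF
    refine rightPerp_induced.{u₁, v₁, w} hP fun Y hY => ⟨homZero_filt ?_ hY hF,
      extZero_filt ?_ hY hF⟩
    · exact fun i hi j hj => hX.homZero i j (Fin.lt_def.2 (lt_of_lt_of_le hi hj))
    · exact fun i hi j hj => hX.extZero i j (Fin.le_def.2 (hi.le.trans hj))
  refine ⟨hfin', fun Y Z => extFinite_induced hP k (hext _ _), n, T, fun m => ⟨⟨?_, ?_⟩, ?_⟩, ?_,
    fun Y => ⟨fun h => ?_, fun h => ?_⟩, fun Y => ?_, fun i => ?_⟩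
  · exact ⟨⟨0, .zero _ (isZero_zero A)⟩, isZero_obj_iff.1 (isZero_zero A),
      .zero _ (isZero_zero A)⟩
  · exact fun S hS h₁ h₃ => extClosure_ext (S := S.map (ObjectProperty.ι _)) hS h₁ h₃
  · intro Y
    obtain ⟨T', F, i, p, hw, e, hT, hF⟩ := hX.exists_torsion m (filt_univ hC Y.property)
    simp only [Set.mem_univ, true_and] at hT hF
    exact ⟨ShortComplex.mk (X₁ := ⟨T', extClosure_of_filt hC hT⟩) (X₂ := Y)
      (X₃ := ⟨F, extClosure_of_filt hC hF⟩) (ObjectProperty.homMk i) (ObjectProperty.homMk p)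
      (ObjectProperty.hom_ext _ hw), e, rfl, hT, hperp m _ hF⟩
  · exact fun m m' hm Y hY => extClosure_mono
      (fun Z ⟨i, hi, e⟩ => ⟨i, lt_of_lt_of_le hi (Fin.le_def.1 hm), e⟩) hY
  · exact isZero_obj_iff.1 (isZero_of_filt_empty (fun i hi => by simp at hi) h)
  · exact .zero _ (isZero_obj_iff.2 h)
  · exact extClosure_mono (fun Z ⟨i, _, e⟩ => ⟨i, i.isLt, e⟩) (filt_univ hC Y.property)
  · -- the graded pieces consist of the direct sums of copies of `X i`
    let R := ((abelianExact A).induced _ hP).rightPerp (T i.castSucc) ⊓ T i.succ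
    have hR : ∀ Y, R Y → Filt X {i} Y.obj := by
      rintro Y ⟨hY, hY'⟩
      obtain ⟨T', F, a, p, hw, e, hT, hF⟩ := hX.exists_torsion i.val hY'
      have hT' : Filt X {j | j.val < i.castSucc.val} T' :=
        extClosure_mono (fun Z ⟨j, hj, e⟩ => ⟨j, hj.2, e⟩) hT
      have ha : a = 0 := congrArg (fun m => m.hom)
        ((hY ⟨T', extClosure_of_filt hC hT⟩ hT').1 (ObjectProperty.homMk a))
      have : Epi p := e.epi_g
      have : Mono p := (ShortComplex.exact_iff_mono _ ha).1 e.exact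
      have : IsIso p := isIso_of_mono_of_epi p
      refine extClosure_of_iso (asIso p).symm (extClosure_mono ?_ hF)
      rintro Z ⟨j, ⟨hj₁, hj₂⟩, e⟩
      refine ⟨j, ?_, e⟩
      rw [Set.mem_ofPred_eq, Fin.val_succ] at hj₁
      exact Fin.ext (by omega)
    have hR' : ∀ Y : ((abelianExact A).ExtClosure C).FullSubcategory, Filt X {i} Y.obj → R Y := by
      intro Y hY
      refine ⟨hperp _ _ (extClosure_mono ?_ hY), extClosure_mono ?_ hY⟩
      · rintro Z ⟨_, rfl, e⟩
        exact ⟨_, by simp, e⟩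
      · rintro Z ⟨_, rfl, e⟩
        exact ⟨_, by simp, e⟩
    have hXi : Filt X {i} (X i) := .of _ ⟨i, rfl, ⟨Iso.refl _⟩⟩
    let mk (Y : A) (hY : Filt X {i} Y) : R.FullSubcategory :=
      ⟨⟨Y, extClosure_of_filt hC hY⟩, hR' _ hY⟩
    let E (Y Z : R.FullSubcategory) : (Y ⟶ Z) ≃ₗ[k] (Y.obj.obj ⟶ Z.obj.obj) :=
      (InducedCategory.homLinearEquiv (R := k) (X := Y) (Y := Z)).trans
        (InducedCategory.homLinearEquiv (R := k) (X := Y.obj) (Y := Z.obj))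
    refine exists_linear_equivalence (mk (X i) hXi) (fun Y => ?_) (fun f => ?_) (fun Y => ?_)
      (fun r => ?_)
    · have := hfin (X i) Y.obj.obj
      exact Module.Finite.equiv (E (mk (X i) hXi) Y).symm
    · obtain ⟨c, hc⟩ := hX.scalar i f.hom.hom
      exact ⟨c, (E (mk (X i) hXi) (mk (X i) hXi)).injective
        (hc.trans ((E (mk (X i) hXi) (mk (X i) hXi)).map_smul c (𝟙 (mk (X i) hXi))).symm)⟩
    · have h1 := hX.isSummandOfPower i (hR Y.obj Y.property)
      let φ : (Y.obj.obj ⟶ Y.obj.obj) →+ (Y ⟶ Y) := (E Y Y).symm.toLinearMap.toAddMonoidHom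
      have h2 := AddSubgroup.mem_map_of_mem φ h1
      rw [AddMonoidHom.map_closure] at h2
      refine (AddSubgroup.closure_mono ?_ : _ ≤ _) h2
      rintro _ ⟨_, ⟨p, j, rfl⟩, rfl⟩
      exact ⟨(E Y (mk (X i) hXi)).symm p, (E (mk (X i) hXi) Y).symm j, rfl⟩
    · obtain ⟨Y, hY, hr⟩ := hX.exists_finrank_hom hfin i r
      exact ⟨mk Y hY, ((E (mk (X i) hXi) (mk Y hY)).finrank_eq).trans hr⟩

/-- The members of an exceptional sequence are the irreducible objects of its extension closure. -/
theorem IsExceptional.isRepresentativeFamily (hX : IsExceptional.{u, u₁, v₁, w} k X)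
    {C : ObjectProperty A} (hC : ∀ Y, C Y ↔ ∃ i, Nonempty (Y ≅ X i))
    (hP : (abelianExact A).IsFullyExact ((abelianExact A).ExtClosure C)) :
    IsRepresentativeFamily (fun Y => ((abelianExact A).induced _ hP).IsIrreducible Y)
      (fun i => ⟨X i, .of _ ((hC _).2 ⟨i, ⟨Iso.refl _⟩⟩)⟩) where
  prop i := by
    refine ⟨fun h => hX.nonzero i (isZero_obj_iff.2 h), ?_⟩
    rintro Y j ⟨Z, p, hw, e⟩
    replace e : (ShortComplex.mk j.hom p.hom (congrArg (fun m => m.hom) hw)).ShortExact := e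
    have hXi : Filt X {i} (X i) := .of _ ⟨i, rfl, ⟨Iso.refl _⟩⟩
    have : Mono j.hom := e.mono_f
    have : Epi p.hom := e.epi_g
    -- a quotient of `X i` is filtered by the `X l` with `l ≤ i`
    have hZ : Filt X {l | l.val ≤ i.val} Z.obj := by
      obtain ⟨T, F, a, q, hw', e', hT, hF⟩ :=
        hX.exists_torsion (i.val + 1) (filt_univ hC Z.property)
      have hq : p.hom ≫ q = 0 := homZero_filt
        (s := {i}) (t := {l | l ∈ Set.univ ∧ i.val + 1 ≤ l.val})
        (by rintro _ rfl l ⟨-, hl⟩; exact hX.homZero _ _ (Fin.lt_def.2 (by omega))) hXi hF _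
      have hF0 : q = 0 := by rw [← cancel_epi p.hom, hq, comp_zero]
      have : Mono a := e'.mono_f
      have : Epi a := (ShortComplex.exact_iff_epi _ hF0).1 e'.exact
      have : IsIso a := isIso_of_mono_of_epi a
      exact extClosure_of_iso (asIso a) (extClosure_mono
        (fun W ⟨l, hl, e⟩ => ⟨l, Nat.lt_succ_iff.1 hl.2, e⟩) hT)
    -- a subobject of `X i` is filtered by the `X l` with `i ≤ l`
    have hY : Filt X {l | i.val ≤ l.val} Y.obj := by
      obtain ⟨T, F, a, q, hw', e', hT, hF⟩ :=
        hX.exists_torsion i.val (filt_univ hC Y.property)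
      have ha : a ≫ j.hom = 0 := homZero_filt (s := {l | l ∈ Set.univ ∧ l.val < i.val}) (t := {i})
        (by rintro l ⟨-, hl⟩ _ rfl; exact hX.homZero _ _ (Fin.lt_def.2 hl)) hT hXi _
      have ha0 : a = 0 := by rw [← cancel_mono j.hom, ha, zero_comp]
      have : Epi q := e'.epi_g
      have : Mono q := (ShortComplex.exact_iff_mono _ ha0).1 e'.exact
      have : IsIso q := isIso_of_mono_of_epi q
      exact extClosure_of_iso (asIso q).symm (extClosure_mono
        (fun W ⟨l, hl, e⟩ => ⟨l, hl.2, e⟩) hF)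
    -- so the conflation splits, whereas `X i` is indecomposable
    have hvan : ExtZero.{u₁, v₁, w} 1 Z.obj Y.obj := extZero_filt
      (fun l hl l' hl' => hX.extZero l l' (Fin.le_def.2 (le_trans hl hl'))) hZ hY
    obtain ⟨σ⟩ := hvan.splitting e
    have hσ : j.hom ≫ σ.r = 𝟙 _ := σ.f_r
    obtain ⟨c, hc⟩ := hX.scalar i (σ.r ≫ j.hom)
    by_cases h0 : c = 0
    · left
      refine ObjectProperty.hom_ext _ ?_
      change j.hom = 0
      rw [← Category.id_comp j.hom, ← hσ, Category.assoc]
      refine (congrArg (j.hom ≫ ·) (hc.trans ?_)).trans comp_zero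
      rw [h0, zero_smul]
    · right
      rw [← ObjectProperty.isIso_hom_iff]
      refine ⟨σ.r, hσ, ?_⟩
      have h1 : c • j.hom = j.hom := by
        have : j.hom ≫ σ.r ≫ j.hom = j.hom ≫ (c • 𝟙 (X i)) := congrArg (j.hom ≫ ·) hc
        rw [reassoc_of% hσ, Linear.comp_smul] at this
        exact ((Category.comp_id j.hom) ▸ this).symm
      have h2 : (c * c) • 𝟙 (X i) = c • 𝟙 (X i) := by
        rw [mul_smul, ← hc, ← Linear.comp_smul]
        exact congrArg (σ.r ≫ ·) h1
      have h3 : 𝟙 (X i) ≠ 0 := fun h => hX.nonzero i ((IsZero.iff_id_eq_zero _).2 h)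
      have h4 : c * c = c := smul_left_injective k h3 h2
      have h5 : c = 1 := mul_left_cancel₀ h0 (by rw [h4, mul_one])
      exact hc.trans (by rw [h5, one_smul])
  inj i j := by
    rintro ⟨e⟩
    have e' : X i ≅ X j := (ObjectProperty.ι _).mapIso e
    rcases lt_trichotomy i j with h | h | h
    · exact absurd (isZero_of_homZero_self ((hX.homZero i j h).of_iso_right e'.symm)) (hX.nonzero i)
    · exact h
    · exact absurd (isZero_of_homZero_self ((hX.homZero j i h).of_iso_right e')) (hX.nonzero j)
  exhaust Y := by
    rintro ⟨h0, hY⟩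
    obtain h | ⟨W, Z, i, p, hw, e, hW, hZ⟩ := isZero_or_exists_generator Y.property
    · exact absurd (isZero_obj_iff.1 h) h0
    · obtain ⟨l, ⟨e'⟩⟩ := (hC W).1 hW
      refine ⟨l, ?_⟩
      have h1 := hY ⟨W, .of _ hW⟩ (ObjectProperty.homMk i) ⟨⟨Z, hZ⟩, ObjectProperty.homMk p,
        ObjectProperty.hom_ext _ hw, e⟩
      obtain h1 | h1 := h1
      · have : Mono i := e.mono_f
        have hi : i = 0 := congrArg (fun m => m.hom) h1
        have hW0 : IsZero W := by
          rw [IsZero.iff_id_eq_zero, ← cancel_mono i, hi, comp_zero, comp_zero]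
        exact absurd (hW0.of_iso e'.symm) (hX.nonzero l)
      · exact ⟨(asIso (ObjectProperty.homMk i)).symm ≪≫ ObjectProperty.isoMk
          (X := ⟨W, _⟩) (Y := ⟨X l, .of _ ((hC _).2 ⟨l, ⟨Iso.refl _⟩⟩)⟩) _ e'⟩

end Exceptional

/-! ### Right exact functors on resolving subcategories -/

section RightExact

variable {E : Type u₁} [Category.{v₁} E] [Preadditive E] {S : ExactStructure E}
  {B : Type u₃} [Category.{v₃} B] [Abelian B] {F : E ⥤ B}

theorem IsRightExact.epi_map (hF : IsRightExact S (abelianExact B) F) {T : ShortComplex E}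
    (hT : S.conf T) : Epi (F.map T.g) := by
  obtain ⟨K, d', i', hw, hc, -, -⟩ := hF.2 T hT
  exact ShortComplex.ShortExact.epi_g hc

theorem IsRightExact.exists_desc (hF : IsRightExact S (abelianExact B) F) {T : ShortComplex E}
    (hT : S.conf T) {U : B} (t : F.obj T.X₂ ⟶ U) (ht : F.map T.f ≫ t = 0) :
    ∃ u : F.obj T.X₃ ⟶ U, F.map T.g ≫ u = t := by
  obtain ⟨K, d', i', hw, hc, ⟨M, j, hj, hd⟩, hf⟩ := hF.2 T hT
  have : Epi d' := ShortComplex.ShortExact.epi_g hd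
  have hi : i' ≫ t = 0 := by
    rw [← cancel_epi d', ← Category.assoc, ← hf, ht, comp_zero]
  obtain ⟨u, hu⟩ := CokernelCofork.IsColimit.desc' (ShortComplex.ShortExact.gIsCokernel hc) t hi
  exact ⟨u, hu⟩

theorem isRightExact_of_exists_desc [F.Additive]
    (h : ∀ T : ShortComplex E, S.conf T → Epi (F.map T.g) ∧ ∀ (U : B) (t : F.obj T.X₂ ⟶ U),
      F.map T.f ≫ t = 0 → ∃ u : F.obj T.X₃ ⟶ U, F.map T.g ≫ u = t) :
    IsRightExact S (abelianExact B) F := by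
  refine ⟨inferInstance, fun T hT => ?_⟩
  obtain ⟨hepi, hdesc⟩ := h T hT
  have hw : F.map T.f ≫ F.map T.g = 0 := by rw [← F.map_comp, T.zero, F.map_zero]
  have hex : (ShortComplex.mk _ _ hw).Exact :=
    ShortComplex.exact_of_g_is_cokernel _ (CokernelCofork.IsColimit.ofπ' _ _
      fun {U} t ht => ⟨(hdesc U t ht).choose, (hdesc U t ht).choose_spec⟩)
  rw [ShortComplex.exact_iff_epi_kernel_lift] at hex
  exact ⟨kernel (F.map T.g), kernel.lift _ _ hw, kernel.ι _, kernel.condition _,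
    shortExact_kernel _, ⟨_, _, _, shortExact_kernel (kernel.lift _ _ hw)⟩,
    (kernel.lift_ι _ _ _).symm⟩

end RightExact

/-- The subcategory `P` contains enough projectives of the ambient abelian category, and the
syzygies of its own objects. -/
structure HasProjectiveResolutions {A : Type u₂} [Category.{v₂} A] [Abelian A]
    (P : ObjectProperty A) : Prop where
  cover : ∀ M : A, ∃ (Q : A) (f : Q ⟶ M), P Q ∧ Projective Q ∧ Epi f
  syzygy : ∀ X : A, P X → ∃ (Q : A) (f : Q ⟶ X), P Q ∧ Projective Q ∧ Epi f ∧ P (kernel f)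

section KanLeg

variable {A : Type u₂} [Category.{v₂} A] {P : ObjectProperty A} {B : Type u₃} [Category.{v₃} B]
  {F : P.FullSubcategory ⥤ B}

/-- The value at `x : X ⟶ M` of the cocone over the `F X` given by a left extension `G` of `F`. -/
def kanLeg {G : A ⥤ B} (η : F ⟶ P.ι ⋙ G) {M : A} (X : P.FullSubcategory) (x : X.obj ⟶ M) :
    F.obj X ⟶ G.obj M :=
  η.app X ≫ G.map x

theorem kanLeg_comp_map {G : A ⥤ B} (η : F ⟶ P.ι ⋙ G) {M N : A} (X : P.FullSubcategory)
    (x : X.obj ⟶ M) (f : M ⟶ N) : kanLeg η X x ≫ G.map f = kanLeg η X (x ≫ f) := by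
  simp [kanLeg]

theorem map_comp_kanLeg {G : A ⥤ B} (η : F ⟶ P.ι ⋙ G) {M : A} {X Y : P.FullSubcategory}
    (f : X ⟶ Y) (y : Y.obj ⟶ M) : F.map f ≫ kanLeg η Y y = kanLeg η X (f.hom ≫ y) := by
  simp [kanLeg]

end KanLeg

section Presentation

variable {A : Type u₂} [Category.{v₂} A] [Abelian A] {P : ObjectProperty A}

/-- A presentation `Q₁ ⟶ Q₀ ⟶ M ⟶ 0` of `M` by projective objects belonging to `P`. -/
structure ProjPresentation (P : ObjectProperty A) (M : A) where
  Q₀ : P.FullSubcategory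
  Q₁ : P.FullSubcategory
  proj₀ : Projective Q₀.obj
  proj₁ : Projective Q₁.obj
  q : Q₀.obj ⟶ M
  d : Q₁ ⟶ Q₀
  epi : Epi q
  r : Q₁.obj ⟶ kernel q
  epi_r : Epi r
  fac : d.hom = r ≫ kernel.ι q

theorem ProjPresentation.w {M : A} (p : ProjPresentation P M) : p.d.hom ≫ p.q = 0 := by
  rw [p.fac, Category.assoc, kernel.condition, comp_zero]

theorem ProjPresentation.exists_lift {M : A} (p : ProjPresentation P M) (X : P.FullSubcategory)
    [Projective X.obj] (x : X.obj ⟶ M) : ∃ l : X ⟶ p.Q₀, l.hom ≫ p.q = x := by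
  have := p.epi
  exact ⟨ObjectProperty.homMk (Projective.factorThru x p.q), Projective.factorThru_comp _ _⟩

theorem ProjPresentation.exists_lift_kernel {M : A} (p : ProjPresentation P M)
    (X : P.FullSubcategory) [Projective X.obj] (x : X ⟶ p.Q₀) (hx : x.hom ≫ p.q = 0) :
    ∃ l : X ⟶ p.Q₁, l ≫ p.d = x := by
  have := p.epi_r
  refine ⟨ObjectProperty.homMk (Projective.factorThru (kernel.lift _ _ hx) p.r),
    ObjectProperty.hom_ext _ ?_⟩
  change Projective.factorThru (kernel.lift _ _ hx) p.r ≫ p.d.hom = x.hom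
  rw [p.fac, Projective.factorThru_comp_assoc, kernel.lift_ι]

theorem HasProjectiveResolutions.nonempty_presentation (hP : HasProjectiveResolutions P) (M : A) :
    Nonempty (ProjPresentation P M) := by
  obtain ⟨Q₀, q, h₀, p₀, e₀⟩ := hP.cover M
  obtain ⟨Q₁, r, h₁, p₁, e₁⟩ := hP.cover (kernel q)
  exact ⟨{
    Q₀ := ⟨Q₀, h₀⟩
    Q₁ := ⟨Q₁, h₁⟩
    proj₀ := p₀
    proj₁ := p₁
    q := q
    d := ObjectProperty.homMk (r ≫ kernel.ι q)
    epi := e₀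
    r := r
    epi_r := e₁
    fac := rfl }⟩

theorem HasProjectiveResolutions.exists_conf (hP : HasProjectiveResolutions P)
    (hE : (abelianExact A).IsFullyExact P) (X : P.FullSubcategory) :
    ∃ (K Q : P.FullSubcategory) (i : K ⟶ Q) (f : Q ⟶ X) (hw : i ≫ f = 0), Projective Q.obj ∧
      ((abelianExact A).induced P hE).conf (ShortComplex.mk i f hw) := by
  obtain ⟨Q, f, hQ, hQ', hf, hK⟩ := hP.syzygy X.obj X.property
  exact ⟨⟨_, hK⟩, ⟨Q, hQ⟩, ObjectProperty.homMk (kernel.ι f), ObjectProperty.homMk f,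
    ObjectProperty.hom_ext _ (kernel.condition f), hQ', shortExact_kernel f⟩

variable {hE : (abelianExact A).IsFullyExact P}
  {B : Type u₃} [Category.{v₃} B] [Abelian B] {F : P.FullSubcategory ⥤ B}

/-- A morphism on `F Q₀` that vanishes on `F Q₁` extends to every morphism `X ⟶ M`
with `X` in `P`. -/
theorem ProjPresentation.exists_extension (hP : HasProjectiveResolutions P)
    (hF : IsRightExact ((abelianExact A).induced P hE) (abelianExact B) F) {M : A}
    (p : ProjPresentation P M) {U : B} (t : F.obj p.Q₀ ⟶ U) (ht : F.map p.d ≫ t = 0)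
    (X : P.FullSubcategory) (x : X.obj ⟶ M) :
    ∃ u : F.obj X ⟶ U, ∀ (Q : P.FullSubcategory) (_ : Projective Q.obj) (g : Q ⟶ X)
      (l : Q ⟶ p.Q₀), l.hom ≫ p.q = g.hom ≫ x → F.map g ≫ u = F.map l ≫ t := by
  have := hF.1
  obtain ⟨K, Q, i, π, hw, hQ, hc⟩ := hP.exists_conf hE X
  obtain ⟨K', Q', i', π', hw', hQ', hc'⟩ := hP.exists_conf hE K
  have hw₀ : i.hom ≫ π.hom = 0 := congrArg (fun m => m.hom) hw
  obtain ⟨l₀, hl₀⟩ := p.exists_lift Q (π.hom ≫ x)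
  have hkill : F.map i ≫ F.map l₀ ≫ t = 0 := by
    have : Epi (F.map π') := hF.epi_map hc'
    rw [← cancel_epi (F.map π'), comp_zero]
    obtain ⟨m, hm⟩ := p.exists_lift_kernel Q' (π' ≫ i ≫ l₀) (by
      change (π'.hom ≫ i.hom ≫ l₀.hom) ≫ p.q = 0
      rw [Category.assoc, Category.assoc, hl₀, reassoc_of% hw₀, zero_comp, comp_zero])
    rw [← Category.assoc, ← Category.assoc, ← F.map_comp, ← F.map_comp, Category.assoc, ← hm,
      F.map_comp, Category.assoc, ht, comp_zero]
  obtain ⟨u, hu⟩ := hF.exists_desc hc (F.map l₀ ≫ t) hkill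
  have hu' : F.map π ≫ u = F.map l₀ ≫ t := hu
  refine ⟨u, fun R hR g l hl => ?_⟩
  have : Epi π.hom := ShortComplex.ShortExact.epi_g hc
  let g' : R ⟶ Q := ObjectProperty.homMk (Projective.factorThru g.hom π.hom)
  have hg' : g' ≫ π = g := ObjectProperty.hom_ext _ (Projective.factorThru_comp _ _)
  have hg₀ : g'.hom ≫ π.hom = g.hom := congrArg (fun m => m.hom) hg'
  obtain ⟨m, hm⟩ := p.exists_lift_kernel R (g' ≫ l₀ - l) (by
    change (g'.hom ≫ l₀.hom - l.hom) ≫ p.q = 0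
    rw [Preadditive.sub_comp, Category.assoc, hl₀, hl, reassoc_of% hg₀, sub_self])
  have h0 : (F.map g' ≫ F.map l₀ - F.map l) ≫ t = 0 := by
    rw [← F.map_comp, ← F.map_sub, ← hm, F.map_comp, Category.assoc, ht, comp_zero]
  rw [← hg', F.map_comp, Category.assoc, hu', ← sub_eq_zero, ← h0, Preadditive.sub_comp,
    Category.assoc]

/-- A cocone over the `F X`, for `X ⟶ M` with `X` in `P`, is determined by the value at `Q₀`. -/
theorem ProjPresentation.hom_ext (hP : HasProjectiveResolutions P)
    (hF : IsRightExact ((abelianExact A).induced P hE) (abelianExact B) F) {M : A}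
    (p : ProjPresentation P M) {U : B}
    (τ τ' : ∀ Y : CostructuredArrow P.ι M, F.obj Y.left ⟶ U)
    (hτ : ∀ {Y Y' : CostructuredArrow P.ι M} (f : Y ⟶ Y'), F.map f.left ≫ τ Y' = τ Y)
    (hτ' : ∀ {Y Y' : CostructuredArrow P.ι M} (f : Y ⟶ Y'), F.map f.left ≫ τ' Y' = τ' Y)
    (h : τ (CostructuredArrow.mk (S := P.ι) (Y := p.Q₀) p.q) =
      τ' (CostructuredArrow.mk (S := P.ι) (Y := p.Q₀) p.q))
    (Y : CostructuredArrow P.ι M) : τ Y = τ' Y := by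
  obtain ⟨K, Q, i, π, hw, hQ, hc⟩ := hP.exists_conf hE Y.left
  obtain ⟨l, hl⟩ := p.exists_lift Q (π.hom ≫ Y.hom)
  let Z : CostructuredArrow P.ι M := CostructuredArrow.mk (S := P.ι) (Y := Q) (π.hom ≫ Y.hom)
  let a : Z ⟶ Y := CostructuredArrow.homMk π
  let b : Z ⟶ CostructuredArrow.mk (S := P.ι) (Y := p.Q₀) p.q := CostructuredArrow.homMk l hl
  have : Epi (F.map a.left) := hF.epi_map hc
  rw [← cancel_epi (F.map a.left), hτ, hτ', ← hτ b, ← hτ' b, h]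

/-- If `F` is right exact, a cocone over the `F X`, for `X ⟶ M` with `X` in `P`, is a colimit
as soon as its vertex is the cokernel of `F Q₁ ⟶ F Q₀` for a presentation of `M`. -/
theorem ProjPresentation.nonempty_isColimit (hP : HasProjectiveResolutions P)
    (hF : IsRightExact ((abelianExact A).induced P hE) (abelianExact B) F) {M : A}
    (p : ProjPresentation P M) (c : Cocone (CostructuredArrow.proj P.ι M ⋙ F))
    (hepi : Epi (c.ι.app (CostructuredArrow.mk (S := P.ι) (Y := p.Q₀) p.q)))
    (hdesc : ∀ (U : B) (t : F.obj p.Q₀ ⟶ U), F.map p.d ≫ t = 0 → ∃ u : c.pt ⟶ U,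
      c.ι.app (CostructuredArrow.mk (S := P.ι) (Y := p.Q₀) p.q) ≫ u = t) :
    Nonempty (IsColimit c) := by
  have := hF.1
  have hkill : ∀ s : Cocone (CostructuredArrow.proj P.ι M ⋙ F),
      F.map p.d ≫ s.ι.app (CostructuredArrow.mk (S := P.ι) (Y := p.Q₀) p.q) = 0 := by
    intro s
    let Z : CostructuredArrow P.ι M := CostructuredArrow.mk (S := P.ι) (Y := p.Q₁) 0
    let a : Z ⟶ CostructuredArrow.mk (S := P.ι) (Y := p.Q₀) p.q := CostructuredArrow.homMk p.d p.w
    let b : Z ⟶ CostructuredArrow.mk (S := P.ι) (Y := p.Q₀) p.q :=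
      CostructuredArrow.homMk 0 zero_comp
    have h1 := (s.w a).trans (s.w b).symm
    have h2 : (CostructuredArrow.proj P.ι M ⋙ F).map b = 0 := F.map_zero _ _
    rw [h2, zero_comp] at h1
    exact h1
  choose u hu using fun s : Cocone (CostructuredArrow.proj P.ι M ⋙ F) =>
    hdesc s.pt _ (hkill s)
  refine ⟨{ desc := u, fac := fun s j => ?_, uniq := fun s m hm => ?_ }⟩
  · refine p.hom_ext hP hF (fun Y => c.ι.app Y ≫ u s) (fun Y => s.ι.app Y) (fun {Y Y'} f => ?_)
      (fun {Y Y'} f => s.w f) (hu s) j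
    exact (Category.assoc _ _ _).symm.trans (congrArg (· ≫ u s) (c.w f))
  · rw [← cancel_epi (c.ι.app (CostructuredArrow.mk (S := P.ι) (Y := p.Q₀) p.q)), hm, hu]

/-- A morphism on `F Q₀` that vanishes on `F Q₁` extends to a cocone over the `F X`, for `X ⟶ M`
with `X` in `P`. -/
theorem ProjPresentation.exists_cocone (hP : HasProjectiveResolutions P)
    (hF : IsRightExact ((abelianExact A).induced P hE) (abelianExact B) F) {M : A}
    (p : ProjPresentation P M) {U : B} (t : F.obj p.Q₀ ⟶ U) (ht : F.map p.d ≫ t = 0) :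
    ∃ s : CostructuredArrow.proj P.ι M ⋙ F ⟶ (Functor.const _).obj U,
      s.app (CostructuredArrow.mk (S := P.ι) (Y := p.Q₀) p.q) = t := by
  choose τ hτ using fun Y : CostructuredArrow P.ι M => p.exists_extension hP hF t ht Y.left Y.hom
  refine ⟨{ app := τ, naturality := fun Y Y' f => ?_ }, ?_⟩
  · obtain ⟨K, Q, i, π, hw, hQ, hc⟩ := hP.exists_conf hE Y.left
    obtain ⟨l, hl⟩ := p.exists_lift Q (π.hom ≫ Y.hom)
    have : Epi (F.map π) := hF.epi_map hc
    have hf : f.left.hom ≫ Y'.hom = Y.hom := CostructuredArrow.w f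
    have h1 : F.map π ≫ F.map f.left ≫ τ Y' = F.map π ≫ τ Y := by
      rw [hτ Y Q hQ π l hl, ← Category.assoc, ← F.map_comp]
      refine hτ Y' Q hQ _ l ?_
      change _ = (π.hom ≫ f.left.hom) ≫ _
      rw [hl, Category.assoc, hf]
    have h2 : F.map f.left ≫ τ Y' = τ Y := (cancel_epi (F.map π)).1 h1
    exact h2.trans (Category.comp_id _).symm
  · have h1 := hτ (CostructuredArrow.mk (S := P.ι) (Y := p.Q₀) p.q) p.Q₀ p.proj₀ (𝟙 _) (𝟙 _) rfl
    rwa [F.map_id, Category.id_comp, Category.id_comp] at h1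

/-- The value at `M` of the Kan extension is the cokernel of `F Q₁ ⟶ F Q₀` for a presentation
`Q₁ ⟶ Q₀ ⟶ M ⟶ 0`. -/
theorem hasPointwiseLeftKanExtension (hP : HasProjectiveResolutions P)
    (hF : IsRightExact ((abelianExact A).induced P hE) (abelianExact B) F) :
    P.ι.HasPointwiseLeftKanExtension F := by
  intro M
  obtain ⟨p⟩ := hP.nonempty_presentation M
  obtain ⟨s, hs⟩ := p.exists_cocone hP hF (cokernel.π (F.map p.d)) (cokernel.condition _)
  obtain ⟨hc⟩ := p.nonempty_isColimit hP hF ⟨_, s⟩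
    (hs.symm ▸ (inferInstance : Epi (cokernel.π (F.map p.d))))
    (fun U t ht => ⟨cokernel.desc _ t ht, hs.symm ▸ cokernel.π_desc (F.map p.d) t ht⟩)
  exact ⟨_, hc⟩

theorem IsRightExact.epi_map_of_epi {G : A ⥤ B}
    (hG : IsRightExact (abelianExact A) (abelianExact B) G) {X Y : A} (f : X ⟶ Y) [Epi f] :
    Epi (G.map f) :=
  hG.epi_map (T := ShortComplex.mk (kernel.ι f) f (kernel.condition f)) (shortExact_kernel f)

/-- A right exact functor on `A` is the pointwise left Kan extension of its restriction to `P`. -/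
theorem nonempty_isPointwiseLeftKanExtension (hP : HasProjectiveResolutions P)
    (hι : IsRightExact ((abelianExact A).induced P hE) (abelianExact A) P.ι) {G : A ⥤ B}
    (hG : IsRightExact (abelianExact A) (abelianExact B) G) :
    Nonempty (Functor.LeftExtension.mk G (𝟙 (P.ι ⋙ G))).IsPointwiseLeftKanExtension := by
  refine ⟨fun M => Nonempty.some ?_⟩
  obtain ⟨p⟩ := hP.nonempty_presentation M
  have hepi := p.epi
  have hepi' := p.epi_r
  have hleg : ((Functor.LeftExtension.mk G (𝟙 (P.ι ⋙ G))).coconeAt M).ι.app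
      (CostructuredArrow.mk (S := P.ι) (Y := p.Q₀) p.q) = G.map p.q := Category.id_comp _
  refine p.nonempty_isColimit hP (hι.comp hG) _ ?_ (fun U t ht => ?_)
  · rw [hleg]
    exact hG.epi_map_of_epi p.q
  · rw [hleg]
    refine hG.exists_desc (T := ShortComplex.mk (kernel.ι p.q) p.q (kernel.condition _))
      (shortExact_kernel p.q) t ?_
    have : Epi (G.map p.r) := hG.epi_map_of_epi p.r
    rw [← cancel_epi (G.map p.r), comp_zero, ← Category.assoc]
    dsimp
    rw [← G.map_comp, ← p.fac]
    exact ht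

/-- The pointwise left Kan extension of a right exact functor on `P` is right exact. -/
theorem isRightExact_of_isPointwiseLeftKanExtension (hP : HasProjectiveResolutions P)
    (hF : IsRightExact ((abelianExact A).induced P hE) (abelianExact B) F) {G : A ⥤ B}
    {η : F ⟶ P.ι ⋙ G} (hG : (Functor.LeftExtension.mk G η).IsPointwiseLeftKanExtension) :
    IsRightExact (abelianExact A) (abelianExact B) G := by
  have := hF.1
  have hhom : ∀ {M : A} (p : ProjPresentation P M) {U : B} (a b : G.obj M ⟶ U),
      kanLeg η p.Q₀ p.q ≫ a = kanLeg η p.Q₀ p.q ≫ b → a = b := by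
    intro M p U a b hab
    refine (hG M).hom_ext fun Y => ?_
    have hw := fun {Y Y'} (f : Y ⟶ Y') => ((Functor.LeftExtension.mk G η).coconeAt M).w f
    exact p.hom_ext hP hF
      (fun Y => ((Functor.LeftExtension.mk G η).coconeAt M).ι.app Y ≫ a)
      (fun Y => ((Functor.LeftExtension.mk G η).coconeAt M).ι.app Y ≫ b)
      (fun {Y Y'} f => (Category.assoc _ _ _).symm.trans (congrArg (· ≫ a) (hw f)))
      (fun {Y Y'} f => (Category.assoc _ _ _).symm.trans (congrArg (· ≫ b) (hw f))) hab Y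
  have hadd : ∀ {M : A} (X : P.FullSubcategory) [Projective X.obj] (x y : X.obj ⟶ M),
      kanLeg η X (x + y) = kanLeg η X x + kanLeg η X y := by
    intro M X _ x y
    obtain ⟨p⟩ := hP.nonempty_presentation M
    obtain ⟨l, rfl⟩ := p.exists_lift X x
    obtain ⟨m, rfl⟩ := p.exists_lift X y
    rw [← map_comp_kanLeg, ← map_comp_kanLeg, ← Preadditive.add_comp (F.obj X), ← F.map_add,
      map_comp_kanLeg, ← Preadditive.add_comp]
    rfl
  have hdesc : ∀ {M : A} (p : ProjPresentation P M) {U : B} (t : F.obj p.Q₀ ⟶ U),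
      F.map p.d ≫ t = 0 → ∃ u : G.obj M ⟶ U, kanLeg η p.Q₀ p.q ≫ u = t := by
    intro M p U t ht
    obtain ⟨s, hs⟩ := p.exists_cocone hP hF t ht
    exact ⟨(hG M).desc ⟨U, s⟩, ((hG M).fac ⟨U, s⟩ _).trans hs⟩
  have hGadd : G.Additive := ⟨fun {M N f g} => by
    obtain ⟨p⟩ := hP.nonempty_presentation M
    have := p.proj₀
    refine hhom p _ _ ?_
    rw [kanLeg_comp_map, Preadditive.comp_add, Preadditive.comp_add, kanLeg_comp_map,
      kanLeg_comp_map, hadd]⟩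
  refine isRightExact_of_exists_desc fun T hT => ?_
  have hTepi : Epi T.g := hT.epi_g
  obtain ⟨pY⟩ := hP.nonempty_presentation T.X₂
  obtain ⟨pZ⟩ := hP.nonempty_presentation T.X₃
  have := pY.proj₀
  have := pZ.proj₀
  have hl : Projective.factorThru pZ.q T.g ≫ T.g = pZ.q := Projective.factorThru_comp _ _
  refine ⟨⟨fun a b hab => hhom pZ a b ?_⟩, fun U t ht => ?_⟩
  · rw [← hl, ← kanLeg_comp_map, Category.assoc, Category.assoc, hab]
  · -- a morphism to `T.X₃` has several lifts to `T.X₂`, but `t` takes the same value on them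
    have hvan : ∀ (X : P.FullSubcategory) [Projective X.obj] (x y : X.obj ⟶ T.X₂),
        x ≫ T.g = y ≫ T.g → kanLeg η X x ≫ t = kanLeg η X y ≫ t := by
      intro X _ x y hxy
      obtain ⟨m, hm⟩ := KernelFork.IsLimit.lift' hT.fIsKernel (x - y)
        (by rw [Preadditive.sub_comp, hxy, sub_self])
      have hm' : m ≫ T.f = x - y := hm
      have h2 := hadd X (m ≫ T.f) y
      rw [hm', sub_add_cancel, ← hm'] at h2
      rw [h2, Preadditive.add_comp, ← kanLeg_comp_map, Category.assoc, ht, comp_zero, zero_add]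
    obtain ⟨u, hu⟩ := hdesc pZ (kanLeg η pZ.Q₀ (Projective.factorThru pZ.q T.g) ≫ t) (by
      have := pZ.proj₁
      have h0 := hadd pZ.Q₁ (0 : pZ.Q₁.obj ⟶ T.X₂) 0
      rw [add_zero, left_eq_add] at h0
      rw [← Category.assoc, map_comp_kanLeg, hvan pZ.Q₁ _ 0, h0, zero_comp]
      rw [Category.assoc, hl, pZ.w, zero_comp])
    refine ⟨u, hhom pY _ _ ?_⟩
    obtain ⟨n, hn⟩ := pZ.exists_lift pY.Q₀ (pY.q ≫ T.g)
    rw [← Category.assoc, kanLeg_comp_map, ← hn, ← map_comp_kanLeg, Category.assoc, hu,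
      ← Category.assoc, map_comp_kanLeg]
    refine hvan _ _ _ ?_
    rw [Category.assoc, hl, hn]

/-- The inclusion of a fully exact subcategory with projective resolutions is a right abelian
envelope: right exact functors extend from `P` to `A` by left Kan extension. -/
theorem HasProjectiveResolutions.isRightAbelianEnvelope (hP : HasProjectiveResolutions P)
    (hE : (abelianExact A).IsFullyExact P) :
    IsRightAbelianEnvelope.{u₂, v₂, u₂, v₂, u₃, v₃} ((abelianExact A).induced P hE) P.ι := by
  have hι : IsRightExact ((abelianExact A).induced P hE) (abelianExact A) P.ι := by
    refine isRightExact_of_exists_desc fun T hT => ⟨ShortComplex.ShortExact.epi_g hT, ?_⟩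
    intro U t ht
    obtain ⟨u, hu⟩ := CokernelCofork.IsColimit.desc' (ShortComplex.ShortExact.gIsCokernel hT) t ht
    exact ⟨u, hu⟩
  refine ⟨hι, fun B _ _ => ?_⟩
  have hLan : ∀ G : Rex (abelianExact A) (abelianExact B),
      G.obj.IsLeftKanExtension (𝟙 (P.ι ⋙ G.obj)) := fun G =>
    (nonempty_isPointwiseLeftKanExtension hP hι G.property).some.isLeftKanExtension
  have hfaith : (rexRestriction P.ι hι B).Faithful := ⟨fun {G H a b} hab => by
    refine ObjectProperty.hom_ext _
      ((G.obj.homEquivOfIsLeftKanExtension (𝟙 (P.ι ⋙ G.obj)) H.obj).injective ?_)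
    exact congrArg (𝟙 (P.ι ⋙ G.obj) ≫ ·) (congrArg (fun m => m.hom) hab)⟩
  have hfull : (rexRestriction P.ι hι B).Full := ⟨fun {G H} a => by
    obtain ⟨b, hb⟩ :=
      (G.obj.homEquivOfIsLeftKanExtension (𝟙 (P.ι ⋙ G.obj)) H.obj).surjective a.hom
    exact ⟨ObjectProperty.homMk b, ObjectProperty.hom_ext _
      ((Category.id_comp (Functor.whiskerLeft P.ι b)).symm.trans hb)⟩⟩
  have hess : (rexRestriction P.ι hι B).EssSurj := ⟨fun F => by
    have := hasPointwiseLeftKanExtension hP F.property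
    have hG := P.ι.pointwiseLeftKanExtensionIsPointwiseLeftKanExtension F.obj
    have : IsIso (P.ι.pointwiseLeftKanExtensionUnit F.obj) := hG.isIso_hom
    exact ⟨⟨_, isRightExact_of_isPointwiseLeftKanExtension hP F.property hG⟩,
      ⟨ObjectProperty.isoMk _ (asIso (P.ι.pointwiseLeftKanExtensionUnit F.obj)).symm⟩⟩⟩
  exact { }

end Presentation

/-! ### Left exact functors on coresolving subcategories -/

section LeftExact

variable {E : Type u₁} [Category.{v₁} E] [Preadditive E] {S : ExactStructure E}
  {B : Type u₃} [Category.{v₃} B] [Abelian B] {F : E ⥤ B}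

theorem IsLeftExact.mono_map (hF : IsLeftExact S (abelianExact B) F) {T : ShortComplex E}
    (hT : S.conf T) : Mono (F.map T.f) := by
  obtain ⟨K, d', i', hw, hc, -, -⟩ := hF.2 T hT
  exact ShortComplex.ShortExact.mono_f hc

theorem IsLeftExact.exists_lift (hF : IsLeftExact S (abelianExact B) F) {T : ShortComplex E}
    (hT : S.conf T) {U : B} (t : U ⟶ F.obj T.X₂) (ht : t ≫ F.map T.g = 0) :
    ∃ u : U ⟶ F.obj T.X₁, u ≫ F.map T.f = t := by
  obtain ⟨K, d', i', hw, hc, ⟨M, j, hj, hd⟩, hf⟩ := hF.2 T hT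
  have : Mono i' := ShortComplex.ShortExact.mono_f hd
  have hi : t ≫ d' = 0 := by
    rw [← cancel_mono i', Category.assoc, ← hf, ht, zero_comp]
  obtain ⟨u, hu⟩ := KernelFork.IsLimit.lift' (ShortComplex.ShortExact.fIsKernel hc) t hi
  exact ⟨u, hu⟩

theorem isLeftExact_of_exists_lift [F.Additive]
    (h : ∀ T : ShortComplex E, S.conf T → Mono (F.map T.f) ∧ ∀ (U : B) (t : U ⟶ F.obj T.X₂),
      t ≫ F.map T.g = 0 → ∃ u : U ⟶ F.obj T.X₁, u ≫ F.map T.f = t) :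
    IsLeftExact S (abelianExact B) F := by
  refine ⟨inferInstance, fun T hT => ?_⟩
  obtain ⟨hmono, hlift⟩ := h T hT
  have hw : F.map T.f ≫ F.map T.g = 0 := by rw [← F.map_comp, T.zero, F.map_zero]
  have hex : (ShortComplex.mk _ _ hw).Exact :=
    ShortComplex.exact_of_f_is_kernel _ (KernelFork.IsLimit.ofι' _ _
      fun {U} t ht => ⟨(hlift U t ht).choose, (hlift U t ht).choose_spec⟩)
  rw [ShortComplex.exact_iff_mono_cokernel_desc] at hex
  exact ⟨cokernel (F.map T.f), cokernel.π _, cokernel.desc _ _ hw, cokernel.condition _,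
    shortExact_cokernel _, ⟨_, _, _, shortExact_cokernel (cokernel.desc _ _ hw)⟩,
    (cokernel.π_desc _ _ _).symm⟩

end LeftExact

/-- The subcategory `P` contains enough injectives of the ambient abelian category, and the
cosyzygies of its own objects. -/
structure HasInjectiveResolutions {A : Type u₂} [Category.{v₂} A] [Abelian A]
    (P : ObjectProperty A) : Prop where
  embed : ∀ M : A, ∃ (I : A) (f : M ⟶ I), P I ∧ Injective I ∧ Mono f
  cosyzygy : ∀ X : A, P X → ∃ (I : A) (f : X ⟶ I), P I ∧ Injective I ∧ Mono f ∧ P (cokernel f)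

section CokanLeg

variable {A : Type u₂} [Category.{v₂} A] {P : ObjectProperty A} {B : Type u₃} [Category.{v₃} B]
  {F : P.FullSubcategory ⥤ B}

/-- The value at `x : M ⟶ X` of the cone over the `F X` given by a right extension `G` of `F`. -/
def cokanLeg {G : A ⥤ B} (η : P.ι ⋙ G ⟶ F) {M : A} (X : P.FullSubcategory) (x : M ⟶ X.obj) :
    G.obj M ⟶ F.obj X :=
  G.map x ≫ η.app X

theorem map_comp_cokanLeg {G : A ⥤ B} (η : P.ι ⋙ G ⟶ F) {M N : A} (X : P.FullSubcategory)
    (x : M ⟶ X.obj) (f : N ⟶ M) : G.map f ≫ cokanLeg η X x = cokanLeg η X (f ≫ x) := by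
  simp [cokanLeg]

theorem cokanLeg_comp_map {G : A ⥤ B} (η : P.ι ⋙ G ⟶ F) {M : A} {X Y : P.FullSubcategory}
    (f : Y ⟶ X) (y : M ⟶ Y.obj) : cokanLeg η Y y ≫ F.map f = cokanLeg η X (y ≫ f.hom) := by
  have h := η.naturality f
  rw [cokanLeg, cokanLeg, Category.assoc, ← h, G.map_comp, Category.assoc]
  rfl

end CokanLeg

section Copresentation

variable {A : Type u₂} [Category.{v₂} A] [Abelian A] {P : ObjectProperty A}

/-- A copresentation `0 ⟶ M ⟶ I₀ ⟶ I₁` of `M` by injective objects belonging to `P`. -/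
structure InjCopresentation (P : ObjectProperty A) (M : A) where
  I₀ : P.FullSubcategory
  I₁ : P.FullSubcategory
  inj₀ : Injective I₀.obj
  inj₁ : Injective I₁.obj
  j : M ⟶ I₀.obj
  d : I₀ ⟶ I₁
  mono : Mono j
  r : cokernel j ⟶ I₁.obj
  mono_r : Mono r
  fac : d.hom = cokernel.π j ≫ r

theorem InjCopresentation.w {M : A} (p : InjCopresentation P M) : p.j ≫ p.d.hom = 0 := by
  rw [p.fac, ← Category.assoc, cokernel.condition, zero_comp]

theorem InjCopresentation.exists_desc {M : A} (p : InjCopresentation P M) (X : P.FullSubcategory)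
    [Injective X.obj] (x : M ⟶ X.obj) : ∃ l : p.I₀ ⟶ X, p.j ≫ l.hom = x := by
  have := p.mono
  exact ⟨ObjectProperty.homMk (Injective.factorThru x p.j), Injective.comp_factorThru _ _⟩

theorem InjCopresentation.exists_desc_cokernel {M : A} (p : InjCopresentation P M)
    (X : P.FullSubcategory) [Injective X.obj] (x : p.I₀ ⟶ X) (hx : p.j ≫ x.hom = 0) :
    ∃ l : p.I₁ ⟶ X, p.d ≫ l = x := by
  have := p.mono_r
  refine ⟨ObjectProperty.homMk (Injective.factorThru (cokernel.desc _ _ hx) p.r),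
    ObjectProperty.hom_ext _ ?_⟩
  change p.d.hom ≫ Injective.factorThru (cokernel.desc _ _ hx) p.r = x.hom
  rw [p.fac, Category.assoc, Injective.comp_factorThru, cokernel.π_desc]

theorem HasInjectiveResolutions.nonempty_copresentation (hP : HasInjectiveResolutions P) (M : A) :
    Nonempty (InjCopresentation P M) := by
  obtain ⟨I₀, j, h₀, i₀, m₀⟩ := hP.embed M
  obtain ⟨I₁, r, h₁, i₁, m₁⟩ := hP.embed (cokernel j)
  exact ⟨{
    I₀ := ⟨I₀, h₀⟩
    I₁ := ⟨I₁, h₁⟩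
    inj₀ := i₀
    inj₁ := i₁
    j := j
    d := ObjectProperty.homMk (cokernel.π j ≫ r)
    mono := m₀
    r := r
    mono_r := m₁
    fac := rfl }⟩

theorem HasInjectiveResolutions.exists_conf (hP : HasInjectiveResolutions P)
    (hE : (abelianExact A).IsFullyExact P) (X : P.FullSubcategory) :
    ∃ (I K : P.FullSubcategory) (f : X ⟶ I) (q : I ⟶ K) (hw : f ≫ q = 0), Injective I.obj ∧
      ((abelianExact A).induced P hE).conf (ShortComplex.mk f q hw) := by
  obtain ⟨I, f, hI, hI', hf, hK⟩ := hP.cosyzygy X.obj X.property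
  exact ⟨⟨I, hI⟩, ⟨_, hK⟩, ObjectProperty.homMk f, ObjectProperty.homMk (cokernel.π f),
    ObjectProperty.hom_ext _ (cokernel.condition f), hI', shortExact_cokernel f⟩

variable {hE : (abelianExact A).IsFullyExact P}
  {B : Type u₃} [Category.{v₃} B] [Abelian B] {F : P.FullSubcategory ⥤ B}

/-- A morphism to `F I₀` whose composite to `F I₁` vanishes induces morphisms to `F X` for every
morphism `M ⟶ X` with `X` in `P`. -/
theorem InjCopresentation.exists_extension (hP : HasInjectiveResolutions P)
    (hF : IsLeftExact ((abelianExact A).induced P hE) (abelianExact B) F) {M : A}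
    (p : InjCopresentation P M) {U : B} (t : U ⟶ F.obj p.I₀) (ht : t ≫ F.map p.d = 0)
    (X : P.FullSubcategory) (x : M ⟶ X.obj) :
    ∃ u : U ⟶ F.obj X, ∀ (I : P.FullSubcategory) (_ : Injective I.obj) (g : X ⟶ I)
      (l : p.I₀ ⟶ I), p.j ≫ l.hom = x ≫ g.hom → u ≫ F.map g = t ≫ F.map l := by
  have := hF.1
  obtain ⟨I, K, f, q, hw, hI, hc⟩ := hP.exists_conf hE X
  obtain ⟨I', K', f', q', hw', hI', hc'⟩ := hP.exists_conf hE K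
  have hw₀ : f.hom ≫ q.hom = 0 := congrArg (fun m => m.hom) hw
  obtain ⟨l₀, hl₀⟩ := p.exists_desc I (x ≫ f.hom)
  have hkill : (t ≫ F.map l₀) ≫ F.map q = 0 := by
    have : Mono (F.map f') := hF.mono_map hc'
    rw [← cancel_mono (F.map f'), zero_comp]
    obtain ⟨m, hm⟩ := p.exists_desc_cokernel I' (l₀ ≫ q ≫ f') (by
      change p.j ≫ l₀.hom ≫ q.hom ≫ f'.hom = 0
      rw [reassoc_of% hl₀, reassoc_of% hw₀, zero_comp, comp_zero])
    rw [Category.assoc, Category.assoc, ← F.map_comp, ← F.map_comp, ← hm, F.map_comp,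
      ← Category.assoc, ht, zero_comp]
  obtain ⟨u, hu⟩ := hF.exists_lift hc (t ≫ F.map l₀) hkill
  have hu' : u ≫ F.map f = t ≫ F.map l₀ := hu
  refine ⟨u, fun R hR g l hl => ?_⟩
  have : Mono f.hom := ShortComplex.ShortExact.mono_f hc
  let g' : I ⟶ R := ObjectProperty.homMk (Injective.factorThru g.hom f.hom)
  have hg' : f ≫ g' = g := ObjectProperty.hom_ext _ (Injective.comp_factorThru _ _)
  have hg₀ : f.hom ≫ g'.hom = g.hom := congrArg (fun m => m.hom) hg'
  obtain ⟨m, hm⟩ := p.exists_desc_cokernel R (l₀ ≫ g' - l) (by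
    change p.j ≫ (l₀.hom ≫ g'.hom - l.hom) = 0
    rw [Preadditive.comp_sub, reassoc_of% hl₀, hl, hg₀, sub_self])
  have h0 : t ≫ (F.map l₀ ≫ F.map g' - F.map l) = 0 := by
    rw [← F.map_comp, ← F.map_sub, ← hm, F.map_comp, ← Category.assoc, ht, zero_comp]
  rw [← hg', F.map_comp, ← Category.assoc, hu', ← sub_eq_zero, ← h0, Preadditive.comp_sub,
    Category.assoc]

/-- A cone over the `F X`, for `M ⟶ X` with `X` in `P`, is determined by the value at `I₀`. -/
theorem InjCopresentation.hom_ext (hP : HasInjectiveResolutions P)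
    (hF : IsLeftExact ((abelianExact A).induced P hE) (abelianExact B) F) {M : A}
    (p : InjCopresentation P M) {U : B}
    (τ τ' : ∀ Y : StructuredArrow M P.ι, U ⟶ F.obj Y.right)
    (hτ : ∀ {Y Y' : StructuredArrow M P.ι} (f : Y ⟶ Y'), τ Y ≫ F.map f.right = τ Y')
    (hτ' : ∀ {Y Y' : StructuredArrow M P.ι} (f : Y ⟶ Y'), τ' Y ≫ F.map f.right = τ' Y')
    (h : τ (StructuredArrow.mk (T := P.ι) (Y := p.I₀) p.j) =
      τ' (StructuredArrow.mk (T := P.ι) (Y := p.I₀) p.j))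
    (Y : StructuredArrow M P.ι) : τ Y = τ' Y := by
  obtain ⟨I, K, f, q, hw, hI, hc⟩ := hP.exists_conf hE Y.right
  obtain ⟨l, hl⟩ := p.exists_desc I (Y.hom ≫ f.hom)
  let Z : StructuredArrow M P.ι := StructuredArrow.mk (T := P.ι) (Y := I) (Y.hom ≫ f.hom)
  let a : Y ⟶ Z := StructuredArrow.homMk f
  let b : StructuredArrow.mk (T := P.ι) (Y := p.I₀) p.j ⟶ Z := StructuredArrow.homMk l hl
  have : Mono (F.map a.right) := hF.mono_map hc
  rw [← cancel_mono (F.map a.right), hτ, hτ', ← hτ b, ← hτ' b, h]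

/-- If `F` is left exact, a cone over the `F X`, for `M ⟶ X` with `X` in `P`, is a limit
as soon as its vertex is the kernel of `F I₀ ⟶ F I₁` for a copresentation of `M`. -/
theorem InjCopresentation.nonempty_isLimit (hP : HasInjectiveResolutions P)
    (hF : IsLeftExact ((abelianExact A).induced P hE) (abelianExact B) F) {M : A}
    (p : InjCopresentation P M) (c : Cone (StructuredArrow.proj M P.ι ⋙ F))
    (hmono : Mono (c.π.app (StructuredArrow.mk (T := P.ι) (Y := p.I₀) p.j)))
    (hlift : ∀ (U : B) (t : U ⟶ F.obj p.I₀), t ≫ F.map p.d = 0 → ∃ u : U ⟶ c.pt,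
      u ≫ c.π.app (StructuredArrow.mk (T := P.ι) (Y := p.I₀) p.j) = t) :
    Nonempty (IsLimit c) := by
  have := hF.1
  have hkill : ∀ s : Cone (StructuredArrow.proj M P.ι ⋙ F),
      s.π.app (StructuredArrow.mk (T := P.ι) (Y := p.I₀) p.j) ≫ F.map p.d = 0 := by
    intro s
    let Z : StructuredArrow M P.ι := StructuredArrow.mk (T := P.ι) (Y := p.I₁) 0
    let a : StructuredArrow.mk (T := P.ι) (Y := p.I₀) p.j ⟶ Z := StructuredArrow.homMk p.d p.w
    let b : StructuredArrow.mk (T := P.ι) (Y := p.I₀) p.j ⟶ Z :=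
      StructuredArrow.homMk 0 comp_zero
    have h1 := (s.w a).trans (s.w b).symm
    have h2 : (StructuredArrow.proj M P.ι ⋙ F).map b = 0 := F.map_zero _ _
    rw [h2, comp_zero] at h1
    exact h1
  choose u hu using fun s : Cone (StructuredArrow.proj M P.ι ⋙ F) =>
    hlift s.pt _ (hkill s)
  refine ⟨{ lift := u, fac := fun s j => ?_, uniq := fun s m hm => ?_ }⟩
  · exact p.hom_ext hP hF (fun Y => u s ≫ c.π.app Y) (fun Y => s.π.app Y)
      (fun {Y Y'} f => (Category.assoc _ _ _).trans (congrArg (u s ≫ ·) (c.w f)))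
      (fun {Y Y'} f => s.w f) (hu s) j
  · rw [← cancel_mono (c.π.app (StructuredArrow.mk (T := P.ι) (Y := p.I₀) p.j)), hm, hu]

/-- A morphism to `F I₀` whose composite to `F I₁` vanishes extends to a cone over the `F X`, for
`M ⟶ X` with `X` in `P`. -/
theorem InjCopresentation.exists_cone (hP : HasInjectiveResolutions P)
    (hF : IsLeftExact ((abelianExact A).induced P hE) (abelianExact B) F) {M : A}
    (p : InjCopresentation P M) {U : B} (t : U ⟶ F.obj p.I₀) (ht : t ≫ F.map p.d = 0) :
    ∃ s : (Functor.const _).obj U ⟶ StructuredArrow.proj M P.ι ⋙ F,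
      s.app (StructuredArrow.mk (T := P.ι) (Y := p.I₀) p.j) = t := by
  choose τ hτ using fun Y : StructuredArrow M P.ι => p.exists_extension hP hF t ht Y.right Y.hom
  refine ⟨{ app := τ, naturality := fun Y Y' f => ?_ }, ?_⟩
  · obtain ⟨I, K, i, q, hw, hI, hc⟩ := hP.exists_conf hE Y'.right
    obtain ⟨l, hl⟩ := p.exists_desc I (Y'.hom ≫ i.hom)
    have : Mono (F.map i) := hF.mono_map hc
    have hf : Y.hom ≫ f.right.hom = Y'.hom := StructuredArrow.w f
    have h1 : (τ Y ≫ F.map f.right) ≫ F.map i = τ Y' ≫ F.map i := by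
      rw [hτ Y' I hI i l hl, Category.assoc, ← F.map_comp]
      refine hτ Y I hI _ l ?_
      change _ = _ ≫ f.right.hom ≫ i.hom
      rw [hl, ← Category.assoc, hf]
    have h2 : τ Y ≫ F.map f.right = τ Y' := (cancel_mono (F.map i)).1 h1
    exact (Category.id_comp _).trans h2.symm
  · have h1 := hτ (StructuredArrow.mk (T := P.ι) (Y := p.I₀) p.j) p.I₀ p.inj₀ (𝟙 _) (𝟙 _) rfl
    rwa [F.map_id, Category.comp_id, F.map_id, Category.comp_id] at h1

/-- The value at `M` of the Kan extension is the kernel of `F I₀ ⟶ F I₁` for a copresentation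
`0 ⟶ M ⟶ I₀ ⟶ I₁`. -/
theorem hasPointwiseRightKanExtension (hP : HasInjectiveResolutions P)
    (hF : IsLeftExact ((abelianExact A).induced P hE) (abelianExact B) F) :
    P.ι.HasPointwiseRightKanExtension F := by
  intro M
  obtain ⟨p⟩ := hP.nonempty_copresentation M
  obtain ⟨s, hs⟩ := p.exists_cone hP hF (kernel.ι (F.map p.d)) (kernel.condition _)
  obtain ⟨hc⟩ := p.nonempty_isLimit hP hF ⟨_, s⟩
    (hs.symm ▸ (inferInstance : Mono (kernel.ι (F.map p.d))))
    (fun U t ht => ⟨kernel.lift _ t ht, hs.symm ▸ kernel.lift_ι (F.map p.d) t ht⟩)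
  exact ⟨_, hc⟩

theorem IsLeftExact.mono_map_of_mono {G : A ⥤ B}
    (hG : IsLeftExact (abelianExact A) (abelianExact B) G) {X Y : A} (f : X ⟶ Y) [Mono f] :
    Mono (G.map f) :=
  hG.mono_map (T := ShortComplex.mk f (cokernel.π f) (cokernel.condition f)) (shortExact_cokernel f)

/-- A left exact functor on `A` is the pointwise right Kan extension of its restriction to `P`. -/
theorem nonempty_isPointwiseRightKanExtension (hP : HasInjectiveResolutions P)
    (hι : IsLeftExact ((abelianExact A).induced P hE) (abelianExact A) P.ι) {G : A ⥤ B}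
    (hG : IsLeftExact (abelianExact A) (abelianExact B) G) :
    Nonempty (Functor.RightExtension.mk G (𝟙 (P.ι ⋙ G))).IsPointwiseRightKanExtension := by
  refine ⟨fun M => Nonempty.some ?_⟩
  obtain ⟨p⟩ := hP.nonempty_copresentation M
  have hmono := p.mono
  have hmono' := p.mono_r
  have hleg : ((Functor.RightExtension.mk G (𝟙 (P.ι ⋙ G))).coneAt M).π.app
      (StructuredArrow.mk (T := P.ι) (Y := p.I₀) p.j) = G.map p.j := Category.comp_id _
  refine p.nonempty_isLimit hP (hι.comp hG) _ ?_ (fun U t ht => ?_)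
  · rw [hleg]
    exact hG.mono_map_of_mono p.j
  · rw [hleg]
    refine hG.exists_lift (T := ShortComplex.mk p.j (cokernel.π p.j) (cokernel.condition _))
      (shortExact_cokernel p.j) t ?_
    have : Mono (G.map p.r) := hG.mono_map_of_mono p.r
    rw [← cancel_mono (G.map p.r), zero_comp, Category.assoc]
    dsimp
    rw [← G.map_comp, ← p.fac]
    exact ht

/-- The pointwise right Kan extension of a left exact functor on `P` is left exact. -/
theorem isLeftExact_of_isPointwiseRightKanExtension (hP : HasInjectiveResolutions P)
    (hF : IsLeftExact ((abelianExact A).induced P hE) (abelianExact B) F) {G : A ⥤ B}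
    {η : P.ι ⋙ G ⟶ F} (hG : (Functor.RightExtension.mk G η).IsPointwiseRightKanExtension) :
    IsLeftExact (abelianExact A) (abelianExact B) G := by
  have := hF.1
  have hhom : ∀ {M : A} (p : InjCopresentation P M) {U : B} (a b : U ⟶ G.obj M),
      a ≫ cokanLeg η p.I₀ p.j = b ≫ cokanLeg η p.I₀ p.j → a = b := by
    intro M p U a b hab
    refine (hG M).hom_ext fun Y => ?_
    have hw := fun {Y Y'} (f : Y ⟶ Y') => ((Functor.RightExtension.mk G η).coneAt M).w f
    exact p.hom_ext hP hF
      (fun Y => a ≫ ((Functor.RightExtension.mk G η).coneAt M).π.app Y)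
      (fun Y => b ≫ ((Functor.RightExtension.mk G η).coneAt M).π.app Y)
      (fun {Y Y'} f => (Category.assoc _ _ _).trans (congrArg (a ≫ ·) (hw f)))
      (fun {Y Y'} f => (Category.assoc _ _ _).trans (congrArg (b ≫ ·) (hw f))) hab Y
  have hadd : ∀ {M : A} (X : P.FullSubcategory) [Injective X.obj] (x y : M ⟶ X.obj),
      cokanLeg η X (x + y) = cokanLeg η X x + cokanLeg η X y := by
    intro M X _ x y
    obtain ⟨p⟩ := hP.nonempty_copresentation M
    obtain ⟨l, rfl⟩ := p.exists_desc X x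
    obtain ⟨m, rfl⟩ := p.exists_desc X y
    rw [← cokanLeg_comp_map, ← cokanLeg_comp_map, ← Preadditive.comp_add _ (F.obj p.I₀),
      ← F.map_add, cokanLeg_comp_map, ← Preadditive.comp_add]
    rfl
  have hlift : ∀ {M : A} (p : InjCopresentation P M) {U : B} (t : U ⟶ F.obj p.I₀),
      t ≫ F.map p.d = 0 → ∃ u : U ⟶ G.obj M, u ≫ cokanLeg η p.I₀ p.j = t := by
    intro M p U t ht
    obtain ⟨s, hs⟩ := p.exists_cone hP hF t ht
    exact ⟨(hG M).lift ⟨U, s⟩, ((hG M).fac ⟨U, s⟩ _).trans hs⟩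
  have hGadd : G.Additive := ⟨fun {M N f g} => by
    obtain ⟨p⟩ := hP.nonempty_copresentation N
    have := p.inj₀
    refine hhom p _ _ ?_
    rw [map_comp_cokanLeg, Preadditive.add_comp, Preadditive.add_comp, map_comp_cokanLeg,
      map_comp_cokanLeg, hadd]⟩
  refine isLeftExact_of_exists_lift fun T hT => ?_
  have hTmono : Mono T.f := hT.mono_f
  obtain ⟨pY⟩ := hP.nonempty_copresentation T.X₂
  obtain ⟨pX⟩ := hP.nonempty_copresentation T.X₁
  have := pY.inj₀
  have := pX.inj₀
  have hl : T.f ≫ Injective.factorThru pX.j T.f = pX.j := Injective.comp_factorThru _ _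
  refine ⟨⟨fun a b hab => hhom pX a b ?_⟩, fun U t ht => ?_⟩
  · rw [← hl, ← map_comp_cokanLeg, ← Category.assoc, ← Category.assoc, hab]
  · -- a morphism from `T.X₁` has several extensions to `T.X₂`, with the same value at `t`
    have hvan : ∀ (X : P.FullSubcategory) [Injective X.obj] (x y : T.X₂ ⟶ X.obj),
        T.f ≫ x = T.f ≫ y → t ≫ cokanLeg η X x = t ≫ cokanLeg η X y := by
      intro X _ x y hxy
      obtain ⟨m, hm⟩ := CokernelCofork.IsColimit.desc' hT.gIsCokernel (x - y)
        (by rw [Preadditive.comp_sub, hxy, sub_self])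
      have hm' : T.g ≫ m = x - y := hm
      have h2 := hadd X (T.g ≫ m) y
      rw [hm', sub_add_cancel, ← hm'] at h2
      rw [h2, Preadditive.comp_add, ← map_comp_cokanLeg, ← Category.assoc, ht, zero_comp, zero_add]
    obtain ⟨u, hu⟩ := hlift pX (t ≫ cokanLeg η pX.I₀ (Injective.factorThru pX.j T.f)) (by
      have := pX.inj₁
      have h0 := hadd pX.I₁ (0 : T.X₂ ⟶ pX.I₁.obj) 0
      rw [add_zero, left_eq_add] at h0
      rw [Category.assoc, cokanLeg_comp_map, hvan pX.I₁ _ 0, h0, comp_zero]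
      rw [← Category.assoc, hl, pX.w, comp_zero])
    refine ⟨u, hhom pY _ _ ?_⟩
    obtain ⟨n, hn⟩ := pX.exists_desc pY.I₀ (T.f ≫ pY.j)
    rw [Category.assoc, map_comp_cokanLeg, ← hn, ← cokanLeg_comp_map, ← Category.assoc, hu,
      Category.assoc, cokanLeg_comp_map]
    refine hvan _ _ _ ?_
    rw [← Category.assoc, hl, hn]

/-- The inclusion of a fully exact subcategory with injective resolutions is a left abelian
envelope: left exact functors extend from `P` to `A` by right Kan extension. -/
theorem HasInjectiveResolutions.isLeftAbelianEnvelope (hP : HasInjectiveResolutions P)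
    (hE : (abelianExact A).IsFullyExact P) :
    IsLeftAbelianEnvelope.{u₂, v₂, u₂, v₂, u₃, v₃} ((abelianExact A).induced P hE) P.ι := by
  have hι : IsLeftExact ((abelianExact A).induced P hE) (abelianExact A) P.ι := by
    refine isLeftExact_of_exists_lift fun T hT => ⟨ShortComplex.ShortExact.mono_f hT, ?_⟩
    intro U t ht
    obtain ⟨u, hu⟩ := KernelFork.IsLimit.lift' (ShortComplex.ShortExact.fIsKernel hT) t ht
    exact ⟨u, hu⟩
  refine ⟨hι, fun B _ _ => ?_⟩
  have hRan : ∀ G : Lex (abelianExact A) (abelianExact B),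
      G.obj.IsRightKanExtension (𝟙 (P.ι ⋙ G.obj)) := fun G =>
    (nonempty_isPointwiseRightKanExtension hP hι G.property).some.isRightKanExtension
  have hfaith : (lexRestriction P.ι hι B).Faithful := ⟨fun {G H a b} hab => by
    refine ObjectProperty.hom_ext _
      ((H.obj.homEquivOfIsRightKanExtension (𝟙 (P.ι ⋙ H.obj)) G.obj).injective ?_)
    exact congrArg (· ≫ 𝟙 (P.ι ⋙ H.obj)) (congrArg (fun m => m.hom) hab)⟩
  have hfull : (lexRestriction P.ι hι B).Full := ⟨fun {G H} a => by
    obtain ⟨b, hb⟩ :=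
      (H.obj.homEquivOfIsRightKanExtension (𝟙 (P.ι ⋙ H.obj)) G.obj).surjective a.hom
    exact ⟨ObjectProperty.homMk b, ObjectProperty.hom_ext _
      ((Category.comp_id (Functor.whiskerLeft P.ι b)).symm.trans hb)⟩⟩
  have hess : (lexRestriction P.ι hι B).EssSurj := ⟨fun F => by
    have := hasPointwiseRightKanExtension hP F.property
    have hG := P.ι.pointwiseRightKanExtensionIsPointwiseRightKanExtension F.obj
    have hiso : IsIso (P.ι.pointwiseRightKanExtensionCounit F.obj) := hG.isIso_hom
    let e := asIso (P.ι.pointwiseRightKanExtensionCounit F.obj)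
    exact ⟨⟨_, isLeftExact_of_isPointwiseRightKanExtension hP F.property hG⟩,
      ⟨ObjectProperty.isoMk _ e⟩⟩⟩
  exact { }

end Copresentation

/-! ### Lengths relative to a projective generator -/

section Generator

variable {k : Type u} [Field k] {A : Type u₁} [Category.{v₁} A] [Abelian A] [Linear k A]
  {G : A}

theorem finrank_hom_le_of_mono (hfin : ∀ X Y : A, Module.Finite k (X ⟶ Y)) {X Y : A} (f : X ⟶ Y)
    [Mono f] : Module.finrank k (G ⟶ X) ≤ Module.finrank k (G ⟶ Y) :=
  LinearMap.finrank_le_finrank_of_injective (f := Linear.rightComp k G f)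
    fun _ _ h => (cancel_mono f).1 h

theorem finrank_hom_le_of_epi (hfin : ∀ X Y : A, Module.Finite k (X ⟶ Y)) [Projective G] {X Y : A}
    (f : X ⟶ Y) [Epi f] : Module.finrank k (G ⟶ Y) ≤ Module.finrank k (G ⟶ X) :=
  LinearMap.finrank_le_finrank_of_surjective (f := Linear.rightComp k G f)
    fun b => ⟨Projective.factorThru b f, Projective.factorThru_comp b f⟩

theorem isIso_of_mono_of_finrank_le (hfin : ∀ X Y : A, Module.Finite k (X ⟶ Y))
    (hG : IsSeparator G) {X Y : A} (f : X ⟶ Y) [Mono f]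
    (h : Module.finrank k (G ⟶ Y) ≤ Module.finrank k (G ⟶ X)) : IsIso f := by
  have hinj : Function.Injective (Linear.rightComp k G f) := fun a b h => (cancel_mono f).1 h
  have hsurj := (LinearMap.injective_iff_surjective_of_finrank_eq_finrank
    (le_antisymm (finrank_hom_le_of_mono hfin f) h)).1 hinj
  have : Epi f := by
    rw [Preadditive.epi_iff_cancel_zero]
    intro Z g hg
    rw [isSeparator_def] at hG
    refine hG g 0 fun x => ?_
    obtain ⟨y, rfl⟩ := hsurj x
    change (y ≫ f) ≫ g = _
    rw [Category.assoc, hg, comp_zero, comp_zero]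
  exact isIso_of_mono_of_epi f

theorem isIso_of_epi_of_finrank_le (hfin : ∀ X Y : A, Module.Finite k (X ⟶ Y)) [Projective G]
    (hG : IsSeparator G) {X Y : A} (f : X ⟶ Y) [Epi f]
    (h : Module.finrank k (G ⟶ X) ≤ Module.finrank k (G ⟶ Y)) : IsIso f := by
  have hsurj : Function.Surjective (Linear.rightComp k G f) :=
    fun b => ⟨Projective.factorThru b f, Projective.factorThru_comp b f⟩
  have hinj := (LinearMap.injective_iff_surjective_of_finrank_eq_finrank
    (le_antisymm h (finrank_hom_le_of_epi hfin f))).2 hsurj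
  have : Mono f := by
    rw [Preadditive.mono_iff_cancel_zero]
    intro Z g hg
    rw [isSeparator_def] at hG
    refine hG g 0 fun x => ?_
    rw [comp_zero]
    refine hinj ?_
    change (x ≫ g) ≫ f = 0 ≫ f
    rw [Category.assoc, hg, comp_zero, zero_comp]
  exact isIso_of_mono_of_epi f

/-! ### Projective covers and injective hulls of simple objects -/

/-- `m` is an essential morphism: a morphism out of `E` is a monomorphism if its restriction
along `m` is one. -/
def IsEssential {X E : A} (m : X ⟶ E) : Prop := ∀ (Y : A) (f : E ⟶ Y), Mono (m ≫ f) → Mono f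

/-- A nonzero subobject of an essential extension of a simple object `L` contains `L`; hence
morphisms from a projective object to `L` lift. -/
theorem exists_comp_eq_of_essential {L E X Q : A} [Simple L] {m : L ⟶ E} (hm : IsEssential m)
    {f : X ⟶ E} (hf : f ≠ 0) [Projective Q] (a : Q ⟶ L) : ∃ b : Q ⟶ X, b ≫ f = a ≫ m := by
  have h0 : m ≫ cokernel.π f = 0 := by
    by_contra h
    have : Mono (cokernel.π f) := hm _ _ (mono_of_nonzero_from_simple h)
    exact hf ((cancel_mono (cokernel.π f)).1 (by rw [cokernel.condition, zero_comp]))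
  obtain ⟨b, hb⟩ := Projective.factors (a ≫ kernel.lift _ m h0) (Abelian.factorThruImage f)
  refine ⟨b, ?_⟩
  have h1 : (b ≫ Abelian.factorThruImage f) ≫ Abelian.image.ι f = a ≫ m := by
    rw [hb, Category.assoc, kernel.lift_ι]
  rwa [Category.assoc, Abelian.image.fac] at h1

theorem exists_comp_eq_of_isProjectiveCover {L L' P : A} [Simple L] [Simple L'] {p : P ⟶ L}
    (hp : IsProjectiveCover p) {f : P ⟶ L'} (hf : f ≠ 0) :
    ∃ u : L ⟶ L', IsIso u ∧ f = p ≫ u := by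
  have : Epi f := epi_of_nonzero_to_simple hf
  have hpe := hp.epi
  have hp0 : p ≠ 0 := fun h => Simple.not_isZero L ((IsZero.iff_id_eq_zero L).2 (by
    rw [← cancel_epi p, h, zero_comp, zero_comp]))
  have h0 : kernel.ι f ≫ p = 0 := by
    by_contra h
    have : Epi (kernel.ι f) := hp.essential _ _ (epi_of_nonzero_to_simple h)
    exact hf ((cancel_epi (kernel.ι f)).1 (by rw [kernel.condition, comp_zero]))
  obtain ⟨v, hv'⟩ : ∃ v : L' ⟶ L, f ≫ v = p :=
    ⟨_, (CokernelCofork.IsColimit.desc' (shortExact_kernel f).gIsCokernel p h0).2⟩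
  have hv0 : v ≠ 0 := fun h => hp0 (by rw [← hv', h, comp_zero])
  have : IsIso v := isIso_of_hom_simple hv0
  exact ⟨inv v, inferInstance, by rw [← hv', Category.assoc, IsIso.hom_inv_id, Category.comp_id]⟩

theorem exists_comp_eq_of_isInjectiveHull {L L' I : A} [Simple L] [Simple L'] {m : L ⟶ I}
    (hm : IsInjectiveHull m) {f : L' ⟶ I} (hf : f ≠ 0) :
    ∃ u : L' ⟶ L, IsIso u ∧ f = u ≫ m := by
  have : Mono f := mono_of_nonzero_from_simple hf
  have hme := hm.mono
  have hm0 : m ≠ 0 := fun h => Simple.not_isZero L ((IsZero.iff_id_eq_zero L).2 (by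
    rw [← cancel_mono m, h, comp_zero, comp_zero]))
  have h0 : m ≫ cokernel.π f = 0 := by
    by_contra h
    have : Mono (cokernel.π f) := hm.essential _ _ (mono_of_nonzero_from_simple h)
    exact hf ((cancel_mono (cokernel.π f)).1 (by rw [cokernel.condition, zero_comp]))
  obtain ⟨v, hv'⟩ : ∃ v : L ⟶ L', v ≫ f = m :=
    ⟨_, (KernelFork.IsLimit.lift' (shortExact_cokernel f).fIsKernel m h0).2⟩
  have hv0 : v ≠ 0 := fun h => hm0 (by rw [← hv', h, zero_comp])
  have : IsIso v := isIso_of_hom_simple hv0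
  exact ⟨inv v, inferInstance, by rw [← hv', IsIso.inv_hom_id_assoc]⟩

theorem exists_smul_of_isProjectiveCover [IsAlgClosed k]
    (hfin : ∀ X Y : A, Module.Finite k (X ⟶ Y)) {L P : A} [Simple L] {p : P ⟶ L}
    (hp : IsProjectiveCover p) (f : P ⟶ L) : ∃ c : k, f = c • p := by
  by_cases hf : f = 0
  · exact ⟨0, by rw [hf, zero_smul]⟩
  · obtain ⟨u, -, rfl⟩ := exists_comp_eq_of_isProjectiveCover hp hf
    obtain ⟨c, rfl⟩ := endomorphism_simple_eq_smul_id k u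
    exact ⟨c, by rw [Linear.comp_smul, Category.comp_id]⟩

theorem exists_smul_of_isInjectiveHull [IsAlgClosed k]
    (hfin : ∀ X Y : A, Module.Finite k (X ⟶ Y)) {L I : A} [Simple L] {m : L ⟶ I}
    (hm : IsInjectiveHull m) (f : L ⟶ I) : ∃ c : k, f = c • m := by
  by_cases hf : f = 0
  · exact ⟨0, by rw [hf, zero_smul]⟩
  · obtain ⟨u, -, rfl⟩ := exists_comp_eq_of_isInjectiveHull hm hf
    obtain ⟨c, rfl⟩ := endomorphism_simple_eq_smul_id k u
    exact ⟨c, by rw [Linear.smul_comp, Category.id_comp]⟩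

/-- The length of an essential extension `E` of a simple object is bounded: for a functional `φ`
on `Hom(G, E)` that does not vanish on `Hom(G, L)`, the pairing `φ (r ≫ g)` of `r : G ⟶ G` and
`g : G ⟶ E` is nondegenerate in `g`. -/
theorem finrank_hom_le_of_essential (hfin : ∀ X Y : A, Module.Finite k (X ⟶ Y)) [Projective G]
    (hG : IsSeparator G) {L E : A} [Simple L] {m : L ⟶ E} [Mono m] (hm : IsEssential m) :
    Module.finrank k (G ⟶ E) ≤ Module.finrank k (G ⟶ G) := by
  obtain ⟨g₀, hg₀⟩ : ∃ g₀ : G ⟶ L, g₀ ≠ 0 := by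
    by_contra! h
    rw [isSeparator_def] at hG
    exact Simple.not_isZero L ((IsZero.iff_id_eq_zero L).2 (hG _ _ fun x => by
      rw [h x, zero_comp, zero_comp]))
  have hg₁ : g₀ ≫ m ≠ 0 := fun h => hg₀ ((cancel_mono m).1 (by rw [h, zero_comp]))
  obtain ⟨φ, hφ⟩ : ∃ φ : Module.Dual k (G ⟶ E), φ (g₀ ≫ m) ≠ 0 := by
    by_contra! h
    exact hg₁ ((Module.forall_dual_apply_eq_zero_iff k _).1 h)
  let Φ : (G ⟶ E) →ₗ[k] Module.Dual k (G ⟶ G) :=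
    { toFun := fun g => φ ∘ₗ Linear.rightComp k G g
      map_add' := fun a b => by ext r; simp
      map_smul' := fun c a => by ext r; simp }
  have hΦ : Function.Injective Φ := by
    rw [injective_iff_map_eq_zero]
    intro g hg
    by_contra hg0
    obtain ⟨r, hr⟩ := exists_comp_eq_of_essential hm hg0 g₀
    exact hφ (by rw [← hr]; exact LinearMap.congr_fun hg r)
  refine (LinearMap.finrank_le_finrank_of_injective hΦ).trans ?_
  rw [Subspace.dual_finrank_eq]

theorem injective_of_forall_mono_splits {E : A}
    (h : ∀ (Y : A) (j : E ⟶ Y), Mono j → ∃ r : Y ⟶ E, j ≫ r = 𝟙 E) : Injective E := by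
  refine ⟨fun {X Y} g f hf => ?_⟩
  obtain ⟨r, hr⟩ := h _ (pushout.inr f g) inferInstance
  exact ⟨pushout.inl f g ≫ r, by rw [pushout.condition_assoc, hr, Category.comp_id]⟩

/-- Simple objects have injective hulls: an essential extension of maximal length is injective. -/
theorem exists_isInjectiveHull (hfin : ∀ X Y : A, Module.Finite k (X ⟶ Y)) [Projective G]
    (hG : IsSeparator G) (L : A) [Simple L] : ∃ (I : A) (m : L ⟶ I), IsInjectiveHull m := by
  let d : A → ℕ := fun X => Module.finrank k (G ⟶ X)
  let s : Set A := {E | ∃ m : L ⟶ E, Mono m ∧ IsEssential m}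
  have hs : s.Nonempty := ⟨L, 𝟙 L, inferInstance, fun Y f h => by rwa [Category.id_comp] at h⟩
  obtain ⟨E, ⟨m, hm, hess⟩, hmax⟩ := (measure fun E => d G - d E).wf.has_min s hs
  replace hmax : ∀ E' ∈ s, d E' ≤ d E := by
    intro E' hE'
    have h1 := hmax E' hE'
    obtain ⟨m', hm', hess'⟩ := hE'
    have h2 : d E' ≤ d G := finrank_hom_le_of_essential hfin hG hess'
    change ¬ (d G - d E' < d G - d E) at h1
    omega
  refine ⟨E, m, injective_of_forall_mono_splits fun Y j hj => ?_, hm, hess⟩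
  -- a minimal quotient `Q` of `Y` in which `E` still embeds is an essential extension of `E`
  let t : Set A := {Q | ∃ q : Y ⟶ Q, Epi q ∧ Mono (j ≫ q)}
  have ht : t.Nonempty := ⟨Y, 𝟙 Y, inferInstance, by rwa [Category.comp_id]⟩
  obtain ⟨Q, ⟨q, hq, hjq⟩, hmin⟩ := (measure d).wf.has_min t ht
  have hQ : Q ∈ s := by
    refine ⟨m ≫ j ≫ q, mono_comp _ _, fun R f hf => ?_⟩
    have h1 : Mono (j ≫ q ≫ f) := hess _ _ (by simpa using hf)
    have h2 : Mono ((j ≫ q ≫ Abelian.factorThruImage f) ≫ Abelian.image.ι f) := by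
      simpa using h1
    have h3 : Mono (j ≫ q ≫ Abelian.factorThruImage f) := mono_of_mono _ (Abelian.image.ι f)
    have h4 := hmin (Abelian.image f)
      ⟨q ≫ Abelian.factorThruImage f, epi_comp _ _, h3⟩
    have : IsIso (Abelian.factorThruImage f) := isIso_of_epi_of_finrank_le hfin hG _ (not_lt.1 h4)
    rw [← Abelian.image.fac f]
    exact mono_comp _ _
  have : IsIso (j ≫ q) := isIso_of_mono_of_finrank_le hfin hG _ (hmax Q hQ)
  exact ⟨q ≫ inv (j ≫ q), by rw [← Category.assoc, IsIso.hom_inv_id]⟩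

end Generator

/-! ### Composition factors -/

section Factors

variable {A : Type u₁} [Category.{v₁} A] [Abelian A] {Λ : Type w'}

/-- The simple objects `L i` of an abelian category of finite length, with their projective
covers. -/
structure SimpleData (L : Λ → A) where
  simple : ∀ i, Simple (L i)
  inj : ∀ i j, Nonempty (L i ≅ L j) → i = j
  length : ∀ X, Filt L Set.univ X
  P : Λ → A
  p : ∀ i, P i ⟶ L i
  cover : ∀ i, IsProjectiveCover (p i)

namespace SimpleData

variable {L : Λ → A} (S : SimpleData L)

theorem projective (i : Λ) : Projective (S.P i) := (S.cover i).projective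

theorem epi_p (i : Λ) : Epi (S.p i) := (S.cover i).epi

theorem p_ne_zero (i : Λ) : S.p i ≠ 0 := fun h => by
  have := S.simple i
  have := S.epi_p i
  exact Simple.not_isZero (L i) ((IsZero.iff_id_eq_zero _).2 (by
    rw [← cancel_epi (S.p i), h, zero_comp, zero_comp]))

theorem homZero_simple {i j : Λ} (h : i ≠ j) : HomZero (S.P i) (L j) := by
  intro f
  have := S.simple i
  have := S.simple j
  by_contra hf
  obtain ⟨u, _, -⟩ := exists_comp_eq_of_isProjectiveCover (S.cover i) hf
  exact h (S.inj i j ⟨asIso u⟩)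

theorem homZero_of_filt {s : Set Λ} {X : A} (hX : Filt L s X) {j : Λ} (hj : j ∉ s) :
    HomZero (S.P j) X :=
  homZero_right hX fun _ ⟨i, hi, ⟨e⟩⟩ =>
    (S.homZero_simple (i := j) (j := i) fun h => hj (by rw [h]; exact hi)).of_iso_right e.symm

theorem homZero_quotient {X Y : A} {j : Λ} (h : HomZero (S.P j) X) (f : X ⟶ Y) [Epi f] :
    HomZero (S.P j) Y := by
  intro g
  have := S.projective j
  rw [← Projective.factorThru_comp g f, h (Projective.factorThru g f), zero_comp]

/-- All composition factors of `X` are among the `L i`, `i ∈ s`, if and only if the other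
projective covers have no nonzero morphisms to `X`. -/
theorem filt_iff {s : Set Λ} {X : A} : Filt L s X ↔ ∀ j, j ∉ s → HomZero (S.P j) X := by
  refine ⟨fun h j hj => S.homZero_of_filt h hj, fun h => ?_⟩
  have key : ∀ {X}, Filt L Set.univ X → (∀ j, j ∉ s → HomZero (S.P j) X) → Filt L s X := by
    intro X hX
    induction hX with
    | zero Z hZ => exact fun _ => .zero Z hZ
    | of X hX =>
      intro h
      obtain ⟨i, -, ⟨e⟩⟩ := hX
      refine .of _ ⟨i, ?_, ⟨e⟩⟩
      by_contra hi
      exact S.p_ne_zero i (((h i hi).of_iso_right e) _)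
    | ext T hT _ _ h₁ h₃ =>
      intro h
      have := hT.mono_f
      have := hT.epi_g
      exact extClosure_ext hT (h₁ fun j hj => (h j hj).of_mono T.f)
        (h₃ fun j hj => S.homZero_quotient (h j hj) T.g)
  exact key (S.length X) h

theorem filt_of_epi (S : SimpleData L) {s : Set Λ} {X Y : A} (hX : Filt L s X) (f : X ⟶ Y)
    [Epi f] : Filt L s Y :=
  S.filt_iff.2 fun j hj => S.homZero_quotient (S.filt_iff.1 hX j hj) f

/-- A nonzero object contains a simple object. -/
theorem exists_mono_simple (S : SimpleData L) {X : A} (hX : ¬ IsZero X) :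
    ∃ (i : Λ) (f : L i ⟶ X), Mono f := by
  obtain h | ⟨W, Z, i, p, hw, e, ⟨j, -, ⟨e'⟩⟩, -⟩ := isZero_or_exists_generator (S.length X)
  · exact absurd h hX
  · have : Mono i := e.mono_f
    exact ⟨j, e'.inv ≫ i, mono_comp _ _⟩

/-- An object without the composition factor `L j` has no nonzero morphism to the injective hull
of `L j`. -/
theorem homZero_hull {j : Λ} {I : A} {m : L j ⟶ I} (hm : IsInjectiveHull m) {X : A}
    (h : HomZero (S.P j) X) : HomZero X I := by
  intro f
  have := S.simple j
  have := S.projective j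
  have := hm.mono
  by_contra hf
  obtain ⟨b, hb⟩ := exists_comp_eq_of_essential hm.essential hf (S.p j)
  refine S.p_ne_zero j ?_
  rw [← cancel_mono m, ← hb, h b, zero_comp, zero_comp]

/-- In a category with finite lengths, every object has a largest subobject with composition
factors among the `L i`, `i ∈ s`. -/
theorem exists_max_subobject (S : SimpleData L) {k : Type u} [Field k] [Linear k A]
    (hfin : ∀ X Y : A, Module.Finite k (X ⟶ Y)) {G : A} [Projective G] (hG : IsSeparator G)
    (s : Set Λ) (I : A) : ∃ (N : A) (n : N ⟶ I), Mono n ∧ Filt L s N ∧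
      ∀ (Q : A) (f : Q ⟶ I), Mono f → Filt L s Q → ∃ g : Q ⟶ N, g ≫ n = f := by
  let d : A → ℕ := fun X => Module.finrank k (G ⟶ X)
  let t : Set A := {N | ∃ n : N ⟶ I, Mono n ∧ Filt L s N}
  have ht : t.Nonempty := ⟨0, 0, ⟨fun _ _ _ => (isZero_zero A).eq_of_tgt _ _⟩,
    .zero _ (isZero_zero A)⟩
  obtain ⟨N, ⟨n, hn, hN⟩, hmax⟩ := (measure fun N => d I - d N).wf.has_min t ht
  refine ⟨N, n, hn, hN, fun Q f hf hQ => ?_⟩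
  -- the sum of the two subobjects is a quotient of their direct sum
  let c := biprod.desc n f
  have hsum : Abelian.image c ∈ t := ⟨Abelian.image.ι c, inferInstance,
    S.filt_of_epi (extClosure_biprod hN hQ) (Abelian.factorThruImage c)⟩
  have h1 := hmax _ hsum
  have h2 : d (Abelian.image c) ≤ d I := finrank_hom_le_of_mono hfin (Abelian.image.ι c)
  have h3 : d (Abelian.image c) ≤ d N := by
    change ¬ (d I - d (Abelian.image c) < d I - d N) at h1
    omega
  let a : N ⟶ Abelian.image c := biprod.inl ≫ Abelian.factorThruImage c
  have ha : a ≫ Abelian.image.ι c = n := by simp [a, c]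
  have : Mono a := mono_of_mono_fac ha
  have : IsIso a := isIso_of_mono_of_finrank_le hfin hG a h3
  refine ⟨biprod.inr ≫ Abelian.factorThruImage c ≫ inv a, ?_⟩
  rw [← ha]
  simp [c]

end SimpleData

end Factors

/-! ### Standard and costandard objects -/

section HighestWeight

variable {A : Type u₁} [Category.{v₁} A] [Abelian A] {Λ : Type w'} [PartialOrder Λ]

/-- The objects attached to the simple objects of a highest weight category: the projective covers
`q i : P i ⟶ D i` of the standard objects and their simple quotients `e i : D i ⟶ L i`, the
injective hulls `m i : L i ⟶ I i`, and the costandard objects `n i : N i ⟶ I i`. -/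
structure HighestWeightData (L : Λ → A) extends SimpleData L where
  D : Λ → A
  q : ∀ i, P i ⟶ D i
  epi_q : ∀ i, Epi (q i)
  filt_ker_q : ∀ i, Filt D {j | i < j} (kernel (q i))
  e : ∀ i, D i ⟶ L i
  epi_e : ∀ i, Epi (e i)
  filt_ker_e : ∀ i, Filt L {j | j < i} (kernel (e i))
  I : Λ → A
  m : ∀ i, L i ⟶ I i
  hull : ∀ i, IsInjectiveHull (m i)
  N : Λ → A
  n : ∀ i, N i ⟶ I i
  mono_n : ∀ i, Mono (n i)
  filt_N : ∀ i, Filt L {j | j ≤ i} (N i)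
  max_N : ∀ i (Q : A) (f : Q ⟶ I i), Mono f → Filt L {j | j ≤ i} Q → ∃ g : Q ⟶ N i, g ≫ n i = f

namespace HighestWeightData

variable {L : Λ → A} (S : HighestWeightData L)

theorem filt_D (i : Λ) : Filt L {j | j ≤ i} (S.D i) := by
  have := S.epi_e i
  refine extClosure_ext (shortExact_kernel (S.e i)) ?_ (.of _ ⟨i, le_rfl, ⟨Iso.refl _⟩⟩)
  exact extClosure_mono (fun Z ⟨j, hj, h⟩ => ⟨j, le_of_lt hj, h⟩) (S.filt_ker_e i)

theorem homZero_P_D {i j : Λ} (h : ¬ j ≤ i) : HomZero (S.P j) (S.D i) :=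
  S.homZero_of_filt (S.filt_D i) h

theorem homZero_P_N {i j : Λ} (h : ¬ j ≤ i) : HomZero (S.P j) (S.N i) :=
  S.homZero_of_filt (S.filt_N i) h

theorem homZero_D {i : Λ} {X : A} (h : HomZero (S.P i) X) : HomZero (S.D i) X :=
  have := S.epi_q i
  h.of_epi (S.q i)

theorem homZero_D_D {i j : Λ} (h : ¬ i ≤ j) : HomZero (S.D i) (S.D j) :=
  S.homZero_D (S.homZero_P_D h)

/-- An object without the composition factor `L j` has no nonzero morphism to `N j`, as `N j` is
contained in the injective hull of `L j`. -/
theorem homZero_N {j : Λ} {X : A} (h : HomZero (S.P j) X) : HomZero X (S.N j) :=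
  have := S.mono_n j
  (S.homZero_hull (S.hull j) h).of_mono (S.n j)

theorem homZero_N_N {i j : Λ} (h : ¬ j ≤ i) : HomZero (S.N i) (S.N j) :=
  S.homZero_N (S.homZero_P_N h)

theorem homZero_ker_q {i : Λ} {X : A} (h : ∀ j, i < j → HomZero (S.P j) X) :
    HomZero (kernel (S.q i)) X :=
  homZero_left (S.filt_ker_q i) fun _ ⟨j, hj, ⟨e⟩⟩ => (S.homZero_D (h j hj)).of_iso_left e.symm

theorem homZero_P_ker_e (i : Λ) : HomZero (S.P i) (kernel (S.e i)) :=
  S.homZero_of_filt (S.filt_ker_e i) (lt_irrefl i)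

/-- Quotients of `P i` without composition factors `L j`, `j > i`, are quotients of `D i`. -/
theorem exists_q_comp_eq {i : Λ} {X : A} (h : ∀ j, i < j → HomZero (S.P j) X) (f : S.P i ⟶ X) :
    ∃ g : S.D i ⟶ X, S.q i ≫ g = f := by
  have := S.epi_q i
  exact ⟨_, (CokernelCofork.IsColimit.desc' (shortExact_kernel (S.q i)).gIsCokernel f
    (S.homZero_ker_q h _)).2⟩

theorem D_nonzero (i : Λ) : ¬ IsZero (S.D i) := fun h => by
  have := S.epi_e i
  have := S.simple i
  exact Simple.not_isZero (L i) ((IsZero.iff_id_eq_zero _).2 (by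
    rw [← cancel_epi (S.e i)]
    exact h.eq_of_src _ _))

theorem exists_socle (i : Λ) : ∃ s : L i ⟶ S.N i, s ≫ S.n i = S.m i :=
  S.max_N i (L i) (S.m i) (S.hull i).mono (.of _ ⟨i, le_rfl, ⟨Iso.refl _⟩⟩)

/-- The inclusion of the socle of `N i`. -/
noncomputable def s (i : Λ) : L i ⟶ S.N i := (S.exists_socle i).choose

theorem s_n (i : Λ) : S.s i ≫ S.n i = S.m i := (S.exists_socle i).choose_spec

theorem mono_s (i : Λ) : Mono (S.s i) :=
  have := (S.hull i).mono
  mono_of_mono_fac (S.s_n i)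

theorem N_nonzero (i : Λ) : ¬ IsZero (S.N i) := fun h => by
  have := S.mono_s i
  have := S.simple i
  exact Simple.not_isZero (L i) ((IsZero.iff_id_eq_zero _).2 (by
    rw [← cancel_mono (S.s i)]
    exact h.eq_of_tgt _ _))

/-- A morphism out of `N i` is a monomorphism as soon as it is nonzero on the socle. -/
theorem mono_of_s_comp_ne_zero {i : Λ} {X : A} (g : S.N i ⟶ X) (hg : S.s i ≫ g ≠ 0) : Mono g := by
  have := S.simple i
  have := S.projective i
  have := S.epi_p i
  have := S.mono_n i
  rw [Preadditive.mono_iff_cancel_zero]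
  intro K κ hκ
  by_contra h0
  have h1 : κ ≫ S.n i ≠ 0 := fun h => h0 ((cancel_mono (S.n i)).1 (by rw [h, zero_comp]))
  obtain ⟨b, hb⟩ := exists_comp_eq_of_essential (S.hull i).essential h1 (S.p i)
  have hb' : b ≫ κ = S.p i ≫ S.s i := by
    rw [← cancel_mono (S.n i), Category.assoc, hb, Category.assoc, S.s_n]
  refine hg ?_
  rw [← cancel_epi (S.p i), ← Category.assoc, ← hb', Category.assoc, hκ, comp_zero, comp_zero]

section Scalar

variable {k : Type u} [Field k] [IsAlgClosed k] [Linear k A]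

/-- `Hom(P i, D i)` is spanned by `q i`: up to a scalar, `f` and `q i` agree modulo the radical of
`D i`, to which `P i` has no nonzero morphisms. -/
theorem exists_smul_q (hfin : ∀ X Y : A, Module.Finite k (X ⟶ Y)) {i : Λ} (f : S.P i ⟶ S.D i) :
    ∃ c : k, f = c • S.q i := by
  have := S.simple i
  have := S.epi_e i
  have := S.epi_q i
  have h0 : S.q i ≫ S.e i ≠ 0 := fun h => by
    refine S.p_ne_zero i ?_
    obtain ⟨g, hg⟩ := S.exists_q_comp_eq (fun j hj => S.homZero_of_filt
      (.of _ ⟨i, rfl, ⟨Iso.refl _⟩⟩ : Filt L {i} (L i)) hj.ne') (S.p i)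
    have h1 : S.e i = 0 := by rw [← cancel_epi (S.q i), h, comp_zero]
    have h2 : IsZero (L i) := (IsZero.iff_id_eq_zero _).2 (by
      rw [← cancel_epi (S.e i), h1, zero_comp, zero_comp])
    exact h2.eq_of_tgt _ _
  obtain ⟨c, hc⟩ := exists_smul_of_isProjectiveCover (k := k) hfin (S.cover i) (f ≫ S.e i)
  obtain ⟨c', hc'⟩ := exists_smul_of_isProjectiveCover (k := k) hfin (S.cover i) (S.q i ≫ S.e i)
  have hc0 : c' ≠ 0 := fun h => h0 (by rw [hc', h, zero_smul])
  have h1 : (f - (c * c'⁻¹) • S.q i) ≫ S.e i = 0 := by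
    rw [Preadditive.sub_comp, Linear.smul_comp, hc, hc', smul_smul, mul_assoc,
      inv_mul_cancel₀ hc0, mul_one, sub_self]
  refine ⟨c * c'⁻¹, sub_eq_zero.1 ?_⟩
  rw [← kernel.lift_ι (S.e i) _ h1, S.homZero_P_ker_e i (kernel.lift (S.e i) _ h1), zero_comp]

theorem exists_smul_id_D (hfin : ∀ X Y : A, Module.Finite k (X ⟶ Y)) {i : Λ} (f : S.D i ⟶ S.D i) :
    ∃ c : k, f = c • 𝟙 (S.D i) := by
  have := S.epi_q i
  obtain ⟨c, hc⟩ := S.exists_smul_q (k := k) hfin (S.q i ≫ f)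
  exact ⟨c, by rw [← cancel_epi (S.q i), hc, Linear.comp_smul, Category.comp_id]⟩

/-- The composition factor `L i` occurs only once in `N i`: every morphism `P i ⟶ N i` is a
multiple of `P i ⟶ L i ⟶ N i`, as it factors through `D i`, and kills the radical of `D i`. -/
theorem exists_smul_p_s (hfin : ∀ X Y : A, Module.Finite k (X ⟶ Y)) {i : Λ} (f : S.P i ⟶ S.N i) :
    ∃ c : k, f = c • (S.p i ≫ S.s i) := by
  have := S.simple i
  have := S.epi_e i
  have := S.mono_n i
  obtain ⟨g, rfl⟩ := S.exists_q_comp_eq (fun j hj => S.homZero_P_N hj.not_ge) f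
  obtain ⟨l, rfl⟩ : ∃ l : L i ⟶ S.N i, S.e i ≫ l = g :=
    ⟨_, (CokernelCofork.IsColimit.desc' (shortExact_kernel (S.e i)).gIsCokernel g
      (S.homZero_N (S.homZero_P_ker_e i) _)).2⟩
  obtain ⟨c, hc⟩ := exists_smul_of_isInjectiveHull (k := k) hfin (S.hull i) (l ≫ S.n i)
  have hl : l = c • S.s i := by
    rw [← cancel_mono (S.n i), hc, Linear.smul_comp, S.s_n]
  obtain ⟨c', hc'⟩ := exists_smul_of_isProjectiveCover (k := k) hfin (S.cover i) (S.q i ≫ S.e i)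
  exact ⟨c * c', by rw [← Category.assoc, hc', hl, Linear.smul_comp, Linear.comp_smul, smul_smul,
    mul_comm]⟩

theorem filt_coker_s (hfin : ∀ X Y : A, Module.Finite k (X ⟶ Y)) (i : Λ) :
    Filt L {j | j < i} (cokernel (S.s i)) := by
  refine S.filt_iff.2 fun j hj => ?_
  have := S.projective j
  intro f
  obtain ⟨g, rfl⟩ := Projective.factors f (cokernel.π (S.s i))
  by_cases hji : j ≤ i
  · obtain rfl : j = i := hji.eq_of_not_lt hj
    obtain ⟨c, rfl⟩ := S.exists_smul_p_s (k := k) hfin g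
    rw [Linear.smul_comp, Category.assoc, cokernel.condition, comp_zero, smul_zero]
  · rw [S.homZero_P_N hji g, zero_comp]

/-- An endomorphism of `N i` acts on the socle `L i` by a scalar, and a morphism vanishing on the
socle factors through an object without the composition factor `L i`, so it is zero. -/
theorem exists_smul_id_N (hfin : ∀ X Y : A, Module.Finite k (X ⟶ Y)) {i : Λ} (f : S.N i ⟶ S.N i) :
    ∃ c : k, f = c • 𝟙 (S.N i) := by
  have := S.simple i
  have := S.mono_n i
  obtain ⟨c, hc⟩ := exists_smul_of_isInjectiveHull (k := k) hfin (S.hull i)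
    ((S.s i ≫ f) ≫ S.n i)
  have h0 : S.s i ≫ (f - c • 𝟙 (S.N i)) = 0 := by
    rw [← cancel_mono (S.n i), Preadditive.comp_sub, Preadditive.sub_comp, hc, Linear.comp_smul,
      Category.comp_id, Linear.smul_comp, S.s_n, sub_self, zero_comp]
  refine ⟨c, sub_eq_zero.1 ?_⟩
  rw [← cokernel.π_desc (S.s i) _ h0, S.homZero_N (S.homZero_of_filt
    (S.filt_coker_s (k := k) hfin i) (lt_irrefl i)) (cokernel.desc (S.s i) _ h0), comp_zero]

end Scalar

end HighestWeightData

end HighestWeight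

/-! ### Vanishing of extensions between standard and costandard objects -/

section DimensionShift

variable {A : Type u₁} [Category.{v₁} A] [Abelian A] [HasExt.{w} A]

open Abelian

/-- Dimension shift in the second variable, along an injective presentation. -/
theorem extZero_succ_of_injective {S : ShortComplex A} (hS : S.ShortExact) [Injective S.X₂]
    {n : ℕ} {Z : A} (h : ExtZero.{u₁, v₁, w} n Z S.X₃) : ExtZero.{u₁, v₁, w} (n + 1) Z S.X₁ := by
  intro x
  obtain ⟨y, rfl⟩ := Ext.covariant_sequence_exact₁ Z hS x (Ext.eq_zero_of_injective _) rfl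
  rw [h y, Ext.zero_comp]

theorem extZero_succ_quotient {S : ShortComplex A} (hS : S.ShortExact) {n : ℕ} {Y : A}
    (h₁ : ExtZero.{u₁, v₁, w} n S.X₁ Y) (h₂ : ExtZero.{u₁, v₁, w} (n + 1) S.X₂ Y) :
    ExtZero.{u₁, v₁, w} (n + 1) S.X₃ Y := by
  intro x
  obtain ⟨y, rfl⟩ := Ext.contravariant_sequence_exact₃ hS Y x (h₂ _) (add_comm 1 n)
  rw [h₁ y, Ext.comp_zero]

theorem extZero_quotient {S : ShortComplex A} (hS : S.ShortExact) {n : ℕ} {Z : A}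
    (h₂ : ExtZero.{u₁, v₁, w} n Z S.X₂) (h₁ : ExtZero.{u₁, v₁, w} (n + 1) Z S.X₁) :
    ExtZero.{u₁, v₁, w} n Z S.X₃ := by
  intro x
  obtain ⟨y, rfl⟩ := Ext.covariant_sequence_exact₃ Z hS x rfl (h₁ _)
  rw [h₂ y, Ext.zero_comp]

end DimensionShift

section HighestWeight

variable {A : Type u₁} [Category.{v₁} A] [Abelian A] {Λ : Type w'} [PartialOrder Λ]

namespace HighestWeightData

variable {L : Λ → A} (S : HighestWeightData L)

theorem homZero_ker_e_N {i j : Λ} (h : ¬ j < i) : HomZero (kernel (S.e i)) (S.N j) :=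
  S.homZero_N (S.homZero_of_filt (S.filt_ker_e i) h)

/-- By maximality of `N j`, the quotient `I j / N j` has no simple subobject `L i` with
`i ≤ j`. -/
theorem homZero_L_coker_n {i j : Λ} (h : i ≤ j) : HomZero (L i) (cokernel (S.n j)) := by
  intro f
  by_contra hf
  have := S.simple i
  have := S.mono_n j
  have : Mono f := mono_of_nonzero_from_simple hf
  obtain ⟨K, a, b, l, w₁, w₂, h₁, h₂, hab, hl⟩ :=
    exists_shortExact_preimage (shortExact_cokernel (S.n j)) (shortExact_cokernel f)
  obtain ⟨g, hg⟩ := S.max_N j K l hl.mono_f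
    (extClosure_ext hab (S.filt_N j) (.of _ ⟨i, h, ⟨Iso.refl _⟩⟩))
  have : Epi b := hab.epi_g
  refine hf ?_
  rw [← cancel_epi b, h₂, ← hg, Category.assoc, cokernel.condition, comp_zero, comp_zero]

variable [HasExt.{w} A]

/-- `Ext¹(D i, Y)` is a quotient of `Hom(ker q, Y)` for `q : P i ⟶ D i`, and `ker q` is filtered by
the `D j` with `j > i`. -/
theorem extZero_D {i : Λ} {Y : A} (h : ∀ j, i < j → HomZero (S.P j) Y) :
    ExtZero.{u₁, v₁, w} 1 (S.D i) Y :=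
  have := S.epi_q i
  have := S.projective i
  extZero_succ_of_projective (shortExact_kernel (S.q i)) (S.homZero_ker_q h).extZero

theorem extZero_D_D {i j : Λ} (h : ¬ i < j) : ExtZero.{u₁, v₁, w} 1 (S.D i) (S.D j) :=
  S.extZero_D fun _ hl => S.homZero_P_D fun hlj => h (hl.trans_le hlj)

/-- For `i ≤ j` this follows from the injective hull of `L j`; if `i` and `j` are incomparable, then
`Ext¹(D i, N j) = 0` and `Hom(ker e, N j) = 0` for `e : D i ⟶ L i`. -/
theorem extZero_L_N {i j : Λ} (h : ¬ j < i) : ExtZero.{u₁, v₁, w} 1 (L i) (S.N j) := by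
  by_cases hij : i ≤ j
  · have := S.mono_n j
    have := (S.hull j).injective
    exact extZero_succ_of_injective (shortExact_cokernel (S.n j))
      (S.homZero_L_coker_n hij).extZero
  · have := S.epi_e i
    exact extZero_succ_quotient (shortExact_kernel (S.e i)) (S.homZero_ker_e_N h).extZero
      (S.extZero_D fun l hl => S.homZero_P_N fun hlj => hij (hl.le.trans hlj))

theorem extZero_N {X : A} {i j : Λ} (h : ¬ j < i) (hX : Filt L {l | l ≤ i} X) :
    ExtZero.{u₁, v₁, w} 1 X (S.N j) :=
  extZero_left hX fun _ ⟨_, hl, ⟨e⟩⟩ =>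
    (S.extZero_L_N fun hjl => h (hjl.trans_le hl)).of_iso_left e.symm

theorem extZero_N_N {i j : Λ} (h : ¬ j < i) : ExtZero.{u₁, v₁, w} 1 (S.N i) (S.N j) :=
  S.extZero_N h (S.filt_N i)

theorem extZero_D_N (i j : Λ) : ExtZero.{u₁, v₁, w} 1 (S.D i) (S.N j) := by
  by_cases h : j < i
  · exact S.extZero_D fun l hl => S.homZero_P_N fun hlj => lt_asymm h (hl.trans_le hlj)
  · exact S.extZero_N h (S.filt_D i)

/-- Dimension shift from `Ext¹(D l, N j) = 0`, as the kernel of `P i ⟶ D i` is filtered by standard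
objects. -/
theorem extZero_two_D_N (i j : Λ) : ExtZero.{u₁, v₁, w} 2 (S.D i) (S.N j) :=
  have := S.epi_q i
  have := S.projective i
  extZero_succ_of_projective (shortExact_kernel (S.q i))
    (extZero_left (S.filt_ker_q i) fun _ ⟨l, _, ⟨e⟩⟩ => (S.extZero_D_N l j).of_iso_left e.symm)

section Criterion

variable {k : Type u} [Field k] [IsAlgClosed k] [Linear k A] [Finite Λ] {G : A} [Projective G]

/-- An object `M` with `Ext¹(D i, M) = 0` for all `i` is filtered by costandard objects. Namely,
for a minimal `i` with `Hom(D i, M) ≠ 0` the inclusion of `L i` into `M` extends to `N i`, and the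
extension is a monomorphism. -/
theorem filt_N_of_extZero (hfin : ∀ X Y : A, Module.Finite k (X ⟶ Y)) (hG : IsSeparator G) {M : A}
    (hM : ∀ i, ExtZero.{u₁, v₁, w} 1 (S.D i) M) : Filt S.N Set.univ M := by
  induction hd : Module.finrank k (G ⟶ M) using Nat.strong_induction_on generalizing M with
  | _ d ih =>
    by_cases hM0 : IsZero M
    · exact .zero _ hM0
    obtain ⟨i, hi, hmin⟩ : ∃ i, ¬ HomZero (S.D i) M ∧ ∀ j < i, HomZero (S.D j) M := by
      obtain ⟨j, f, hf⟩ := S.exists_mono_simple hM0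
      have hj : ¬ HomZero (S.D j) M := fun h => by
        have := S.simple j
        have := S.epi_e j
        refine Simple.not_isZero (L j) ((IsZero.iff_id_eq_zero _).2 ?_)
        rw [← cancel_epi (S.e j), ← cancel_mono f, Category.comp_id, comp_zero, zero_comp]
        exact h _
      obtain ⟨i, hi, hmin⟩ := (Finite.to_wellFoundedLT (α := Λ)).wf.has_min
        {i | ¬ HomZero (S.D i) M} ⟨j, hj⟩
      exact ⟨i, hi, fun j hj => by_contra fun h => hmin j h hj⟩
    have hL : ∀ j < i, HomZero (L j) M := fun j hj =>
      have := S.epi_e j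
      (hmin j hj).of_epi (S.e j)
    have hker : ∀ j ≤ i, HomZero (kernel (S.e j)) M := fun j hj =>
      homZero_left (S.filt_ker_e j) fun _ ⟨l, hl, ⟨e⟩⟩ =>
        (hL l (lt_of_lt_of_le hl hj)).of_iso_left e.symm
    obtain ⟨f, hf⟩ : ∃ f : S.D i ⟶ M, f ≠ 0 := by
      by_contra! h
      exact hi h
    have := S.epi_e i
    have := S.mono_s i
    obtain ⟨l, hl⟩ : ∃ l : L i ⟶ M, S.e i ≫ l = f :=
      ⟨_, (CokernelCofork.IsColimit.desc' (shortExact_kernel (S.e i)).gIsCokernel f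
        (hker i le_rfl _)).2⟩
    have hs : ExtZero.{u₁, v₁, w} 1 (cokernel (S.s i)) M :=
      extZero_left (S.filt_coker_s (k := k) hfin i) fun _ ⟨j, hj, ⟨e⟩⟩ =>
        have := S.epi_e j
        (extZero_succ_quotient (shortExact_kernel (S.e j)) (hker j (le_of_lt hj)).extZero
          (hM j)).of_iso_left e.symm
    obtain ⟨g, hg⟩ := hs.extend (shortExact_cokernel (S.s i)) l
    have hl0 : l ≠ 0 := fun h => hf (by rw [← hl, h, comp_zero])
    have hg' : S.s i ≫ g = l := hg
    have hgm : Mono g := S.mono_of_s_comp_ne_zero g (by rwa [hg'])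
    refine extClosure_ext (shortExact_cokernel g) (.of _ ⟨i, trivial, ⟨Iso.refl _⟩⟩)
      (ih _ ?_ (fun j => extZero_quotient (shortExact_cokernel g) (hM j) (S.extZero_two_D_N j i))
        rfl)
    rw [← hd]
    by_contra hlt
    have : IsIso (cokernel.π g) := isIso_of_epi_of_finrank_le hfin hG _ (not_lt.1 hlt)
    have hg0 : g = 0 := by
      rw [← cancel_mono (cokernel.π g), cokernel.condition, zero_comp]
    exact hl0 (by rw [← hg', hg0, comp_zero])

end Criterion

end HighestWeightData

end HighestWeight

/-! ### Resolutions by standard and costandard objects -/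

section Horseshoe

variable {A : Type u₁} [Category.{v₁} A] [Abelian A]

theorem epi_biprod_desc {S : ShortComplex A} (hS : S.ShortExact) {Q₁ Q₃ : A} (f₁ : Q₁ ⟶ S.X₁)
    [Epi f₁] (c : Q₃ ⟶ S.X₂) [Epi (c ≫ S.g)] : Epi (biprod.desc (f₁ ≫ S.f) c) := by
  rw [Preadditive.epi_iff_cancel_zero]
  intro Z t ht
  have h₁ : (f₁ ≫ S.f) ≫ t = 0 := by simpa using biprod.inl ≫= ht
  have h₃ : c ≫ t = 0 := by simpa using biprod.inr ≫= ht
  obtain ⟨u, rfl⟩ := CokernelCofork.IsColimit.desc' hS.gIsCokernel t (by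
    rw [← cancel_epi f₁, ← Category.assoc, h₁, comp_zero])
  have hu : (c ≫ S.g) ≫ u = 0 := by simpa using h₃
  rw [(cancel_epi (c ≫ S.g)).1 (hu.trans comp_zero.symm), comp_zero]

theorem mono_biprod_lift {S : ShortComplex A} (hS : S.ShortExact) {I₁ I₃ : A} (f₃ : S.X₃ ⟶ I₃)
    [Mono f₃] (c : S.X₂ ⟶ I₁) [Mono (S.f ≫ c)] : Mono (biprod.lift c (S.g ≫ f₃)) := by
  rw [Preadditive.mono_iff_cancel_zero]
  intro Z t ht
  have h₁ : t ≫ c = 0 := by simpa using ht =≫ biprod.fst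
  have h₃ : t ≫ S.g ≫ f₃ = 0 := by simpa using ht =≫ biprod.snd
  obtain ⟨u, rfl⟩ := KernelFork.IsLimit.lift' hS.fIsKernel t (by
    rw [← cancel_mono f₃, Category.assoc, h₃, zero_comp])
  have hu : u ≫ S.f ≫ c = 0 := (Category.assoc _ _ _).symm.trans h₁
  rw [(cancel_mono (S.f ≫ c)).1 (hu.trans zero_comp.symm), zero_comp]

/-- The kernel of the epimorphism `Q₁ ⊞ Q₃ ⟶ X₂` of the horseshoe lemma. -/
theorem exists_shortExact_horseshoe {S : ShortComplex A} (hS : S.ShortExact) {Q₁ Q₃ : A}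
    (f₁ : Q₁ ⟶ S.X₁) [Epi f₁] (c : Q₃ ⟶ S.X₂) :
    ∃ (a : kernel f₁ ⟶ kernel (biprod.desc (f₁ ≫ S.f) c))
      (b : kernel (biprod.desc (f₁ ≫ S.f) c) ⟶ kernel (c ≫ S.g)) (w : a ≫ b = 0),
      (ShortComplex.mk a b w).ShortExact := by
  let F := biprod.desc (f₁ ≫ S.f) c
  have := hS.mono_f
  let a : kernel f₁ ⟶ kernel F := kernel.lift F (kernel.ι f₁ ≫ biprod.inl) (by simp [F])
  have hF : F ≫ S.g = biprod.snd ≫ c ≫ S.g := by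
    ext <;> simp [F]
  let b : kernel F ⟶ kernel (c ≫ S.g) := kernel.lift _ (kernel.ι F ≫ biprod.snd) (by
    rw [Category.assoc, ← hF, kernel.condition_assoc, zero_comp])
  have ha : a ≫ kernel.ι F = kernel.ι f₁ ≫ biprod.inl := kernel.lift_ι _ _ _
  have hb : b ≫ kernel.ι (c ≫ S.g) = kernel.ι F ≫ biprod.snd := kernel.lift_ι _ _ _
  have w : a ≫ b = 0 := by
    rw [← cancel_mono (kernel.ι (c ≫ S.g)), Category.assoc, hb, ← Category.assoc, ha]
    simp
  have hma : Mono a := by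
    have : Mono (a ≫ kernel.ι F) := by rw [ha]; infer_instance
    exact mono_of_mono a (kernel.ι F)
  have : Epi b := by
    rw [epi_iff_surjective_up_to_refinements]
    intro Z y
    obtain ⟨t, ht⟩ := KernelFork.IsLimit.lift' hS.fIsKernel (y ≫ kernel.ι (c ≫ S.g) ≫ c) (by simp)
    obtain ⟨Z', π, hπ, r, hr⟩ := surjective_up_to_refinements_of_epi f₁ t
    have ht' : t ≫ S.f = y ≫ kernel.ι (c ≫ S.g) ≫ c := ht
    refine ⟨Z', π, hπ, kernel.lift F (biprod.lift (-r) (π ≫ y ≫ kernel.ι (c ≫ S.g))) ?_, ?_⟩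
    · simp only [F, biprod.lift_desc, Preadditive.neg_comp, Category.assoc]
      rw [← ht', reassoc_of% hr, neg_add_cancel]
    · rw [← cancel_mono (kernel.ι (c ≫ S.g)), Category.assoc, Category.assoc, hb,
        kernel.lift_ι_assoc, biprod.lift_snd]
  refine ⟨a, b, w, { exact := ?_, mono_f := hma, epi_g := this }⟩
  refine ShortComplex.exact_of_f_is_kernel _ (KernelFork.IsLimit.ofι' _ _ fun {U} x hx => ?_)
  have h1 : x ≫ kernel.ι F ≫ biprod.snd = 0 := by
    rw [← hb, ← Category.assoc]
    exact (congrArg (· ≫ kernel.ι (c ≫ S.g)) hx).trans zero_comp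
  have h2 : x ≫ kernel.ι F = (x ≫ kernel.ι F ≫ biprod.fst) ≫ biprod.inl := by
    ext <;> simp [h1]
  have h3 : (x ≫ kernel.ι F ≫ biprod.fst) ≫ f₁ = 0 := by
    have h4 : (x ≫ kernel.ι F) ≫ F = 0 := by rw [Category.assoc, kernel.condition, comp_zero]
    rw [h2, Category.assoc, biprod.inl_desc, ← Category.assoc] at h4
    exact (cancel_mono S.f).1 (by rw [h4, zero_comp])
  refine ⟨kernel.lift f₁ _ h3, ?_⟩
  rw [← cancel_mono (kernel.ι F), h2, Category.assoc]
  exact (congrArg (kernel.lift f₁ _ h3 ≫ ·) ha).trans (by simp)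

end Horseshoe

section HighestWeight

variable {A : Type u₁} [Category.{v₁} A] [Abelian A] {Λ : Type w'} [PartialOrder Λ]

namespace HighestWeightData

variable {L : Λ → A} (S : HighestWeightData L)

theorem filt_D_P (i : Λ) : Filt S.D Set.univ (S.P i) :=
  have := S.epi_q i
  extClosure_ext (shortExact_kernel (S.q i))
    (extClosure_mono (fun _ ⟨j, _, e⟩ => ⟨j, trivial, e⟩) (S.filt_ker_q i))
    (.of _ ⟨i, trivial, ⟨Iso.refl _⟩⟩)

theorem exists_epi_of_projective (M : A) :
    ∃ (Q : A) (f : Q ⟶ M), Filt S.D Set.univ Q ∧ Projective Q ∧ Epi f := by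
  induction S.length M with
  | zero Z hZ =>
    exact ⟨0, 0, .zero _ (isZero_zero A), inferInstance, ⟨fun _ _ _ => hZ.eq_of_src _ _⟩⟩
  | of X hX =>
    obtain ⟨i, -, ⟨e⟩⟩ := hX
    have := S.epi_p i
    exact ⟨S.P i, S.p i ≫ e.inv, S.filt_D_P i, S.projective i, epi_comp _ _⟩
  | ext T hT _ _ h₁ h₃ =>
    obtain ⟨Q₁, f₁, hQ₁, _, _⟩ := h₁
    obtain ⟨Q₃, f₃, hQ₃, _, _⟩ := h₃
    have := hT.epi_g
    have : Epi (Projective.factorThru f₃ T.g ≫ T.g) := by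
      rwa [Projective.factorThru_comp]
    exact ⟨Q₁ ⊞ Q₃, biprod.desc (f₁ ≫ T.f) (Projective.factorThru f₃ T.g),
      extClosure_biprod hQ₁ hQ₃, inferInstance, epi_biprod_desc hT _ _⟩

/-- Objects filtered by standard objects have projective resolutions within the category of these
objects. -/
theorem hasProjectiveResolutions : HasProjectiveResolutions (Filt S.D Set.univ) where
  cover := S.exists_epi_of_projective
  syzygy X hX := by
    induction hX with
    | zero Z hZ =>
      refine ⟨0, 0, .zero _ (isZero_zero A), inferInstance, ⟨fun _ _ _ => hZ.eq_of_src _ _⟩,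
        .zero _ ?_⟩
      exact (isZero_zero A).of_mono (kernel.ι _)
    | of X hX =>
      obtain ⟨i, -, ⟨e⟩⟩ := hX
      have := S.epi_q i
      exact ⟨S.P i, S.q i ≫ e.inv, S.filt_D_P i, S.projective i, epi_comp _ _,
        extClosure_of_iso (kernelCompMono (S.q i) e.inv).symm
          (extClosure_mono (fun _ ⟨j, _, e⟩ => ⟨j, trivial, e⟩) (S.filt_ker_q i))⟩
    | ext T hT _ _ h₁ h₃ =>
      obtain ⟨Q₁, f₁, hQ₁, _, _, hK₁⟩ := h₁
      obtain ⟨Q₃, f₃, hQ₃, _, _, hK₃⟩ := h₃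
      have := hT.epi_g
      obtain ⟨c, rfl⟩ := Projective.factors f₃ T.g
      obtain ⟨a, b, w, hab⟩ := exists_shortExact_horseshoe hT f₁ c
      exact ⟨Q₁ ⊞ Q₃, biprod.desc (f₁ ≫ T.f) c, extClosure_biprod hQ₁ hQ₃, inferInstance,
        epi_biprod_desc hT _ _, extClosure_ext hab hK₁ hK₃⟩

theorem exists_mono_to_injective (S : HighestWeightData L) (M : A) :
    ∃ (I : A) (f : M ⟶ I), Injective I ∧ Mono f := by
  induction S.length M with
  | zero Z hZ => exact ⟨0, 0, inferInstance, ⟨fun _ _ _ => hZ.eq_of_tgt _ _⟩⟩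
  | of X hX =>
    obtain ⟨i, -, ⟨e⟩⟩ := hX
    have := (S.hull i).mono
    exact ⟨S.I i, e.hom ≫ S.m i, (S.hull i).injective, mono_comp _ _⟩
  | ext T hT _ _ h₁ h₃ =>
    obtain ⟨I₁, f₁, _, _⟩ := h₁
    obtain ⟨I₃, f₃, _, _⟩ := h₃
    have := hT.mono_f
    have : Mono (T.f ≫ Injective.factorThru f₁ T.f) := by
      rwa [Injective.comp_factorThru]
    exact ⟨I₁ ⊞ I₃, biprod.lift (Injective.factorThru f₁ T.f) (T.g ≫ f₃), inferInstance,
      mono_biprod_lift hT _ _⟩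

/-- Objects filtered by costandard objects have injective resolutions within the category of these
objects. -/
theorem hasInjectiveResolutions [HasExt.{w} A] [Finite Λ] {k : Type u} [Field k] [IsAlgClosed k]
    [Linear k A] (hfin : ∀ X Y : A, Module.Finite k (X ⟶ Y)) {G : A} [Projective G]
    (hG : IsSeparator G) : HasInjectiveResolutions (Filt S.N Set.univ) := by
  have hI : ∀ (Z I : A) [Injective I], ExtZero.{u₁, v₁, w} 1 Z I :=
    fun Z I _ x => Abelian.Ext.eq_zero_of_injective x
  have hN : ∀ (I : A) [Injective I], Filt S.N Set.univ I := fun I _ =>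
    S.filt_N_of_extZero.{u, u₁, v₁, w} (k := k) hfin hG fun i => hI _ _
  refine ⟨fun M => ?_, fun X hX => ?_⟩
  · obtain ⟨I, f, _, hf⟩ := S.exists_mono_to_injective M
    exact ⟨I, f, hN I, inferInstance, hf⟩
  · obtain ⟨I, f, _, hf⟩ := S.exists_mono_to_injective X
    refine ⟨I, f, hN I, inferInstance, hf,
      S.filt_N_of_extZero.{u, u₁, v₁, w} (k := k) hfin hG fun i => ?_⟩
    exact extZero_quotient (shortExact_cokernel f) (hI _ _)
      (extZero_right hX fun _ ⟨j, _, ⟨e⟩⟩ => (S.extZero_two_D_N i j).of_iso_right e.symm)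

end HighestWeightData

end HighestWeight

/-! ### Standard and costandard objects as exceptional sequences -/

section Uniqueness

variable {A : Type u₁} [Category.{v₁} A] [Abelian A] {Λ : Type w} [PartialOrder Λ] {L : Λ → A}

/-- Any two standard objects for `i` are quotients of each other, as the projective covers of `L i`
are. -/
theorem IsStandard.exists_epi {i : Λ} {D D' : A} (h : IsStandard L i D) (h' : IsStandard L i D') :
    ∃ g : D ⟶ D', Epi g := by
  obtain ⟨P, p, q, hp, -, -, hmax⟩ := h
  obtain ⟨P', p', q', hp', hq', hD', -⟩ := h'
  have := hp.projective
  have := hp'.epi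
  let a : P ⟶ P' := Projective.factorThru p p'
  have : Epi a := hp'.essential _ _ (by rw [Projective.factorThru_comp]; exact hp.epi)
  obtain ⟨g, hg⟩ := hmax _ (a ≫ q') (epi_comp _ _) hD'
  have : Epi (q ≫ g) := by
    rw [hg]
    infer_instance
  exact ⟨g, epi_of_epi q g⟩

theorem IsCostandard.exists_mono {i : Λ} {N N' : A} (h : IsCostandard L i N)
    (h' : IsCostandard L i N') : ∃ g : N ⟶ N', Mono g := by
  obtain ⟨I, m, n, hm, hn, hN, -⟩ := h
  obtain ⟨I', m', n', hm', -, -, hmax⟩ := h'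
  have := hm'.injective
  have := hm.mono
  let a : I ⟶ I' := Injective.factorThru m' m
  have : Mono a := hm.essential _ _ (by rw [Injective.comp_factorThru]; exact hm'.mono)
  obtain ⟨g, hg⟩ := hmax _ (n ≫ a) (mono_comp _ _) hN
  have : Mono (g ≫ n') := by
    rw [hg]
    infer_instance
  exact ⟨g, mono_of_mono g n'⟩

theorem IsStandard.of_iso {i : Λ} {D D' : A} (h : IsStandard L i D) (e : D ≅ D') :
    IsStandard L i D' := by
  obtain ⟨P, p, q, hp, hq, hD, hmax⟩ := h
  refine ⟨P, p, q ≫ e.hom, hp, epi_comp _ _, extClosure_of_iso e hD, fun Q f hf hQ => ?_⟩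
  obtain ⟨g, hg⟩ := hmax Q f hf hQ
  exact ⟨e.inv ≫ g, by simp [hg]⟩

theorem IsCostandard.of_iso {i : Λ} {N N' : A} (h : IsCostandard L i N) (e : N ≅ N') :
    IsCostandard L i N' := by
  obtain ⟨I, m, n, hm, hn, hN, hmax⟩ := h
  refine ⟨I, m, e.inv ≫ n, hm, mono_comp _ _, extClosure_of_iso e hN, fun Q f hf hQ => ?_⟩
  obtain ⟨g, hg⟩ := hmax Q f hf hQ
  exact ⟨g ≫ e.hom, by simp [hg]⟩

variable {k : Type u} [Field k] [Linear k A]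

theorem IsStandard.nonempty_iso (hfin : ∀ X Y : A, Module.Finite k (X ⟶ Y)) {G : A} [Projective G]
    (hG : IsSeparator G) {i : Λ} {D D' : A} (h : IsStandard L i D) (h' : IsStandard L i D') :
    Nonempty (D ≅ D') := by
  obtain ⟨g, _⟩ := h.exists_epi h'
  obtain ⟨g', _⟩ := h'.exists_epi h
  have := isIso_of_epi_of_finrank_le hfin hG g (finrank_hom_le_of_epi hfin g')
  exact ⟨asIso g⟩

theorem IsCostandard.nonempty_iso (hfin : ∀ X Y : A, Module.Finite k (X ⟶ Y)) {G : A}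
    (hG : IsSeparator G) {i : Λ} {N N' : A} (h : IsCostandard L i N) (h' : IsCostandard L i N') :
    Nonempty (N ≅ N') := by
  obtain ⟨g, _⟩ := h.exists_mono h'
  obtain ⟨g', _⟩ := h'.exists_mono h
  have := isIso_of_mono_of_finrank_le hfin hG g (finrank_hom_le_of_mono hfin g')
  exact ⟨asIso g⟩

/-- Choice of the objects attached to a highest weight category. Standard objects are unique up to
isomorphism, so that both axioms can be stated with the same `D i`. -/
theorem IsHighestWeight.exists_data (hA : IsHighestWeight L k) :
    ∃ S : HighestWeightData L,
      (∀ i Y, IsStandard L i Y ↔ Nonempty (Y ≅ S.D i)) ∧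
      (∀ i Y, IsCostandard L i Y ↔ Nonempty (Y ≅ S.N i)) := by
  have hfin := hA.deligneFinite.homFinite
  obtain ⟨G, _, hG⟩ := hA.deligneFinite.generator
  choose P p D hp hD q hq hker using hA.st2
  choose D' hD' e' he' hker' using hA.st1
  have iso : ∀ i, Nonempty (D i ≅ D' i) := fun i => (hD i).nonempty_iso hfin hG (hD' i)
  have hL : ∀ i, Simple (L i) := hA.simples.prop
  choose I m hm using fun i => exists_isInjectiveHull (k := k) hfin hG (L i)
  let S : SimpleData L :=
    { simple := hL
      inj := hA.simples.inj
      length := fun X => extClosure_mono (fun Y hY => by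
        obtain ⟨i, e⟩ := hA.simples.exhaust Y hY
        exact ⟨i, trivial, e⟩) (hA.deligneFinite.finite_length X)
      P := P
      p := p
      cover := hp }
  choose N n hn hN hmax using fun i => S.exists_max_subobject (k := k) hfin hG {j | j ≤ i} (I i)
  let S' : HighestWeightData L :=
    { S with
      D := D
      q := q
      epi_q := hq
      filt_ker_q := fun i => extClosure_mono (fun Y ⟨j, hj, hY⟩ =>
        ⟨j, hj, hY.nonempty_iso hfin hG (hD j)⟩) (hker i)
      e := fun i => (iso i).some.hom ≫ e' i
      epi_e := fun i => have := he' i; epi_comp _ _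
      filt_ker_e := fun i =>
        extClosure_of_iso (kernelIsIsoComp (iso i).some.hom (e' i)).symm (hker' i)
      I := I
      m := m
      hull := hm
      N := N
      n := n
      mono_n := hn
      filt_N := hN
      max_N := hmax }
  have hN' : ∀ i, IsCostandard L i (N i) := fun i => ⟨I i, m i, n i, hm i, hn i, hN i, hmax i⟩
  exact ⟨S', fun i Y => ⟨fun h => h.nonempty_iso hfin hG (hD i), fun ⟨e⟩ => (hD i).of_iso e.symm⟩,
    fun i Y => ⟨fun h => h.nonempty_iso hfin hG (hN' i), fun ⟨e⟩ => (hN' i).of_iso e.symm⟩⟩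

theorem IsHighestWeight.finite (hA : IsHighestWeight L k) : Finite Λ := by
  obtain ⟨n, X, hX⟩ := hA.deligneFinite.finite_simples
  choose f hf using fun i => hX (L i) (hA.simples.prop i)
  refine Finite.of_injective f fun i j h => hA.simples.inj i j ?_
  have hj := hf j
  rw [← h] at hj
  exact ⟨(hf i).some ≪≫ hj.some.symm⟩

end Uniqueness

theorem exists_linear_extension (Λ : Type w) [PartialOrder Λ] [Finite Λ] :
    ∃ (n : ℕ) (σ : Λ ≃ Fin n), ∀ i j, i ≤ j → σ i ≤ σ j := by
  have : Finite (LinearExtension Λ) := inferInstanceAs (Finite Λ)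
  have := Fintype.ofFinite (LinearExtension Λ)
  let τ := Fintype.orderIsoFinOfCardEq (LinearExtension Λ) rfl
  refine ⟨_, (show Λ ≃ LinearExtension Λ from Equiv.refl _).trans τ.symm.toEquiv, fun i j h => ?_⟩
  have h' : toLinearExtension i ≤ toLinearExtension j := toLinearExtension.monotone h
  exact τ.symm.monotone h'

section Exceptional

variable {A : Type u₁} [Category.{v₁} A] [Abelian A] [HasExt.{w'} A] {k : Type u} [Field k]
  [Linear k A]

/-- The extension closure of an exceptional family, indexed by a finite set in bijection with an
initial segment of the natural numbers. -/
theorem IsExceptional.isThin_and_isRepresentativeFamily {Λ : Type w} {X : Λ → A} {n : ℕ}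
    (σ : Λ ≃ Fin n) (hX : IsExceptional.{u, u₁, v₁, w'} k (X ∘ σ.symm))
    (hfin : ∀ X Y : A, Module.Finite k (X ⟶ Y))
    (hext : ∀ X Y : A, (abelianExact A).ExtFinite k X Y)
    {C : ObjectProperty A} (hC : ∀ Y, C Y ↔ ∃ i, Nonempty (Y ≅ X i))
    (hP : (abelianExact A).IsFullyExact ((abelianExact A).ExtClosure C)) :
    ((abelianExact A).induced _ hP).IsThin k ∧
      IsRepresentativeFamily (fun Y => ((abelianExact A).induced _ hP).IsIrreducible Y)
        (fun i => ⟨X i, .of _ ((hC _).2 ⟨i, ⟨Iso.refl _⟩⟩)⟩) := by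
  have hC' : ∀ Y, C Y ↔ ∃ a, Nonempty (Y ≅ (X ∘ σ.symm) a) := fun Y => by
    rw [hC, σ.symm.surjective.exists]
    rfl
  refine ⟨hX.isThin hfin hext hC' hP, ?_⟩
  have h := hX.isRepresentativeFamily hC' hP
  refine ⟨fun i => ?_, fun i j ⟨e⟩ => ?_, fun Y hY => ?_⟩
  · have := h.prop (σ i)
    simpa using this
  · refine σ.injective (h.inj (σ i) (σ j) ?_)
    simpa using (⟨e⟩ : Nonempty _)
  · obtain ⟨a, e⟩ := h.exhaust Y hY
    exact ⟨σ.symm a, e⟩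

end Exceptional

end ExactCat

theorem mainTheorem2 {k : Type u} [Field k] [IsAlgClosed k]
    {A : Type u₁} [Category.{v₁} A] [Abelian A] [Linear k A]
    {Λ : Type w} [PartialOrder Λ] (L : Λ → A) (hA : ExactCat.IsHighestWeight L k) :
    -- `F(Δ)` is thin with irreducible objects the `Δ(i)`
    ((ExactCat.exactFDelta L).IsThin k ∧
      ∃ D : Λ → (ExactCat.FDelta L).FullSubcategory,
        (∀ i, ExactCat.IsStandard L i (D i).obj) ∧
        ExactCat.IsRepresentativeFamily (fun X => (ExactCat.exactFDelta L).IsIrreducible X) D) ∧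
    -- `F(∇)` is thin with irreducible objects the `∇(i)`
    ((ExactCat.exactFNabla L).IsThin k ∧
      ∃ N : Λ → (ExactCat.FNabla L).FullSubcategory,
        (∀ i, ExactCat.IsCostandard L i (N i).obj) ∧
        ExactCat.IsRepresentativeFamily (fun X => (ExactCat.exactFNabla L).IsIrreducible X) N) ∧
    -- the envelopes
    ExactCat.IsRightAbelianEnvelope.{u₁, v₁, u₁, v₁, u₃, v₃}
      (ExactCat.exactFDelta L) (ExactCat.FDelta L).ι ∧
    ExactCat.IsLeftAbelianEnvelope.{u₁, v₁, u₁, v₁, u₃, v₃}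
      (ExactCat.exactFNabla L) (ExactCat.FNabla L).ι := by
  open ExactCat in
  have hfin := hA.deligneFinite.homFinite
  have hext := hA.deligneFinite.extFinite
  obtain ⟨G, _, hG⟩ := hA.deligneFinite.generator
  have : Finite Λ := hA.finite
  have : HasExt.{max u₁ v₁} A := HasExt.standard A
  obtain ⟨S, hD, hN⟩ := hA.exists_data
  obtain ⟨n, σ, hσ⟩ := exists_linear_extension Λ
  have hσ_lt : ∀ {a b}, a < b → ¬ σ.symm b ≤ σ.symm a := fun {a b} hab h => by
    have := hσ _ _ h
    rw [σ.apply_symm_apply, σ.apply_symm_apply] at this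
    exact this.not_gt hab
  have hσ_le : ∀ {a b}, a ≤ b → ¬ σ.symm b < σ.symm a := fun hab h => by
    obtain hab | rfl := hab.lt_or_eq
    · exact hσ_lt hab h.le
    · exact lt_irrefl _ h
  have hD' : ∀ Y, (∃ i, IsStandard L i Y) ↔ ∃ i, Nonempty (Y ≅ S.D i) := fun Y => by
    simp only [hD]
  have hN' : ∀ Y, (∃ i, IsCostandard L i Y) ↔ ∃ i, Nonempty (Y ≅ S.N i) := fun Y => by
    simp only [hN]
  -- the standard objects form an exceptional sequence in the opposite order
  have hDσ : IsExceptional.{u, u₁, v₁, max u₁ v₁} k (S.D ∘ (σ.trans Fin.revPerm).symm) :=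
    { homZero := fun a b h => S.homZero_D_D (hσ_lt (Fin.rev_lt_rev.2 h))
      extZero := fun a b h => S.extZero_D_D (hσ_le (Fin.rev_le_rev.2 h))
      nonzero := fun a => S.D_nonzero _
      scalar := fun a => S.exists_smul_id_D hfin }
  have hNσ : IsExceptional.{u, u₁, v₁, max u₁ v₁} k (S.N ∘ σ.symm) :=
    { homZero := fun a b h => S.homZero_N_N (hσ_lt h)
      extZero := fun a b h => S.extZero_N_N (hσ_le h)
      nonzero := fun a => S.N_nonzero _
      scalar := fun a => S.exists_smul_id_N hfin }
  have eD : Filt S.D Set.univ = FDelta L :=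
    funext fun X => propext ⟨extClosure_of_filt hD', filt_univ hD'⟩
  have eN : Filt S.N Set.univ = FNabla L :=
    funext fun X => propext ⟨extClosure_of_filt hN', filt_univ hN'⟩
  have resD := S.hasProjectiveResolutions
  have resN := S.hasInjectiveResolutions.{u, u₁, v₁, max u₁ v₁} (k := k) hfin hG
  rw [eD] at resD
  rw [eN] at resN
  obtain ⟨thinD, irrD⟩ := hDσ.isThin_and_isRepresentativeFamily _ hfin hext hD'
    ((abelianExact A).extClosure_isFullyExact _)
  obtain ⟨thinN, irrN⟩ := hNσ.isThin_and_isRepresentativeFamily _ hfin hext hN'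
    ((abelianExact A).extClosure_isFullyExact _)
  exact ⟨⟨thinD, _, fun i => (hD i _).2 ⟨Iso.refl _⟩, irrD⟩,
    ⟨thinN, _, fun i => (hN i _).2 ⟨Iso.refl _⟩, irrN⟩,
    resD.isRightAbelianEnvelope _, resN.isLeftAbelianEnvelope _⟩
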